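/- **Conventions.** Write $z=(z_1,z_2)\in\mathbb C^2$ and $\mathbf o=(0,0)$. A mixed polynomial is a polynomial in $z_1,z_2,\bar z_1,\bar z_2$ with complex coefficients, regarded as a map $\mathbb C^2=\mathbb R^4\to\mathbb C=\mathbb R^2$. A point $w$ is a *singularity* of such a map $F$ if the gradients of $\Re F$ and $\Im F$ at $w$ are linearly dependent over $\mathbb R$. It is an *indefinite fold singularity* if there are smooth local coordinates of $\mathbb R^4$ centred at $w$ and of $\mathbb R^2$ centred at $F(w)$ in which $F$ has the form $(x_1,x_2,x_3,x_4)\mapsto(x_1,\pm x_2^2\pm x_3^2\pm x_4^2)$ with both signs occurring. A complex polynomial $f(z_1,z_2)$ is *convenient* if neither $f(z_1,0)$ nor $f(0,z_2)$ vanishes identically. **Theorem.** Let $p,q$ be coprime positive integers and let $m\neq n$ be positive integers. Let $f,g\in\mathbb C[z_1,z_2]$ be convenient and weighted homogeneous with the same weights: $f(c^qz_1,c^pz_2)=c^{pqm}f(z_1,z_2)$ and $g(c^qz_1,c^pz_2)=c^{pqn}g(z_1,z_2)$ for all $c\in\mathbb C^*$. Assume that $f\bar g$ has an isolated singularity at $\mathbf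 o$. Suppose first that $m>n$. Then there are $\gamma_1,\gamma_2\in\mathbb C\setminus\{0\}$, a neighbourhood $U$ of $\mathbf o$ and $t_0>0$ such that, for every $0<t<t_0$, every singularity of the deformation $$F_t(z)=f(z)\overline{g(z)}+t\,h(z)$$ in $U\setminus\{\mathbf o\}$ is an indefinite fold singularity, where 1. $h(z)=\gamma_1z_1^{p(m-n)}+\gamma_2z_2^{q(m-n)}$ if $g$ is not of the form $\beta_1z_1+\beta_2z_2$; 2. $h(z)=z_1^m\bar z_1+\gamma_1z_1^{m-1}+\gamma_2z_2^{m-1}$ if $g=\beta_1z_1+\beta_2z_2$ for some $\beta_1,\beta_2\in\mathbb C$. If $m<n$, the same holds for $F_t=f\bar g+t\,\bar h$, with $h$ as above for the pair $(g,f)$, that is, with $(f,m)$ and $(g,n)$ interchanged in the description of $h$. -/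

import Mathlib

open scoped ContDiff Topology

noncomputable section

/-- Mixed polynomials in two variables: polynomials in `z₁, z₂` (the variables `Sum.inl j`)
and in the conjugates `z̄₁, z̄₂` (the variables `Sum.inr j`). -/
abbrev MixedPoly : Type := MvPolynomial (Fin 2 ⊕ Fin 2) ℂ

namespace MixedPoly

/-- The function `ℂ² → ℂ` defined by a mixed polynomial. -/
def toFun (P : MixedPoly) (z : Fin 2 → ℂ) : ℂ :=
  MvPolynomial.eval (Sum.elim z (fun j => (starRingEnd ℂ) (z j))) P

/-- A complex polynomial, regarded as a mixed polynomial. -/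
def ofComplex (f : MvPolynomial (Fin 2) ℂ) : MixedPoly :=
  MvPolynomial.rename Sum.inl f

/-- The complex conjugate of a mixed polynomial. -/
def conj (P : MixedPoly) : MixedPoly :=
  MvPolynomial.rename Sum.swap (MvPolynomial.map (starRingEnd ℂ) P)

/-- The variable `z_j`. -/
def z (j : Fin 2) : MixedPoly := MvPolynomial.X (Sum.inl j)

/-- The variable `z̄_j`. -/
def zbar (j : Fin 2) : MixedPoly := MvPolynomial.X (Sum.inr j)

/-- A complex constant. -/
def const (c : ℂ) : MixedPoly := MvPolynomial.C c

theorem toFun_ofComplex (f : MvPolynomial (Fin 2) ℂ) (w : Fin 2 → ℂ) :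
    toFun (ofComplex f) w = MvPolynomial.eval w f := by
  simp only [toFun, ofComplex, MvPolynomial.eval_rename]
  rfl

theorem toFun_conj (P : MixedPoly) (w : Fin 2 → ℂ) :
    toFun (conj P) w = (starRingEnd ℂ) (toFun P w) := by
  simp only [toFun, conj, MvPolynomial.eval_rename, MvPolynomial.eval_map]
  rw [← MvPolynomial.eval₂_id, MvPolynomial.hom_eval₂, RingHom.comp_id]
  congr 1
  funext i
  rcases i with i | i <;> simp

end MixedPoly

/-- `w` is a singularity of `F = (Re F, Im F)`: the differentials of `Re F` and `Im F` at `w`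
are linearly dependent over `ℝ`. -/
def IsSingularity (F : (Fin 2 → ℂ) → ℂ) (w : Fin 2 → ℂ) : Prop :=
  ¬ LinearIndependent ℝ
    ![fderiv ℝ (fun z => (F z).re) w, fderiv ℝ (fun z => (F z).im) w]

/-- `w` is an isolated singularity of `F`. -/
def IsIsolatedSingularity (F : (Fin 2 → ℂ) → ℂ) (w : Fin 2 → ℂ) : Prop :=
  IsSingularity F w ∧ ∀ᶠ z in 𝓝[≠] w, ¬ IsSingularity F z

/-- `w` is an indefinite fold singularity of `F : ℂ² = ℝ⁴ → ℂ = ℝ²`: in smooth local coordinates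
`φ = (x₁, x₂, x₃, x₄)` centred at `w` and `ψ` centred at `F w`, the map `F` has the form
`(x₁, ± x₂² ± x₃² ± x₄²)`, with both signs occurring. -/
def IsIndefiniteFold (F : (Fin 2 → ℂ) → ℂ) (w : Fin 2 → ℂ) : Prop :=
  ∃ (φ : OpenPartialHomeomorph (Fin 2 → ℂ) (Fin 4 → ℝ)) (ψ : OpenPartialHomeomorph ℂ (ℝ × ℝ))
    (ε : Fin 3 → ℝ),
    w ∈ φ.source ∧ φ w = 0 ∧ F w ∈ ψ.source ∧ ψ (F w) = 0 ∧
    ContDiffOn ℝ ∞ φ φ.source ∧ ContDiffOn ℝ ∞ φ.symm φ.target ∧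
    ContDiffOn ℝ ∞ ψ ψ.source ∧ ContDiffOn ℝ ∞ ψ.symm ψ.target ∧
    Set.MapsTo F φ.source ψ.source ∧
    (∀ i, ε i = 1 ∨ ε i = -1) ∧ (∃ i, ε i = 1) ∧ (∃ i, ε i = -1) ∧
    ∀ z ∈ φ.source, ψ (F z) = (φ z 0, ∑ i : Fin 3, ε i * (φ z i.succ) ^ 2)

/-- `f` does not vanish identically on any coordinate axis. -/
def IsConvenient (f : MvPolynomial (Fin 2) ℂ) : Prop :=
  ∀ j : Fin 2, ∃ c : ℂ, MvPolynomial.eval (Pi.single j c) f ≠ 0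

/-- `g = β₁ z₁ + β₂ z₂`. -/
def IsLinearForm (g : MvPolynomial (Fin 2) ℂ) : Prop :=
  ∃ β₁ β₂ : ℂ, g = MvPolynomial.C β₁ * MvPolynomial.X 0 + MvPolynomial.C β₂ * MvPolynomial.X 1

/-- The shape of the deformation term `h` for `f ḡ`, where `f`, `g` have degrees `p q m`,
`p q n` with `n < m`. -/
def IsDeformationTerm (p q m n : ℕ) (g : MvPolynomial (Fin 2) ℂ) (h : MixedPoly) : Prop :=
  ∃ γ₁ γ₂ : ℂ, γ₁ ≠ 0 ∧ γ₂ ≠ 0 ∧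
    (¬ IsLinearForm g →
      h = MixedPoly.const γ₁ * MixedPoly.z 0 ^ (p * (m - n)) +
        MixedPoly.const γ₂ * MixedPoly.z 1 ^ (q * (m - n))) ∧
    (IsLinearForm g →
      h = MixedPoly.z 0 ^ m * MixedPoly.zbar 0 +
        MixedPoly.const γ₁ * MixedPoly.z 0 ^ (m - 1) +
        MixedPoly.const γ₂ * MixedPoly.z 1 ^ (m - 1))

/-- On some neighbourhood `U` of the origin, for all sufficiently small `t > 0`, every singularity
of `F_t = P + t h` in `U ∖ {o}` is an indefinite fold singularity. -/
def DeformsToIndefiniteFolds (P h : MixedPoly) : Prop :=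
  ∃ U ∈ 𝓝 (0 : Fin 2 → ℂ), ∃ t₀ : ℝ, 0 < t₀ ∧ ∀ t : ℝ, 0 < t → t < t₀ →
    ∀ w ∈ U, w ≠ 0 →
      IsSingularity (MixedPoly.toFun (P + MixedPoly.const (t : ℂ) * h)) w →
      IsIndefiniteFold (MixedPoly.toFun (P + MixedPoly.const (t : ℂ) * h)) w

end

open scoped ContDiff Topology

set_option maxSynthPendingDepth 3

/-! Let m > n and G = f ḡ + h with h = γ₁z₁^(p(m-n)) + γ₂z₂^(q(m-n)). The map G is equivariant of
weight k = pq(m-n) ≠ 0 under the weighted circle action, and a real dilation turns f ḡ + t h into a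
constant multiple of G. So it suffices to study all singularities of G off the origin.

Fold criterion: at a singularity the image of dG is orthogonal to a unit vector ζ. Since dG sends
the orbit direction to ikG, this forces G ∈ ℝζ, and |G|² is critical. Every orbit meets the slice
where z₁ is real and nonnegative. If z₁ > 0, G ≠ 0 and the Hessian of |G|² on the slice is
nondegenerate and indefinite, polar coordinates in the target and the Morse lemma on the slice give
the normal form (`isIndefiniteFold_of_isSliceFold`).

Indefiniteness follows from nondegeneracy (`isSliceFold_of_nondegenerate`): dG vanishes on the
kernel of dg, and there the Hessian of |G|² changes sign under v ↦ iv.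

Genericity (`exists_generic_deformation`): where z₁z₂ ≠ 0, the singular equations at (z, ζ) can be
solved for (γ₁, γ₂). This gives a map between real 4-dimensional spaces, and a null vector of the
Hessian yields a null vector of its differential, so Sard's theorem excludes degenerate Hessians. If
moreover G = 0, Euler's identity eliminates ζ when fg ≠ 0, and the parameters lie in a null set;
when fg = 0 they lie on finitely many lines. An open condition on γ₁, γ₂ excludes singularities on
the axes. An open set is not covered by null sets.

If g is linear, then p = q = n = 1 and rescaling gives G + t z₁^m z̄₁. The fold condition is stable
over compact sets, and for small t the singularities stay in a fixed annulus (`exists_annulus`):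
near the origin h dominates, far away f ḡ does, and neither is singular off the origin. The case m <
n follows by complex conjugation. -/

/-! ### Inverse function theorem and integrals with parameters -/

/-- The inverse function theorem, packaged as a smooth chart. -/
theorem exists_smooth_chart {E F : Type*} [NormedAddCommGroup E] [NormedSpace ℝ E]
    [FiniteDimensional ℝ E] [NormedAddCommGroup F] [NormedSpace ℝ F] [FiniteDimensional ℝ F]
    {f : E → F} {U : Set E} (hU : IsOpen U) {a : E} (ha : a ∈ U) (hf : ContDiffOn ℝ ∞ f U)
    (hinj : Function.Injective (fderiv ℝ f a))
    (hdim : Module.finrank ℝ E = Module.finrank ℝ F) :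
    ∃ e : OpenPartialHomeomorph E F, a ∈ e.source ∧ e.source ⊆ U ∧ (∀ x, e x = f x) ∧
      ContDiffOn ℝ ∞ e e.source ∧ ContDiffOn ℝ ∞ e.symm e.target := by
  have : CompleteSpace E := FiniteDimensional.complete ℝ E
  have : CompleteSpace F := FiniteDimensional.complete ℝ F
  have hfa : ∀ x ∈ U, ContDiffAt ℝ ∞ f x := fun x hx => hf.contDiffAt (hU.mem_nhds hx)
  have hone : (∞ : WithTop ℕ∞) ≠ 0 := by simp
  let L : E ≃L[ℝ] F :=
    (LinearMap.linearEquivOfInjective (fderiv ℝ f a).toLinearMap hinj hdim).toContinuousLinearEquiv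
  have hL : (L : E →L[ℝ] F) = fderiv ℝ f a := by ext x; rfl
  have hd : HasFDerivAt f (L : E →L[ℝ] F) a := by
    rw [hL]; exact ((hfa a ha).differentiableAt hone).hasFDerivAt
  let e₀ := (hfa a ha).toOpenPartialHomeomorph f hd hone
  have hcont : ContinuousOn (fderiv ℝ f) U := hf.continuousOn_fderiv_of_isOpen hU (by simp)
  -- Restricting to points with invertible differential makes the inverse smooth on the whole
  -- target, not only near the image of a.
  let V := U ∩ fderiv ℝ f ⁻¹' (Set.range ((↑) : (E ≃L[ℝ] F) → E →L[ℝ] F))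
  have hV : IsOpen V := hcont.isOpen_inter_preimage hU ContinuousLinearEquiv.isOpen
  have haV : a ∈ V := ⟨ha, L, hL⟩
  refine ⟨e₀.restrOpen V hV, ?_, ?_, fun x => rfl, ?_, ?_⟩
  · rw [OpenPartialHomeomorph.restrOpen_source]
    exact ⟨(hfa a ha).mem_toOpenPartialHomeomorph_source hd hone, haV⟩
  · rw [OpenPartialHomeomorph.restrOpen_source]
    exact fun x hx => hx.2.1
  · rw [OpenPartialHomeomorph.restrOpen_source]
    exact hf.mono fun x hx => hx.2.1
  · intro y hy
    have hx := (e₀.restrOpen V hV).map_target hy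
    rw [OpenPartialHomeomorph.restrOpen_source] at hx
    obtain ⟨-, hxU, L', hL'⟩ := hx
    have hc := hfa _ hxU
    refine ((e₀.restrOpen V hV).contDiffAt_symm (f₀' := L') hy ?_ hc).contDiffWithinAt
    rw [hL']
    exact (hc.differentiableAt hone).hasFDerivAt

theorem hasFDerivAt_intervalIntegral_param {E F : Type*} [NormedAddCommGroup E] [NormedSpace ℝ E]
    [FiniteDimensional ℝ E] [NormedAddCommGroup F] [NormedSpace ℝ F] [CompleteSpace F]
    {Φ : E × ℝ → F} (hΦ : ContDiff ℝ 1 Φ) (x₀ : E) :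
    HasFDerivAt (fun x => ∫ s in (0 : ℝ)..1, Φ (x, s))
      (∫ s in (0 : ℝ)..1, (fderiv ℝ Φ (x₀, s)).comp (ContinuousLinearMap.inl ℝ E ℝ)) x₀ := by
  have : ProperSpace E := FiniteDimensional.proper ℝ E
  have hc : Continuous fun z : E × ℝ => (fderiv ℝ Φ z).comp (ContinuousLinearMap.inl ℝ E ℝ) :=
    (hΦ.continuous_fderiv (by simp)).clm_comp continuous_const
  have hK : IsCompact (Metric.closedBall x₀ 1 ×ˢ Set.Icc (0 : ℝ) 1) :=
    (isCompact_closedBall _ _).prod isCompact_Icc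
  obtain ⟨C, hC⟩ := hK.exists_bound_of_continuousOn hc.continuousOn
  refine intervalIntegral.hasFDerivAt_integral_of_dominated_of_fderiv_le
    (s := Metric.closedBall x₀ 1) (bound := fun _ => C)
    (F' := fun x s => (fderiv ℝ Φ (x, s)).comp (ContinuousLinearMap.inl ℝ E ℝ))
    (Metric.closedBall_mem_nhds _ one_pos) ?_ ?_ ?_ ?_ ?_ ?_
  · exact Filter.Eventually.of_forall fun x =>
      (hΦ.continuous.comp (by fun_prop : Continuous fun s : ℝ => (x, s))).aestronglyMeasurable
  · exact (hΦ.continuous.comp (by fun_prop : Continuous fun s : ℝ => (x₀, s))).intervalIntegrable _ _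
  · exact (hc.comp (by fun_prop : Continuous fun s : ℝ => (x₀, s))).aestronglyMeasurable
  · refine Filter.Eventually.of_forall fun s hs x hx => hC (x, s) ⟨hx, ?_⟩
    rw [Set.uIoc_of_le zero_le_one] at hs
    exact ⟨hs.1.le, hs.2⟩
  · exact intervalIntegrable_const
  · refine Filter.Eventually.of_forall fun s _ x _ => ?_
    exact ((hΦ.differentiable (by simp) (x, s)).hasFDerivAt).comp x (hasFDerivAt_prodMk_left x s)

/-- Induction on the order: the derivative is again such an integral, with values in `E →L[ℝ] F`.
Hence F is quantified inside the induction, and both spaces lie in `Type` so that the operator space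
stays in the same universe. -/
theorem contDiff_intervalIntegral_param {E : Type} [NormedAddCommGroup E] [NormedSpace ℝ E]
    [FiniteDimensional ℝ E] (n : ℕ) : ∀ {F : Type} [NormedAddCommGroup F] [NormedSpace ℝ F]
    [CompleteSpace F] {Φ : E × ℝ → F}, ContDiff ℝ n Φ →
    ContDiff ℝ n (fun x => ∫ s in (0 : ℝ)..1, Φ (x, s)) := by
  induction n with
  | zero =>
    intro F _ _ _ Φ hΦ
    rw [Nat.cast_zero, contDiff_zero] at hΦ ⊢
    exact intervalIntegral.continuous_parametric_intervalIntegral_of_continuous' (by simpa [Function.uncurry_def] using hΦ) 0 1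
  | succ n ih =>
    intro F _ _ _ Φ hΦ
    have hd := hasFDerivAt_intervalIntegral_param
      (hΦ.of_le (by exact_mod_cast Nat.le_add_left 1 n))
    have hs : ContDiff ℝ ((n : WithTop ℕ∞) + 1) Φ := by exact_mod_cast hΦ
    push_cast
    rw [contDiff_succ_iff_fderiv]
    refine ⟨fun x => (hd x).differentiableAt, by simp, ?_⟩
    rw [show fderiv ℝ (fun x => ∫ s in (0 : ℝ)..1, Φ (x, s)) = _ from
      funext fun x => (hd x).fderiv]
    exact ih (Φ := fun z => (fderiv ℝ Φ z).comp (ContinuousLinearMap.inl ℝ E ℝ))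
      ((hs.fderiv_right le_rfl).clm_comp contDiff_const)

theorem clm_intervalIntegral_param {E W : Type*} [TopologicalSpace E] [NormedAddCommGroup W]
    [NormedSpace ℝ W] [CompleteSpace W] {Φ : E × ℝ → W} (hΦ : Continuous Φ) (ℓ : W →L[ℝ] ℝ)
    (x : E) : ℓ (∫ s in (0 : ℝ)..1, Φ (x, s)) = ∫ s in (0 : ℝ)..1, ℓ (Φ (x, s)) :=
  (ℓ.intervalIntegral_comp_comm
    ((hΦ.comp (by fun_prop : Continuous fun s : ℝ => (x, s))).intervalIntegrable _ _)).symm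

theorem intervalIntegral_two_mul_one_sub_smul {W : Type*} [NormedAddCommGroup W]
    [NormedSpace ℝ W] [CompleteSpace W] (c : W) :
    ∫ s in (0 : ℝ)..1, (2 * (1 - s)) • c = c := by
  have h1 : ∫ s in (0 : ℝ)..1, (2 * (1 - s)) = 1 := by
    rw [intervalIntegral.integral_const_mul, intervalIntegral.integral_sub (by simp) (by simp)]
    simp; norm_num
  rw [intervalIntegral.integral_smul_const, h1, one_smul]

theorem two_le_infty : (2 : WithTop ℕ∞) ≤ ∞ := WithTop.coe_le_coe.2 le_top

/-! ### The Morse lemma -/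

/-- Second order Taylor expansion with a smooth quadratic remainder. -/
theorem exists_smooth_quadratic_remainder {E : Type} [NormedAddCommGroup E] [NormedSpace ℝ E]
    [FiniteDimensional ℝ E] {A : E → ℝ} (hA : ContDiff ℝ ∞ A) (a : E) (ha : fderiv ℝ A a = 0) :
    ∃ H : E → E →L[ℝ] E →L[ℝ] ℝ, ContDiff ℝ ∞ H ∧ H 0 = fderiv ℝ (fderiv ℝ A) a ∧
      (∀ x u v, H x u v = H x v u) ∧ ∀ x, A (a + x) - A a = 2⁻¹ * H x x x := by
  have hA1 : ContDiff ℝ ∞ (fderiv ℝ A) := hA.fderiv_right (by simp)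
  have hA2 : ContDiff ℝ ∞ (fderiv ℝ (fderiv ℝ A)) := hA1.fderiv_right (by simp)
  -- This is the integral form of the Taylor remainder; the weight 2(1-s) has integral 1, which
  -- gives H 0 = D²A(a).
  let Φ : E × ℝ → E →L[ℝ] E →L[ℝ] ℝ :=
    fun z => (2 * (1 - z.2)) • fderiv ℝ (fderiv ℝ A) (a + z.2 • z.1)
  have hΦ : ContDiff ℝ ∞ Φ := by
    have h1 : ContDiff ℝ ∞ fun z : E × ℝ => 2 * (1 - z.2) := by fun_prop
    have h2 : ContDiff ℝ ∞ fun z : E × ℝ => a + z.2 • z.1 := by fun_prop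
    exact h1.smul (hA2.comp h2)
  have happ : ∀ x u v, (∫ s in (0 : ℝ)..1, Φ (x, s)) u v = ∫ s in (0 : ℝ)..1, Φ (x, s) u v :=
    fun x u v => clm_intervalIntegral_param hΦ.continuous
      ((ContinuousLinearMap.apply ℝ ℝ v).comp (ContinuousLinearMap.apply ℝ (E →L[ℝ] ℝ) u)) x
  refine ⟨fun x => ∫ s in (0 : ℝ)..1, Φ (x, s), ?_, ?_, ?_, ?_⟩
  · rw [contDiff_infty]
    exact fun n => contDiff_intervalIntegral_param n
      (hΦ.of_le (WithTop.coe_le_coe.2 le_top))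
  · simp only [Φ, smul_zero, add_zero]
    exact intervalIntegral_two_mul_one_sub_smul _
  · intro x u v
    simp only [happ]
    refine intervalIntegral.integral_congr fun s _ => ?_
    have hsymm : IsSymmSndFDerivAt ℝ A (a + s • x) :=
      hA.contDiffAt.isSymmSndFDerivAt (by simpa using two_le_infty)
    simp only [Φ, smul_apply]
    rw [hsymm.eq u v]
  · intro x
    have h := map_add_eq_sum_add_integral_iteratedFDeriv (f := A) (x := a) (y := x) (n := 1)
      (fun t _ => hA.contDiffAt.of_le (WithTop.coe_le_coe.2 le_top))
    simp only [happ]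
    rw [h]
    simp [Finset.sum_range_succ, ha, Φ, iteratedFDeriv_two_apply,
      intervalIntegral.integral_const_mul, mul_assoc]

/-- The differential of squaring at 1 is X ↦ 2X, so a smooth local square root exists there. -/
theorem injective_fderiv_mul_self_one {𝔸 : Type*} [NormedRing 𝔸] [NormedAlgebra ℝ 𝔸] :
    Function.Injective (fderiv ℝ (fun X : 𝔸 => X * X) 1) := by
  have h : HasFDerivAt (fun X : 𝔸 => X * X) _ 1 :=
    (hasFDerivAt_id (𝕜 := ℝ) (1 : 𝔸)).mul' (hasFDerivAt_id 1)
  rw [h.fderiv, injective_iff_map_eq_zero]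
  intro X hX
  simpa [← two_smul ℝ X] using hX

/-- Near `1`, an operator that is self-adjoint for a nondegenerate symmetric bilinear form `L` has a
smooth self-adjoint square root. -/
theorem exists_smooth_selfAdjoint_sqrt {E : Type*} [NormedAddCommGroup E] [NormedSpace ℝ E]
    [FiniteDimensional ℝ E] (L : E ≃L[ℝ] (E →L[ℝ] ℝ)) :
    ∃ (W : Set (E →L[ℝ] E)) (r : (E →L[ℝ] E) → E →L[ℝ] E), IsOpen W ∧ 1 ∈ W ∧
      ContDiffOn ℝ ∞ r W ∧ r 1 = 1 ∧ (∀ C ∈ W, r C * r C = C) ∧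
      ∀ C ∈ W, (∀ u v, L (C u) v = L u (C v)) → ∀ u v, L (r C u) v = L u (r C v) := by
  have hsq : ContDiff ℝ ∞ fun X : E →L[ℝ] E => X * X := contDiff_id.mul contDiff_id
  obtain ⟨s, h1, -, hs, -, hsm⟩ :=
    exists_smooth_chart isOpen_univ (Set.mem_univ 1) hsq.contDiffOn
      injective_fderiv_mul_self_one rfl
  let adj : (E →L[ℝ] E) → E →L[ℝ] E := fun X =>
    (L.symm : (E →L[ℝ] ℝ) →L[ℝ] E) ∘L ((ContinuousLinearMap.compL ℝ E E ℝ).flip X) ∘L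
      (L : E →L[ℝ] (E →L[ℝ] ℝ))
  have hadj : ∀ X u v, L (adj X u) v = L u (X v) := fun X u v => by simp [adj]
  have hadj_eq : ∀ X Y : E →L[ℝ] E, (∀ u v, L (Y u) v = L u (X v)) → adj X = Y := by
    intro X Y h
    ext u
    apply L.injective
    ext v
    rw [hadj, h]
  have hadjc : Continuous adj := by
    refine continuous_const.clm_comp (Continuous.clm_comp ?_ continuous_const)
    exact (ContinuousLinearMap.flip (ContinuousLinearMap.compL ℝ E E ℝ)).continuous
  have hs1 : s 1 = 1 := by rw [hs, one_mul]
  have h1t : (1 : E →L[ℝ] E) ∈ s.target := by simpa [hs1] using s.map_source h1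
  have hr1 : s.symm 1 = 1 := by simpa [hs1] using s.left_inv h1
  have hsqrt : ∀ C ∈ s.target, s.symm C * s.symm C = C := fun C hC => by
    rw [← hs]; exact s.right_inv hC
  refine ⟨s.target ∩ (fun C => adj (s.symm C)) ⁻¹' s.source, s.symm, ?_, ⟨h1t, ?_⟩,
    hsm.mono Set.inter_subset_left, hr1, fun C hC => hsqrt C hC.1, ?_⟩
  · exact (hadjc.comp_continuousOn s.symm.continuousOn).isOpen_inter_preimage s.open_target
      s.open_source
  · rw [Set.mem_preimage, hr1, hadj_eq 1 1 fun u v => rfl]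
    exact h1
  · rintro C ⟨hCt, hCs⟩ hC
    -- The adjoint of a root of a self-adjoint C is again a root of C. Squaring is injective on
    -- `s.source`, and the domain was cut down so that this adjoint lies there.
    have key : adj (s.symm C) = s.symm C := by
      refine s.injOn hCs (s.symm.map_source hCt) ?_
      rw [s.right_inv hCt, hs]
      refine Eq.trans (hadj_eq C _ fun u v => ?_).symm (hadj_eq C C hC)
      rw [mul_apply_eq_comp, hadj, hadj, ← mul_apply_eq_comp, hsqrt C hCt]
    intro u v
    conv_lhs => rw [← key]
    exact hadj _ u v

/-- The Morse lemma: near a nondegenerate critical point, a smooth function is a quadratic form in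
suitable smooth coordinates. -/
theorem exists_morse_chart {E : Type} [NormedAddCommGroup E] [NormedSpace ℝ E]
    [FiniteDimensional ℝ E] {A : E → ℝ} (hA : ContDiff ℝ ∞ A) (a : E) (ha : fderiv ℝ A a = 0)
    (hinj : Function.Injective (fderiv ℝ (fderiv ℝ A) a)) :
    ∃ e : OpenPartialHomeomorph E E, a ∈ e.source ∧ e a = 0 ∧ ContDiffOn ℝ ∞ e e.source ∧
      ContDiffOn ℝ ∞ e.symm e.target ∧
      ∀ x ∈ e.source, A x - A a = 2⁻¹ * fderiv ℝ (fderiv ℝ A) a (e x) (e x) := by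
  obtain ⟨H, hH, hH0, hHs, hHA⟩ := exists_smooth_quadratic_remainder hA a ha
  have hdim : Module.finrank ℝ E = Module.finrank ℝ (E →L[ℝ] ℝ) := by
    rw [← (LinearMap.toContinuousLinearMap : (E →ₗ[ℝ] ℝ) ≃ₗ[ℝ] (E →L[ℝ] ℝ)).finrank_eq]
    exact (Subspace.dual_finrank_eq (K := ℝ) (V := E)).symm
  let L : E ≃L[ℝ] (E →L[ℝ] ℝ) := (LinearMap.linearEquivOfInjective
    (fderiv ℝ (fderiv ℝ A) a).toLinearMap hinj hdim).toContinuousLinearEquiv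
  have hL : ∀ u, L u = fderiv ℝ (fderiv ℝ A) a u := fun u => rfl
  have hLs : ∀ u v, L u v = L v u := fun u v => by rw [hL, hL, ← hH0, hHs]
  obtain ⟨W, r, hW, h1W, hr, hr1, hrr, hrs⟩ := exists_smooth_selfAdjoint_sqrt L
  let C : E → E →L[ℝ] E := fun x => (L.symm : (E →L[ℝ] ℝ) →L[ℝ] E) ∘L H (x - a)
  have hC : ContDiff ℝ ∞ C :=
    contDiff_const.clm_comp (hH.comp (contDiff_id.sub contDiff_const))
  have hLC : ∀ x u v, L (C x u) v = H (x - a) u v := fun x u v => by simp [C]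
  have hCa : C a = 1 := by
    ext u
    apply L.injective
    ext v
    rw [hLC, sub_self, hH0, hL]
    rfl
  let U := C ⁻¹' W
  have hU : IsOpen U := hW.preimage hC.continuous
  have haU : a ∈ U := by simpa [U, hCa] using h1W
  -- With S = r (C x) self-adjoint, S² = C x and y = x - a, one has H(y)(y, y) = L(S²y, y) = L(Sy,
  -- Sy). So Sy is the required coordinate.
  let Φ : E → E := fun x => r (C x) (x - a)
  have hrC : ContDiffOn ℝ ∞ (fun x => r (C x)) U := hr.comp hC.contDiffOn fun x hx => hx
  have hΦ : ContDiffOn ℝ ∞ Φ U := hrC.clm_apply (contDiffOn_id.sub contDiffOn_const)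
  have hΦ' : HasFDerivAt Φ (ContinuousLinearMap.id ℝ E) a := by
    have h1 : HasFDerivAt (fun x => r (C x)) _ a :=
      ((hrC.contDiffAt (hU.mem_nhds haU)).differentiableAt (by simp)).hasFDerivAt
    refine (h1.clm_apply ((hasFDerivAt_id a).sub_const a)).congr_fderiv ?_
    ext u
    simp [hCa, hr1]
  obtain ⟨e, hae, heU, he, hes, het⟩ := exists_smooth_chart hU haU hΦ
    (by rw [hΦ'.fderiv]; exact Function.injective_id) rfl
  refine ⟨e, hae, by simp [he, Φ], hes, het, fun x hx => ?_⟩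
  have h := hHA (x - a)
  rw [add_sub_cancel] at h
  have hsa := hrs (C x) (heU hx) fun u v => by rw [hLC, hHs, ← hLC, hLs]
  have hsq := hrr (C x) (heU hx)
  rw [h, he, ← hL]
  congr 1
  rw [hsa, ← mul_apply_eq_comp, hsq, hLs, hLC]

/-- The Morse lemma with Sylvester's normal form of the Hessian. -/
theorem exists_indefinite_morse_chart {E : Type} [NormedAddCommGroup E] [NormedSpace ℝ E]
    [FiniteDimensional ℝ E] (hdim : Module.finrank ℝ E = 3) {A : E → ℝ} (hA : ContDiff ℝ ∞ A)
    (a : E) (ha : fderiv ℝ A a = 0) (hinj : Function.Injective (fderiv ℝ (fderiv ℝ A) a))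
    (hpos : ∃ v, 0 < fderiv ℝ (fderiv ℝ A) a v v) (hneg : ∃ v, fderiv ℝ (fderiv ℝ A) a v v < 0) :
    ∃ (e : OpenPartialHomeomorph E (Fin 3 → ℝ)) (ε : Fin 3 → ℝ), a ∈ e.source ∧ e a = 0 ∧
      ContDiffOn ℝ ∞ e e.source ∧ ContDiffOn ℝ ∞ e.symm e.target ∧
      (∀ i, ε i = 1 ∨ ε i = -1) ∧ (∃ i, ε i = 1) ∧ (∃ i, ε i = -1) ∧
      ∀ x ∈ e.source, A x - A a = ∑ i, ε i * (e x i) ^ 2 := by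
  obtain ⟨e, hae, hea, hes, het, heA⟩ := exists_morse_chart hA a ha hinj
  set D := fderiv ℝ (fderiv ℝ A) a with hD
  let B : LinearMap.BilinForm ℝ E :=
    LinearMap.mk₂ ℝ (fun u v => 2⁻¹ * D u v) (by intros; simp [mul_add]) (by intros; simp; ring)
      (by intros; simp [mul_add]) (by intros; simp; ring)
  have hBs : B.IsSymm := ⟨fun u v => by
    have hsymm : IsSymmSndFDerivAt ℝ A a :=
      hA.contDiffAt.isSymmSndFDerivAt (by simpa using two_le_infty)
    simp only [B, LinearMap.mk₂_apply, hD]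
    rw [hsymm.eq u v]⟩
  let Q : QuadraticForm ℝ E := LinearMap.BilinMap.toQuadraticMap B
  have hQ : ∀ v, Q v = 2⁻¹ * D v v := fun v => rfl
  have hsep : (QuadraticMap.associated (R := ℝ) Q).SeparatingLeft := by
    have : QuadraticMap.associated (R := ℝ) Q = B := QuadraticMap.associated_left_inverse ℝ hBs.eq
    rw [this]
    intro u hu
    apply (injective_iff_map_eq_zero _).1 hinj
    ext v
    simpa [B] using hu v
  obtain ⟨w, hw, ⟨I⟩⟩ := Q.equivalent_one_neg_one_weighted_sum_squared hsep
  obtain ⟨J, hJ⟩ : ∃ J : E ≃L[ℝ] (Fin (Module.finrank ℝ E) → ℝ),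
      ∀ v, 2⁻¹ * D v v = ∑ i, w i * (J v i) ^ 2 := by
    refine ⟨I.toLinearEquiv.toContinuousLinearEquiv, fun v => ?_⟩
    rw [← hQ, ← I.map_app v, QuadraticMap.weightedSumSquares_apply]
    simp [sq]
  -- The index type has to become `Fin 3`; everything that depends on it is generalized or discarded
  -- before rewriting.
  clear I
  revert w J
  rw [hdim]
  intro w hw J hJ
  refine ⟨e.trans J.toHomeomorph.toOpenPartialHomeomorph, w, ?_, ?_, ?_, ?_,
    fun i => (hw i).symm, ?_, ?_, ?_⟩
  · simpa using hae
  · simp [hea]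
  · simpa using J.contDiff.comp_contDiffOn hes
  · simp only [OpenPartialHomeomorph.coe_trans_symm, OpenPartialHomeomorph.trans_target]
    exact het.comp J.symm.contDiff.contDiffOn fun x hx => hx.2
  · by_contra! h
    obtain ⟨v, hv⟩ := hpos
    have h1 := hJ v
    have : ∑ i, w i * (J v i) ^ 2 ≤ 0 := Finset.sum_nonpos fun i _ => by
      rw [(hw i).resolve_right (h i)]; nlinarith [sq_nonneg (J v i)]
    linarith
  · by_contra! h
    obtain ⟨v, hv⟩ := hneg
    have h1 := hJ v
    have : 0 ≤ ∑ i, w i * (J v i) ^ 2 := Finset.sum_nonneg fun i _ => by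
      rw [(hw i).resolve_left (h i)]; positivity
    linarith
  · intro x hx
    rw [heA x (by simpa using hx), hJ]
    rfl

/-! ### The weighted action, the slice and local coordinates -/

/-- The weighted action `c ∘ (z₁, z₂) = (c^q z₁, c^p z₂)`. -/
def weightedAct (p q : ℕ) (c : ℂ) (z : Fin 2 → ℂ) : Fin 2 → ℂ := ![c ^ q * z 0, c ^ p * z 1]

/-- The embedding `(x, b) ↦ (x, b)` of the slice `ℝ × ℂ` into `ℂ²`. -/
noncomputable def slice : ℝ × ℂ →L[ℝ] (Fin 2 → ℂ) :=
  ContinuousLinearMap.pi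
    ![Complex.ofRealCLM.comp (ContinuousLinearMap.fst ℝ ℝ ℂ), ContinuousLinearMap.snd ℝ ℝ ℂ]

@[simp] theorem slice_zero (y : ℝ × ℂ) : slice y 0 = (y.1 : ℂ) := rfl

@[simp] theorem slice_one (y : ℝ × ℂ) : slice y 1 = y.2 := rfl

@[simp] theorem weightedAct_zero (p q : ℕ) (c : ℂ) (z : Fin 2 → ℂ) :
    weightedAct p q c z 0 = c ^ q * z 0 := rfl

@[simp] theorem weightedAct_one (p q : ℕ) (c : ℂ) (z : Fin 2 → ℂ) :
    weightedAct p q c z 1 = c ^ p * z 1 := rfl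

/-- The squared modulus of `G` on the slice. -/
noncomputable def sliceNormSq (G : (Fin 2 → ℂ) → ℂ) (y : ℝ × ℂ) : ℝ := Complex.normSq (G (slice y))

/-- At `y` the function `G` does not vanish, and the Hessian of its squared modulus on the slice is
nondegenerate and indefinite. -/
def IsSliceFold (G : (Fin 2 → ℂ) → ℂ) (y : ℝ × ℂ) : Prop :=
  0 < y.1 ∧ G (slice y) ≠ 0 ∧ Function.Injective (fderiv ℝ (fderiv ℝ (sliceNormSq G)) y) ∧
    (∃ v, 0 < fderiv ℝ (fderiv ℝ (sliceNormSq G)) y v v) ∧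
    ∃ v, fderiv ℝ (fderiv ℝ (sliceNormSq G)) y v v < 0

theorem contDiff_normSq : ContDiff ℝ ∞ Complex.normSq := by
  have : (Complex.normSq : ℂ → ℝ) = fun z => Complex.reCLM z * Complex.reCLM z +
      Complex.imCLM z * Complex.imCLM z := by
    ext z; simp [Complex.normSq_apply]
  rw [this]
  fun_prop

theorem contDiff_sliceNormSq {G : (Fin 2 → ℂ) → ℂ} (hG : ContDiff ℝ ∞ G) :
    ContDiff ℝ ∞ (sliceNormSq G) :=
  contDiff_normSq.comp (hG.comp slice.contDiff)

theorem HasDerivAt.normSq {w : ℝ → ℂ} {w' : ℂ} {s : ℝ} (h : HasDerivAt w w' s) :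
    HasDerivAt (fun s => Complex.normSq (w s)) (2 * ((starRingEnd ℂ) (w s) * w').re) s := by
  have h1 := Complex.reCLM.hasFDerivAt.comp_hasDerivAt s h
  have h2 := Complex.imCLM.hasFDerivAt.comp_hasDerivAt s h
  have : (fun s => Complex.normSq (w s)) =
      fun s => Complex.reCLM (w s) * Complex.reCLM (w s) +
        Complex.imCLM (w s) * Complex.imCLM (w s) := by
    ext z; simp [Complex.normSq_apply]
  rw [this]
  refine ((h1.mul h1).add (h2.mul h2)).congr_deriv ?_
  simp
  ring

theorem HasFDerivAt.hasDerivAt_line {E F : Type*} [NormedAddCommGroup E] [NormedSpace ℝ E]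
    [NormedAddCommGroup F] [NormedSpace ℝ F] {f : E → F} {f' : E →L[ℝ] F} {a : E}
    (h : HasFDerivAt f f' a) (v : E) : HasDerivAt (fun s : ℝ => f (a + s • v)) (f' v) 0 := by
  have hl : HasDerivAt (fun s : ℝ => a + s • v) v 0 := by
    simpa using ((hasDerivAt_id (0 : ℝ)).smul_const v).const_add a
  have h' : HasFDerivAt f f' (a + (0 : ℝ) • v) := by simpa using h
  exact h'.comp_hasDerivAt 0 hl

theorem injective_fderiv_openPartialHomeomorph {E F : Type*} [NormedAddCommGroup E]
    [NormedSpace ℝ E] [NormedAddCommGroup F] [NormedSpace ℝ F] (e : OpenPartialHomeomorph E F)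
    (he : ContDiffOn ℝ ∞ e e.source) (he' : ContDiffOn ℝ ∞ e.symm e.target) {a : E}
    (ha : a ∈ e.source) : Function.Injective (fderiv ℝ e a) := by
  have h1 := ((he.contDiffAt (e.open_source.mem_nhds ha)).differentiableAt (by simp)).hasFDerivAt
  have h2 := ((he'.contDiffAt (e.open_target.mem_nhds (e.map_source ha))).differentiableAt
    (by simp)).hasFDerivAt
  have h3 : HasFDerivAt id _ a := (h2.comp a h1).congr_of_eventuallyEq
    (by filter_upwards [e.open_source.mem_nhds ha] with x hx using (e.left_inv hx).symm)
  have h4 := h3.unique (hasFDerivAt_id a)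
  intro u v huv
  have := congrArg (fderiv ℝ e.symm (e a)) huv
  rw [← ContinuousLinearMap.comp_apply, ← ContinuousLinearMap.comp_apply, h4] at this
  simpa using this

theorem contDiffOn_im_log {E : Type*} [NormedAddCommGroup E] [NormedSpace ℝ E] {f : E → ℂ}
    {U : Set E} (hf : ContDiffOn ℝ ∞ f U) (hU : ∀ x ∈ U, f x ∈ Complex.slitPlane) :
    ContDiffOn ℝ ∞ (fun x => (Complex.log (f x)).im) U := fun x hx =>
  Complex.imCLM.contDiff.contDiffAt.comp_contDiffWithinAt x
    ((((Complex.contDiffAt_log (n := ∞) (hU x hx)).restrict_scalars ℝ)).comp_contDiffWithinAt x (hf x hx))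

theorem hasDerivAt_im_log {f : ℝ → ℂ} {f' : ℂ} (hf : HasDerivAt f f' 0) (h1 : f 0 = 1) :
    HasDerivAt (fun s => (Complex.log (f s)).im) f'.im 0 := by
  have := Complex.imCLM.hasFDerivAt.comp_hasDerivAt (0 : ℝ)
    (hf.clog_real (by rw [h1]; exact Complex.one_mem_slitPlane))
  simp only [h1, div_one] at this
  exact this

/-- Local polar coordinates `u ↦ (arg (u / a), (|u|² - |a|²) / ν)` around a point `a ≠ 0`. -/
theorem exists_polar_chart {a : ℂ} (ha : a ≠ 0) {ν : ℝ} (hν : ν ≠ 0) :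
    ∃ ψ : OpenPartialHomeomorph ℂ (ℝ × ℝ), a ∈ ψ.source ∧
      (∀ u, ψ u = ((Complex.log (u / a)).im, (Complex.normSq u - Complex.normSq a) / ν)) ∧
      ContDiffOn ℝ ∞ ψ ψ.source ∧ ContDiffOn ℝ ∞ ψ.symm ψ.target ∧
      ∀ u ∈ ψ.source, u / a ∈ Complex.slitPlane := by
  let U := (fun u : ℂ => u / a) ⁻¹' Complex.slitPlane
  have hU : IsOpen U := Complex.isOpen_slitPlane.preimage (continuous_id.div_const a)
  have haU : a ∈ U := by simp [U, ha, Complex.one_mem_slitPlane]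
  have hsm : ContDiffOn ℝ ∞ (fun u : ℂ => ((Complex.log (u / a)).im,
      (Complex.normSq u - Complex.normSq a) / ν)) U := by
    refine ContDiffOn.prodMk (contDiffOn_im_log ?_ fun x hx => hx) ?_
    · exact (contDiff_id.div_const a).contDiffOn
    · exact ((contDiff_normSq.sub contDiff_const).div_const ν).contDiffOn
  obtain ⟨ψ, h1, h2, h3, h4, h5⟩ := exists_smooth_chart hU haU hsm (by
    rw [injective_iff_map_eq_zero]
    intro v hv
    have hd := ((hsm.contDiffAt (hU.mem_nhds haU)).differentiableAt
      (by simp)).hasFDerivAt.hasDerivAt_line v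
    rw [hv] at hd
    have hl : HasDerivAt (fun s : ℝ => a + s • v) v 0 := by
      simpa using ((hasDerivAt_id (0 : ℝ)).smul_const v).const_add a
    have hd1 := hasDerivAt_im_log (hl.div_const a) (by simp [ha])
    have hd2 := (hl.normSq.sub_const (Complex.normSq a)).div_const ν
    have e := (hd1.prodMk hd2).unique hd
    simp only [Prod.mk_eq_zero, zero_smul, add_zero, div_eq_zero_iff, hν, or_false, mul_eq_zero,
      OfNat.ofNat_ne_zero, false_or] at e
    -- Zero angular derivative makes v/a real; zero radial derivative then makes this real number
    -- vanish.
    obtain ⟨e1, e2⟩ := e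
    have hr : v = ((v / a).re : ℂ) * a := by
      have : v / a = ((v / a).re : ℂ) := Complex.ext rfl (by simp [e1])
      rw [← this, div_mul_cancel₀ _ ha]
    rw [hr, mul_left_comm, mul_comm _ a, Complex.mul_conj, ← Complex.ofReal_mul,
      Complex.ofReal_re, mul_eq_zero] at e2
    rw [hr, e2.resolve_right (by simpa using ha)]
    simp) (by simp [Complex.finrank_real_complex])
  exact ⟨ψ, h1, h3, h4, h5, h2⟩

/-- Local coordinates `(η, y) ↦ (e^{iη} c) ∘ y` around the orbit of a point of the slice. -/
theorem exists_orbit_chart (p : ℕ) {q : ℕ} (hq : 0 < q) {c : ℂ} (hc : c ≠ 0) {y₀ : ℝ × ℂ}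
    (hy : 0 < y₀.1) :
    ∃ θ : OpenPartialHomeomorph (ℝ × ℝ × ℂ) (Fin 2 → ℂ), (0, y₀) ∈ θ.source ∧
      (∀ x, θ x = weightedAct p q (Complex.exp (x.1 * Complex.I) * c) (slice x.2)) ∧
      ContDiffOn ℝ ∞ θ θ.source ∧ ContDiffOn ℝ ∞ θ.symm θ.target := by
  have hofReal : ContDiff ℝ ∞ fun x : ℝ × ℝ × ℂ => (x.1 : ℂ) :=
    Complex.ofRealCLM.contDiff.comp contDiff_fst
  have hexp : ContDiff ℝ ∞ fun x : ℝ × ℝ × ℂ => Complex.exp (x.1 * Complex.I) * c :=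
    ((hofReal.mul contDiff_const).cexp).mul contDiff_const
  have hsm : ContDiff ℝ ∞ fun x : ℝ × ℝ × ℂ =>
      weightedAct p q (Complex.exp (x.1 * Complex.I) * c) (slice x.2) := by
    rw [contDiff_pi]
    intro i
    fin_cases i
    · exact (hexp.pow q).mul (Complex.ofRealCLM.contDiff.comp (contDiff_fst.comp contDiff_snd))
    · exact (hexp.pow p).mul (contDiff_snd.comp contDiff_snd)
  obtain ⟨θ, h1, -, h3, h4, h5⟩ := exists_smooth_chart isOpen_univ (Set.mem_univ (0, y₀))
    hsm.contDiffOn (by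
    rw [injective_iff_map_eq_zero]
    rintro ⟨η, a, b⟩ hv
    have hd := (hsm.differentiable (by simp) (0, y₀)).hasFDerivAt.hasDerivAt_line (η, a, b)
    rw [hv] at hd
    have hd0 := hasDerivAt_pi.1 hd 0
    have hd1 := hasDerivAt_pi.1 hd 1
    have hη : HasDerivAt (fun s : ℝ => ((s * η : ℝ) : ℂ)) η 0 := by
      simpa using ((hasDerivAt_id (0 : ℝ)).mul_const η).ofReal_comp
    have he : HasDerivAt (fun s : ℝ => Complex.exp (((s * η : ℝ) : ℂ) * Complex.I) * c)
        (η * Complex.I * c) 0 := by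
      simpa using ((hη.mul_const Complex.I).cexp).mul_const c
    have ha : HasDerivAt (fun s : ℝ => ((y₀.1 + s * a : ℝ) : ℂ)) a 0 := by
      simpa using (((hasDerivAt_id (0 : ℝ)).mul_const a).const_add y₀.1).ofReal_comp
    have hb : HasDerivAt (fun s : ℝ => y₀.2 + s • b) b 0 := by
      simpa using ((hasDerivAt_id (0 : ℝ)).smul_const b).const_add y₀.2
    have hd0' : HasDerivAt (fun s : ℝ => (Complex.exp (((s * η : ℝ) : ℂ) * Complex.I) * c) ^ q *
        ((y₀.1 + s * a : ℝ) : ℂ)) 0 0 := by simpa using hd0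
    have hd1' : HasDerivAt (fun s : ℝ => (Complex.exp (((s * η : ℝ) : ℂ) * Complex.I) * c) ^ p *
        (y₀.2 + s • b)) 0 0 := by simpa using hd1
    have e0 := ((he.fun_pow q).fun_mul ha).unique hd0'
    have e1 := ((he.fun_pow p).fun_mul hb).unique hd1'
    obtain ⟨q, rfl⟩ : ∃ r, q = r + 1 := ⟨q - 1, by omega⟩
    simp only [zero_mul, Complex.ofReal_zero, Complex.exp_zero, one_mul, zero_smul, add_zero,
      Nat.add_sub_cancel] at e0 e1
    -- The real part gives a = 0 and the imaginary part gives η = 0, since y₀.1 > 0; the second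
    -- coordinate then gives b = 0.
    have e0' : c ^ (q + 1) * ((q + 1 : ℕ) * η * y₀.1 * Complex.I + a) = 0 := by
      rw [← e0]; push_cast; ring
    have e0'' := (mul_eq_zero.1 e0').resolve_left (pow_ne_zero _ hc)
    have hre := congrArg Complex.re e0''
    have him := congrArg Complex.im e0''
    norm_cast at hre him
    simp at hre him
    have hη0 : η = 0 := by
      rcases him with (h | h) | h
      · norm_cast at h
      · exact h
      · exact absurd h hy.ne'
    subst hη0
    simp [hc] at e1
    simp [hre, e1]) (by
      rw [Module.finrank_pi_fintype]
      simp [Complex.finrank_real_complex])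
  exact ⟨θ, h1, h3, h4, h5⟩

/-! ### The fold criterion -/

/-- A circle-equivariant map whose squared modulus on the slice has a nondegenerate indefinite
critical point has an indefinite fold there. -/
theorem isIndefiniteFold_of_isSliceFold {F G : (Fin 2 → ℂ) → ℂ} {p q : ℕ} (hq : 0 < q) {k : ℝ}
    (hk : k ≠ 0) {c lam : ℂ} (hc : c ≠ 0) (hlam : lam ≠ 0) (hG : ContDiff ℝ ∞ G)
    (hF : Continuous F)
    (hFG : ∀ (η : ℝ) (y : ℝ × ℂ), F (weightedAct p q (Complex.exp (η * Complex.I) * c) (slice y)) =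
      lam * Complex.exp ((k * η : ℝ) * Complex.I) * G (slice y))
    {y₀ : ℝ × ℂ} (hy : IsSliceFold G y₀) (hcrit : fderiv ℝ (sliceNormSq G) y₀ = 0) :
    IsIndefiniteFold F (weightedAct p q c (slice y₀)) := by
  obtain ⟨hy0, hG0, hinj, hpos, hneg⟩ := hy
  set w := weightedAct p q c (slice y₀) with hw
  have hFw : F w = lam * G (slice y₀) := by simpa [hw] using hFG 0 y₀
  have hFw0 : F w ≠ 0 := by rw [hFw]; exact mul_ne_zero hlam hG0
  obtain ⟨μ, ε, hμ0, hμa, hμs, hμt, hε, hε1, hε2, hμ⟩ := exists_indefinite_morse_chart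
    (by simp [Complex.finrank_real_complex]) (contDiff_sliceNormSq hG) y₀ hcrit hinj hpos hneg
  -- Since |F|² = |λ|²|G|², division by |λ|² turns the radial coordinate into the Morse function on
  -- the slice.
  obtain ⟨ψ, hψw, hψ, hψs, hψt, hψU⟩ := exists_polar_chart hFw0
    (ν := Complex.normSq lam) (by simpa using hlam)
  obtain ⟨θ, hθ0, hθ, hθs, hθt⟩ := exists_orbit_chart p hq hc hy0
  have hθw : θ (0, y₀) = w := by simp [hθ, hw]
  have hθw' : θ.symm w = (0, y₀) := by rw [← hθw, θ.left_inv hθ0]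
  let u : ℝ × ℝ × ℂ → ℂ := fun x =>
    lam * Complex.exp ((k * x.1 : ℝ) * Complex.I) * G (slice x.2) / F w
  have hu : ContDiff ℝ ∞ u := by
    have h1 : ContDiff ℝ ∞ fun x : ℝ × ℝ × ℂ => ((k * x.1 : ℝ) : ℂ) :=
      Complex.ofRealCLM.contDiff.comp (contDiff_const.mul contDiff_fst)
    exact ((contDiff_const.mul (h1.mul contDiff_const).cexp).mul
      (hG.comp (slice.contDiff.comp contDiff_snd))).div_const _
  have hu0 : u (0, y₀) = 1 := by simp [u, hFw, div_self, hlam, hG0]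
  have hFu : ∀ x, F (θ x) / F w = u x := fun x => by rw [hθ, hFG]
  -- The first coordinate is the argument of F relative to F w, so that it agrees with the first
  -- target coordinate; the other three are Morse coordinates.
  let X : ℝ × ℝ × ℂ → Fin 4 → ℝ := fun x => Fin.cons (Complex.log (u x)).im (μ x.2)
  let U : Set (ℝ × ℝ × ℂ) := u ⁻¹' Complex.slitPlane ∩ Prod.snd ⁻¹' μ.source
  have hU : IsOpen U := (Complex.isOpen_slitPlane.preimage hu.continuous).inter
    (μ.open_source.preimage continuous_snd)
  have hU0 : ((0 : ℝ), y₀) ∈ U := ⟨by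
    rw [Set.mem_preimage, hu0]; exact Complex.one_mem_slitPlane, hμ0⟩
  have hX : ContDiffOn ℝ ∞ X U := by
    rw [contDiffOn_pi]
    intro i
    refine Fin.cases ?_ (fun j => ?_) i
    · exact contDiffOn_im_log hu.contDiffOn fun x hx => hx.1
    · exact (contDiffOn_pi.1 hμs j).comp contDiff_snd.contDiffOn fun x hx => hx.2
  obtain ⟨ξ, hξ0, hξU, hξ, hξs, hξt⟩ := exists_smooth_chart hU hU0 hX (by
    rw [injective_iff_map_eq_zero]
    rintro ⟨η, v⟩ hv
    have hd := ((hX.contDiffAt (hU.mem_nhds hU0)).differentiableAt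
      (by simp)).hasFDerivAt.hasDerivAt_line (η, v)
    rw [hv] at hd
    -- The Morse components force v = 0; along the remaining orbit direction the argument of F grows
    -- at rate k ≠ 0.
    have hv0 : v = 0 := by
      have hμd := ((hμs.contDiffAt (μ.open_source.mem_nhds hμ0)).differentiableAt
        (by simp)).hasFDerivAt.hasDerivAt_line v
      apply (injective_iff_map_eq_zero _).1 (injective_fderiv_openPartialHomeomorph μ hμs hμt hμ0)
      ext j
      exact (hasDerivAt_pi.1 hμd j).unique (by simpa [X] using hasDerivAt_pi.1 hd j.succ)
    subst hv0
    have hη : HasDerivAt (fun s : ℝ => ((k * (s * η) : ℝ) : ℂ)) (k * η : ℝ) 0 := by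
      simpa using (((hasDerivAt_id (0 : ℝ)).mul_const η).const_mul k).ofReal_comp
    have he : HasDerivAt (fun s : ℝ => u (((0 : ℝ), y₀) + s • (η, (0 : ℝ × ℂ))))
        ((k * η : ℝ) * Complex.I) 0 := by
      have h1 := (((hη.mul_const Complex.I).cexp.const_mul lam).mul_const
        (G (slice y₀))).div_const (F w)
      refine (h1.congr_deriv ?_).congr_of_eventuallyEq (Filter.Eventually.of_forall fun s => ?_)
      · simp [hFw]; field_simp
      · simp [u]
    have h2 := hasDerivAt_im_log he (by simpa using hu0)
    have h3 := h2.unique (hasDerivAt_pi.1 hd 0)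
    simp [hk] at h3
    simp [h3]) (by simp [Complex.finrank_real_complex])
  have hξw : ξ (0, y₀) = 0 := by
    ext i
    rw [hξ]
    refine Fin.cases ?_ (fun j => ?_) i
    · simp [X, hu0]
    · simp [X, hμa]
  let φ₀ := θ.symm.trans ξ
  have hO : IsOpen (F ⁻¹' ψ.source) := ψ.open_source.preimage hF
  have hsrc : (φ₀.restrOpen _ hO).source =
      (θ.target ∩ θ.symm ⁻¹' ξ.source) ∩ F ⁻¹' ψ.source := by
    rw [OpenPartialHomeomorph.restrOpen_source, OpenPartialHomeomorph.trans_source]; rfl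
  refine ⟨φ₀.restrOpen _ hO, ψ, ε, ?_, ?_, hψw, ?_, ?_, ?_, hψs, hψt, ?_, hε, hε1, hε2, ?_⟩
  · rw [hsrc]
    refine ⟨⟨?_, ?_⟩, hψw⟩
    · rw [← hθw]; exact θ.map_source hθ0
    · rw [Set.mem_preimage, hθw']; exact hξ0
  · change ξ (θ.symm w) = 0
    rw [hθw', hξw]
  · simp [hψ, hFw0]
  · rw [hsrc]
    exact hξs.comp (hθt.mono fun z hz => hz.1.1) fun z hz => hz.1.2
  · have : ContDiffOn ℝ ∞ φ₀.symm φ₀.target := by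
      rw [OpenPartialHomeomorph.trans_target]
      exact hθs.comp (hξt.mono fun z hz => hz.1) fun z hz => hz.2
    exact this.mono (fun x hx => hx.1)
  · intro z hz
    rw [hsrc] at hz
    exact hz.2
  · intro z hz
    rw [hsrc] at hz
    obtain ⟨⟨hz1, hz2⟩, hz3⟩ := hz
    change ψ (F z) = (ξ (θ.symm z) 0, ∑ i : Fin 3, ε i * (ξ (θ.symm z) i.succ) ^ 2)
    have hz4 := θ.right_inv hz1
    set x := θ.symm z
    have hFz : F z = lam * Complex.exp ((k * x.1 : ℝ) * Complex.I) * G (slice x.2) := by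
      rw [← hFG, ← hθ, hz4]
    rw [hψ, hξ]
    refine Prod.ext ?_ ?_
    · simp only [X, Fin.cons_zero]
      rw [← hFu, hz4]
    · simp only [X, Fin.cons_succ]
      rw [← hμ x.2 (hξU hz2).2, hFz, hFw]
      have hl : Complex.normSq lam ≠ 0 := by simpa using hlam
      have he : Complex.normSq (Complex.exp ((k * x.1 : ℝ) * Complex.I)) = 1 := by
        rw [Complex.normSq_eq_norm_sq, Complex.norm_exp_ofReal_mul_I, one_pow]
      simp only [map_mul, he, mul_one, sliceNormSq]
      field_simp

/-! ### Singular directions and circle equivariance -/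

theorem re_conj_mul_eq (ζ w : ℂ) : ((starRingEnd ℂ) ζ * w).re = ζ.re * w.re + ζ.im * w.im := by
  simp [Complex.mul_re]

/-- A relation s d(Re F) + t d(Im F) = 0 says that the image of dF is orthogonal to s + it.
Normalizing this vector makes the set of directions compact. -/
theorem isSingularity_iff {F : (Fin 2 → ℂ) → ℂ} {w : Fin 2 → ℂ} (hF : DifferentiableAt ℝ F w) :
    IsSingularity F w ↔
      ∃ ζ : ℂ, ‖ζ‖ = 1 ∧ ∀ v, ((starRingEnd ℂ) ζ * fderiv ℝ F w v).re = 0 := by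
  have hre : fderiv ℝ (fun z => (F z).re) w = Complex.reCLM.comp (fderiv ℝ F w) :=
    (Complex.reCLM.hasFDerivAt.comp w hF.hasFDerivAt).fderiv
  have him : fderiv ℝ (fun z => (F z).im) w = Complex.imCLM.comp (fderiv ℝ F w) :=
    (Complex.imCLM.hasFDerivAt.comp w hF.hasFDerivAt).fderiv
  unfold IsSingularity
  rw [LinearIndependent.pair_iff, hre, him]
  constructor
  · intro h
    push Not at h
    obtain ⟨s, t, hst, hne⟩ := h
    have hζ : (⟨s, t⟩ : ℂ) ≠ 0 := fun h0 => by
      have h1 := congrArg Complex.re h0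
      have h2 := congrArg Complex.im h0
      exact hne h1 h2
    refine ⟨(‖(⟨s, t⟩ : ℂ)‖⁻¹ : ℝ) * ⟨s, t⟩, ?_, fun v => ?_⟩
    · rw [norm_mul, Complex.norm_real, norm_inv, norm_norm, inv_mul_cancel₀ (by simpa using hζ)]
    · have := DFunLike.congr_fun hst v
      simp only [add_apply, smul_apply, ContinuousLinearMap.comp_apply, Complex.reCLM_apply,
        Complex.imCLM_apply, smul_eq_mul, zero_apply] at this
      rw [map_mul, Complex.conj_ofReal, mul_assoc, Complex.re_ofReal_mul, re_conj_mul_eq, this,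
        mul_zero]
  · rintro ⟨ζ, hζ, h⟩ hli
    have := hli ζ.re ζ.im (by
      ext v
      simpa [re_conj_mul_eq] using h v)
    rw [show ζ = 0 from Complex.ext this.1 this.2, norm_zero] at hζ
    exact zero_ne_one hζ

/-- Circle-equivariance of weight `k` with respect to the weighted action. -/
def IsCircleEquivariant (p q : ℕ) (k : ℝ) (G : (Fin 2 → ℂ) → ℂ) : Prop :=
  ∀ (η : ℝ) (z : Fin 2 → ℂ), G (weightedAct p q (Complex.exp (η * Complex.I)) z) =
    Complex.exp ((k * η : ℝ) * Complex.I) * G z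

/-- The velocity of the circle action at `z`. -/
noncomputable def orbitVelocity (p q : ℕ) (z : Fin 2 → ℂ) : Fin 2 → ℂ :=
  ![q * Complex.I * z 0, p * Complex.I * z 1]

theorem IsCircleEquivariant.fderiv_orbitVelocity {p q : ℕ} {k : ℝ} {G : (Fin 2 → ℂ) → ℂ}
    (h : IsCircleEquivariant p q k G) (hG : Differentiable ℝ G) (z : Fin 2 → ℂ) :
    fderiv ℝ G z (orbitVelocity p q z) = k * Complex.I * G z := by
  have hη : HasDerivAt (fun s : ℝ => (s : ℂ)) 1 0 := by
    simpa using (hasDerivAt_id (0 : ℝ)).ofReal_comp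
  have he : HasDerivAt (fun s : ℝ => Complex.exp (s * Complex.I)) Complex.I 0 := by
    simpa using (hη.mul_const Complex.I).cexp
  have hcurve : HasDerivAt (fun s : ℝ => weightedAct p q (Complex.exp (s * Complex.I)) z)
      (orbitVelocity p q z) 0 := by
    rw [hasDerivAt_pi]
    intro i
    fin_cases i
    · simpa [orbitVelocity] using (he.fun_pow q).mul_const (z 0)
    · simpa [orbitVelocity] using (he.fun_pow p).mul_const (z 1)
  have h0 : weightedAct p q (Complex.exp ((0 : ℝ) * Complex.I)) z = z := by
    ext i; fin_cases i <;> simp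
  have h1 : HasDerivAt (fun s : ℝ => G (weightedAct p q (Complex.exp (s * Complex.I)) z))
      (fderiv ℝ G z (orbitVelocity p q z)) 0 := by
    have hd : HasFDerivAt G (fderiv ℝ G z)
      (weightedAct p q (Complex.exp ((0 : ℝ) * Complex.I)) z) := by
      rw [h0]; exact (hG z).hasFDerivAt
    exact hd.comp_hasDerivAt (0 : ℝ) hcurve
  have hk : HasDerivAt (fun s : ℝ => ((k * s : ℝ) : ℂ)) k 0 := by
    simpa using ((hasDerivAt_id (0 : ℝ)).const_mul k).ofReal_comp
  have h2 := ((hk.mul_const Complex.I).cexp).mul_const (G z)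
  rw [show (fun s : ℝ => G (weightedAct p q (Complex.exp (s * Complex.I)) z)) = _ from
    funext fun s => h s z] at h1
  rw [h1.unique h2]
  simp

/-- If the image of `dG` is orthogonal to the unit vector `ζ`, then `G` is a real multiple
of `ζ`. -/
theorem IsCircleEquivariant.exists_eq_mul {p q : ℕ} {k : ℝ} {G : (Fin 2 → ℂ) → ℂ}
    (h : IsCircleEquivariant p q k G) (hk : k ≠ 0) (hG : Differentiable ℝ G) {z : Fin 2 → ℂ}
    {ζ : ℂ} (hζ : ‖ζ‖ = 1) (hs : ∀ v, ((starRingEnd ℂ) ζ * fderiv ℝ G z v).re = 0) :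
    ∃ r : ℝ, G z = r * ζ := by
  -- On the orbit direction dG equals ikG, so orthogonality to ζ says that ζ̄G is real.
  have h1 := hs (orbitVelocity p q z)
  rw [h.fderiv_orbitVelocity hG] at h1
  have h2 : ((starRingEnd ℂ) ζ * G z).im = 0 := by
    have : (starRingEnd ℂ) ζ * (k * Complex.I * G z) =
      (k : ℂ) * (Complex.I * ((starRingEnd ℂ) ζ * G z)) := by ring
    rw [this, Complex.re_ofReal_mul, Complex.I_mul_re] at h1
    exact neg_eq_zero.1 ((mul_eq_zero.1 h1).resolve_left hk)
  refine ⟨((starRingEnd ℂ) ζ * G z).re, ?_⟩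
  have h3 : (((starRingEnd ℂ) ζ * G z).re : ℂ) = (starRingEnd ℂ) ζ * G z :=
    Complex.ext rfl (by simp [h2])
  rw [h3, mul_right_comm, mul_comm _ ζ, Complex.mul_conj, Complex.normSq_eq_norm_sq, hζ]
  simp

theorem hasFDerivAt_normSq_comp {E : Type*} [NormedAddCommGroup E] [NormedSpace ℝ E] {G : E → ℂ}
    {z : E} (hG : DifferentiableAt ℝ G z) (v : E) :
    fderiv ℝ (fun z => Complex.normSq (G z)) z v =
      2 * ((starRingEnd ℂ) (G z) * fderiv ℝ G z v).re := by
  have hd : DifferentiableAt ℝ (fun z => Complex.normSq (G z)) z :=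
    (contDiff_normSq.differentiable (by simp) _).comp z hG
  have h1 := hd.hasFDerivAt.hasDerivAt_line v
  have h2 := (hG.hasFDerivAt.hasDerivAt_line v).normSq
  simpa using h1.unique h2

theorem fderiv_sliceNormSq {G : (Fin 2 → ℂ) → ℂ} (hG : Differentiable ℝ G) (y v : ℝ × ℂ) :
    fderiv ℝ (sliceNormSq G) y v =
      2 * ((starRingEnd ℂ) (G (slice y)) * fderiv ℝ G (slice y) (slice v)).re := by
  have h := hasFDerivAt_normSq_comp (G := fun y => G (slice y)) (z := y)
    ((hG _).comp y slice.differentiableAt) v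
  have h2 : fderiv ℝ (fun y => G (slice y)) y v = fderiv ℝ G (slice y) (slice v) := by
    have := ((hG (slice y)).hasFDerivAt.comp y slice.hasFDerivAt).fderiv
    exact DFunLike.congr_fun this v
  rw [h2] at h
  exact h

/-- Since G = rζ with r real, d|G|² = 2r Re(ζ̄ dG), which vanishes on every vector. -/
theorem IsCircleEquivariant.fderiv_sliceNormSq_eq_zero {p q : ℕ} {k : ℝ} {G : (Fin 2 → ℂ) → ℂ}
    (h : IsCircleEquivariant p q k G) (hk : k ≠ 0) (hG : Differentiable ℝ G) {y : ℝ × ℂ}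
    {ζ : ℂ} (hζ : ‖ζ‖ = 1) (hs : ∀ v, ((starRingEnd ℂ) ζ * fderiv ℝ G (slice y) v).re = 0) :
    fderiv ℝ (sliceNormSq G) y = 0 := by
  obtain ⟨r, hr⟩ := h.exists_eq_mul hk hG hζ hs
  ext v
  all_goals
    simp only [ContinuousLinearMap.comp_apply, fderiv_sliceNormSq hG, hr, map_mul,
      Complex.conj_ofReal, mul_assoc, Complex.re_ofReal_mul, hs]
    simp

/-- The weighted action of a fixed scalar as a real linear map. -/
noncomputable def weightedActCLM (p q : ℕ) (c : ℂ) : (Fin 2 → ℂ) →L[ℝ] (Fin 2 → ℂ) :=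
  ContinuousLinearMap.pi ![(c ^ q) • ContinuousLinearMap.proj 0, (c ^ p) • ContinuousLinearMap.proj 1]

theorem weightedActCLM_apply (p q : ℕ) (c : ℂ) (z : Fin 2 → ℂ) :
    weightedActCLM p q c z = weightedAct p q c z := by
  ext i; fin_cases i <;> simp [weightedActCLM]

theorem weightedAct_mul (p q : ℕ) (c c' : ℂ) (z : Fin 2 → ℂ) :
    weightedAct p q (c * c') z = weightedAct p q c (weightedAct p q c' z) := by
  ext i; fin_cases i <;> simp [mul_pow, mul_assoc]

/-- By the chain rule, dF composed with the action of c is λ dG. So the direction ζ for F becomes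
λ̄ζ/|λ| for G. -/
theorem exists_singular_direction_of_scaled {F G : (Fin 2 → ℂ) → ℂ} {p q : ℕ} {c lam : ℂ}
    (hlam : lam ≠ 0) (hF : Differentiable ℝ F) (hG : Differentiable ℝ G)
    (hFG : ∀ z, F (weightedAct p q c z) = lam * G z) {z : Fin 2 → ℂ}
    (hs : IsSingularity F (weightedAct p q c z)) :
    ∃ ζ : ℂ, ‖ζ‖ = 1 ∧ ∀ v, ((starRingEnd ℂ) ζ * fderiv ℝ G z v).re = 0 := by
  obtain ⟨ζ, hζ, h⟩ := (isSingularity_iff (hF _)).1 hs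
  have hl : ‖lam‖ ≠ 0 := by simpa using hlam
  refine ⟨(‖lam‖⁻¹ : ℝ) * ((starRingEnd ℂ) lam * ζ), ?_, fun v => ?_⟩
  · simp [hζ, hl]
  · have h1 := ((hF (weightedActCLM p q c z)).hasFDerivAt.comp z
      (weightedActCLM p q c).hasFDerivAt)
    have h2 : HasFDerivAt (F ∘ weightedActCLM p q c) (lam • fderiv ℝ G z) z := by
      have : F ∘ weightedActCLM p q c = fun z => lam * G z :=
        funext fun z => by simp [weightedActCLM_apply, hFG]
      rw [this]
      exact (hG z).hasFDerivAt.const_mul lam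
    have h3 := DFunLike.congr_fun (h1.unique h2) v
    have h4 := h (weightedActCLM p q c v)
    rw [← weightedActCLM_apply, ← ContinuousLinearMap.comp_apply, h3] at h4
    rw [map_mul, Complex.conj_ofReal, mul_assoc, Complex.re_ofReal_mul, map_mul,
      Complex.conj_conj, mul_right_comm, mul_comm lam, mul_comm _ ((starRingEnd ℂ) ζ),
      mul_comm _ lam]
    rw [smul_apply, smul_eq_mul] at h4
    rw [h4, mul_zero]

theorem isIndefiniteFold_of_scaled {F G : (Fin 2 → ℂ) → ℂ} {p q : ℕ} (hq : 0 < q) {k : ℝ}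
    (hk : k ≠ 0) {c lam : ℂ} (hc : c ≠ 0) (hlam : lam ≠ 0) (hF : ContDiff ℝ ∞ F)
    (hG : ContDiff ℝ ∞ G) (hequi : IsCircleEquivariant p q k G)
    (hFG : ∀ z, F (weightedAct p q c z) = lam * G z) {y : ℝ × ℂ}
    (hy : ∀ ζ : ℂ, ‖ζ‖ = 1 →
      (∀ v, ((starRingEnd ℂ) ζ * fderiv ℝ G (slice y) v).re = 0) → IsSliceFold G y)
    (hs : IsSingularity F (weightedAct p q c (slice y))) :
    IsIndefiniteFold F (weightedAct p q c (slice y)) := by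
  have hF' := hF.differentiable (by simp)
  have hG' := hG.differentiable (by simp)
  obtain ⟨ζ, hζ, h⟩ := exists_singular_direction_of_scaled hlam hF' hG' hFG hs
  refine isIndefiniteFold_of_isSliceFold hq hk hc hlam hG hF.continuous (fun η y => ?_)
    (hy ζ hζ h) (hequi.fderiv_sliceNormSq_eq_zero hk hG' hζ h)
  rw [mul_comm, weightedAct_mul, hFG, hequi, mul_assoc]

/-- Every circle orbit meets the slice. -/
theorem exists_slice_representative (p : ℕ) {q : ℕ} (hq : 0 < q) (w : Fin 2 → ℂ) :
    ∃ (η : ℝ) (y : ℝ × ℂ), 0 ≤ y.1 ∧ ‖y.1‖ = ‖w 0‖ ∧ ‖y.2‖ = ‖w 1‖ ∧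
      w = weightedAct p q (Complex.exp (η * Complex.I)) (slice y) := by
  have hq' : (q : ℂ) ≠ 0 := by exact_mod_cast hq.ne'
  -- The first coordinate rotates by qη, which has to be the argument of `w 0`.
  set η := (w 0).arg / q with hη
  refine ⟨η, (‖w 0‖, Complex.exp (η * Complex.I) ^ (-(p : ℤ)) * w 1), norm_nonneg _,
    by simp, ?_, ?_⟩
  · simp [Complex.norm_exp_ofReal_mul_I]
  · ext i
    fin_cases i
    · simp only [Fin.zero_eta, weightedAct_zero, slice_zero]
      rw [← Complex.exp_nat_mul, hη]
      push_cast
      rw [show (q : ℂ) * ((w 0).arg / q * Complex.I) = (w 0).arg * Complex.I by field_simp,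
        mul_comm, Complex.norm_mul_exp_arg_mul_I]
    · simp

/-! ### The maps f ḡ + h and their singular equations -/

open MvPolynomial

theorem hasFDerivAt_eval (f : MvPolynomial (Fin 2) ℂ) (z : Fin 2 → ℂ) :
    HasFDerivAt (fun z => eval z f)
      (∑ j, eval z (pderiv j f) • (ContinuousLinearMap.proj j : (Fin 2 → ℂ) →L[ℂ] ℂ)) z := by
  induction f using MvPolynomial.induction_on with
  | C a => simpa using hasFDerivAt_const a z
  | add f g hf hg =>
    simp only [map_add, add_smul, Finset.sum_add_distrib]
    exact hf.add hg
  | mul_X f i hf =>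
    simp only [map_mul, eval_X]
    refine (hf.mul (hasFDerivAt_apply i z)).congr_fderiv ?_
    ext v
    fin_cases i <;> simp [Derivation.leibniz, pderiv_X] <;> ring

theorem contDiff_eval (f : MvPolynomial (Fin 2) ℂ) : ContDiff ℝ ∞ fun z : Fin 2 → ℂ => eval z f := by
  have : ContDiff ℂ ∞ fun z : Fin 2 → ℂ => eval z f := by
    rw [← contDiffOn_univ]
    exact (AnalyticOnNhd.eval_mvPolynomial f).contDiffOn uniqueDiffOn_univ
  exact this.restrict_scalars ℝ

/-- The map `z ↦ f(z) * conj (g(z)) + h(z)`. -/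
noncomputable def mixedMap (f g h : MvPolynomial (Fin 2) ℂ) (z : Fin 2 → ℂ) : ℂ :=
  eval z f * (starRingEnd ℂ) (eval z g) + eval z h

theorem contDiff_conj : ContDiff ℝ ∞ fun z : ℂ => (starRingEnd ℂ) z := Complex.conjCLE.contDiff

theorem contDiff_mixedMap (f g h : MvPolynomial (Fin 2) ℂ) : ContDiff ℝ ∞ (mixedMap f g h) :=
  ((contDiff_eval f).mul (contDiff_conj.comp (contDiff_eval g))).add (contDiff_eval h)

theorem hasDerivAt_eval_line (f : MvPolynomial (Fin 2) ℂ) (z v : Fin 2 → ℂ) :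
    HasDerivAt (fun s : ℝ => eval (z + s • v) f)
      (eval z (pderiv 0 f) * v 0 + eval z (pderiv 1 f) * v 1) 0 := by
  simpa [Fin.sum_univ_two] using ((hasFDerivAt_eval f z).restrictScalars ℝ).hasDerivAt_line v

theorem HasDerivAt.complex_conj {w : ℝ → ℂ} {w' : ℂ} {s : ℝ} (h : HasDerivAt w w' s) :
    HasDerivAt (fun s => (starRingEnd ℂ) (w s)) ((starRingEnd ℂ) w') s := by
  exact Complex.conjCLE.hasFDerivAt.comp_hasDerivAt s h

theorem fderiv_mixedMap (f g h : MvPolynomial (Fin 2) ℂ) (z v : Fin 2 → ℂ) :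
    fderiv ℝ (mixedMap f g h) z v =
      (eval z (pderiv 0 f) * (starRingEnd ℂ) (eval z g) + eval z (pderiv 0 h)) * v 0 +
      (eval z (pderiv 1 f) * (starRingEnd ℂ) (eval z g) + eval z (pderiv 1 h)) * v 1 +
      eval z f * (starRingEnd ℂ) (eval z (pderiv 0 g) * v 0 + eval z (pderiv 1 g) * v 1) := by
  have h1 := ((contDiff_mixedMap f g h).differentiable (by simp) z).hasFDerivAt.hasDerivAt_line v
  have h2 := ((hasDerivAt_eval_line f z v).fun_mul (hasDerivAt_eval_line g z v).complex_conj).fun_add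
    (hasDerivAt_eval_line h z v)
  refine (h1.unique h2).trans ?_
  simp
  ring

/-- The coefficients of the covector `v ↦ conj ζ * dG(v)` up to imaginary parts, for
`G = f * conj g + h` and a unit vector `ζ`. -/
noncomputable def singularCoeff (f g h : MvPolynomial (Fin 2) ℂ) (z : Fin 2 → ℂ) (ζ : ℂ)
    (j : Fin 2) : ℂ :=
  eval z (pderiv j f) * (starRingEnd ℂ) (eval z g) + eval z (pderiv j h) +
    ζ ^ 2 * ((starRingEnd ℂ) (eval z f) * eval z (pderiv j g))

/-- Conjugating ζ̄ · f · b̄ preserves its real part, and |ζ| = 1 rewrites the result ζ f̄ b as ζ̄ ·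
ζ² f̄ b. This makes the antilinear term complex linear in v. -/
theorem re_conj_mul_fderiv_mixedMap (f g h : MvPolynomial (Fin 2) ℂ) (z v : Fin 2 → ℂ) {ζ : ℂ}
    (hζ : ‖ζ‖ = 1) :
    ((starRingEnd ℂ) ζ * fderiv ℝ (mixedMap f g h) z v).re =
      ((starRingEnd ℂ) ζ * (singularCoeff f g h z ζ 0 * v 0 + singularCoeff f g h z ζ 1 * v 1)).re := by
  have hζ' : (starRingEnd ℂ) ζ * ζ = 1 := by
    rw [mul_comm, Complex.mul_conj, Complex.normSq_eq_norm_sq, hζ]; simp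
  have h1 : ∀ a b : ℂ, ((starRingEnd ℂ) ζ * (a + eval z f * (starRingEnd ℂ) b)).re =
      ((starRingEnd ℂ) ζ * (a + ζ ^ 2 * ((starRingEnd ℂ) (eval z f) * b))).re := by
    intro a b
    have h2 : (starRingEnd ℂ) ζ * (a + ζ ^ 2 * ((starRingEnd ℂ) (eval z f) * b)) =
        (starRingEnd ℂ) ζ * a + (starRingEnd ℂ) ((starRingEnd ℂ) ζ * (eval z f * (starRingEnd ℂ) b)) := by
      simp only [map_mul, Complex.conj_conj]
      linear_combination (ζ * ((starRingEnd ℂ) (eval z f) * b)) * hζ'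
    rw [h2, mul_add, Complex.add_re, Complex.add_re, Complex.conj_re]
  rw [fderiv_mixedMap, h1]
  congr 2
  simp only [singularCoeff]
  ring

theorem eq_zero_of_re_conj_mul {ζ a b : ℂ} (hζ : ‖ζ‖ = 1)
    (h : ∀ u v : ℂ, ((starRingEnd ℂ) ζ * (a * u + b * v)).re = 0) : a = 0 ∧ b = 0 := by
  have hζ0 : (starRingEnd ℂ) ζ ≠ 0 := by
    intro h0
    rw [map_eq_zero] at h0
    simp [h0] at hζ
  have key : ∀ w : ℂ, (∀ u : ℂ, ((starRingEnd ℂ) ζ * (w * u)).re = 0) → w = 0 := by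
    intro w hw
    have h1 := hw ((starRingEnd ℂ) ((starRingEnd ℂ) ζ * w))
    rw [← mul_assoc, Complex.mul_conj, Complex.ofReal_re, Complex.normSq_eq_zero] at h1
    exact (mul_eq_zero.1 h1).resolve_left hζ0
  exact ⟨key a fun u => by simpa using h u 0, key b fun v => by simpa using h 0 v⟩

/-- A complex linear form whose product with ζ̄ has real part zero on all vectors is zero. The two
resulting complex equations are affine in h, so they can be solved for γ₁ and γ₂. -/
theorem singularCoeff_eq_zero_iff (f g h : MvPolynomial (Fin 2) ℂ) (z : Fin 2 → ℂ) {ζ : ℂ}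
    (hζ : ‖ζ‖ = 1) :
    (∀ v, ((starRingEnd ℂ) ζ * fderiv ℝ (mixedMap f g h) z v).re = 0) ↔
      singularCoeff f g h z ζ 0 = 0 ∧ singularCoeff f g h z ζ 1 = 0 := by
  simp only [re_conj_mul_fderiv_mixedMap f g h z _ hζ]
  constructor
  · exact fun H => eq_zero_of_re_conj_mul hζ fun u v => by simpa using H ![u, v]
  · rintro ⟨h0, h1⟩ v
    simp [h0, h1]

theorem eval_weightedAct {p q D : ℕ} {f : MvPolynomial (Fin 2) ℂ}
    (hf : IsWeightedHomogeneous ![q, p] f D) (c : ℂ) (z : Fin 2 → ℂ) :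
    eval (weightedAct p q c z) f = c ^ D * eval z f := by
  simp only [eval_eq', Finset.mul_sum]
  refine Finset.sum_congr rfl fun d hd => ?_
  have h := hf (mem_support_iff.1 hd)
  rw [Finsupp.weight_apply, Finsupp.sum_fintype _ _ (by simp)] at h
  simp only [Fin.sum_univ_two, Fin.prod_univ_two, weightedAct_zero, weightedAct_one] at h ⊢
  simp only [Matrix.cons_val_zero, Matrix.cons_val_one, smul_eq_mul] at h
  rw [← h]
  ring

theorem euler_identity {p q D : ℕ} {f : MvPolynomial (Fin 2) ℂ}
    (hf : IsWeightedHomogeneous ![q, p] f D) (z : Fin 2 → ℂ) :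
    q * (z 0 * eval z (pderiv 0 f)) + p * (z 1 * eval z (pderiv 1 f)) = D * eval z f := by
  have h := congrArg (eval z) hf.sum_weight_X_mul_pderiv
  simpa [Fin.sum_univ_two] using h

theorem exp_mul_conj_pow {a b : ℕ} (hab : b ≤ a) (η : ℝ) :
    Complex.exp (η * Complex.I) ^ a * (starRingEnd ℂ) (Complex.exp (η * Complex.I) ^ b) =
      Complex.exp (η * Complex.I) ^ (a - b) := by
  have h1 : Complex.exp (η * Complex.I) * (starRingEnd ℂ) (Complex.exp (η * Complex.I)) = 1 := by
    rw [Complex.mul_conj, Complex.normSq_eq_norm_sq, Complex.norm_exp_ofReal_mul_I]; simp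
  obtain ⟨d, rfl⟩ := Nat.exists_eq_add_of_le hab
  rw [Nat.add_sub_cancel_left, map_pow, pow_add, mul_right_comm, ← mul_pow, h1, one_pow, one_mul]

theorem isCircleEquivariant_mixedMap {p q a b : ℕ} (hab : b ≤ a) {f g h : MvPolynomial (Fin 2) ℂ}
    (hf : IsWeightedHomogeneous ![q, p] f a) (hg : IsWeightedHomogeneous ![q, p] g b)
    (hh : IsWeightedHomogeneous ![q, p] h (a - b)) :
    IsCircleEquivariant p q ((a - b : ℕ) : ℝ) (mixedMap f g h) := by
  intro η z
  have he : Complex.exp ((((a - b : ℕ) : ℝ) * η : ℝ) * Complex.I) =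
      Complex.exp (η * Complex.I) ^ (a - b) := by
    rw [← Complex.exp_nat_mul]; push_cast; ring_nf
  rw [he]
  simp only [mixedMap, eval_weightedAct hf, eval_weightedAct hg, eval_weightedAct hh]
  rw [map_mul, mul_mul_mul_comm, exp_mul_conj_pow hab]
  ring

/-! ### The Hessian of |G|² and its indefiniteness -/

theorem hasDerivAt_fderiv_line {E F : Type*} [NormedAddCommGroup E] [NormedSpace ℝ E]
    [NormedAddCommGroup F] [NormedSpace ℝ F] {N : E → F} (hN : ContDiff ℝ ∞ N) (z u v : E) :
    HasDerivAt (fun s : ℝ => fderiv ℝ N (z + s • u) v) (fderiv ℝ (fderiv ℝ N) z u v) 0 := by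
  have h1 : ContDiff ℝ ∞ (fderiv ℝ N) := hN.fderiv_right (by simp)
  have h2 := (h1.differentiable (by simp) z).hasFDerivAt.hasDerivAt_line u
  simpa using h2.clm_apply (hasDerivAt_const (0 : ℝ) v)

theorem fderiv_fderiv_comp_clm {E F : Type*} [NormedAddCommGroup E] [NormedSpace ℝ E]
    [NormedAddCommGroup F] [NormedSpace ℝ F] {N : F → ℝ} (hN : ContDiff ℝ ∞ N) (L : E →L[ℝ] F)
    (y u v : E) :
    fderiv ℝ (fderiv ℝ fun y => N (L y)) y u v = fderiv ℝ (fderiv ℝ N) (L y) (L u) (L v) := by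
  have h1 := hasDerivAt_fderiv_line (hN.comp L.contDiff) y u v
  have h2 := hasDerivAt_fderiv_line hN (L y) (L u) (L v)
  refine h1.unique (h2.congr_of_eventuallyEq (Filter.Eventually.of_forall fun s => ?_))
  have := ((hN.differentiable (by simp) (L (y + s • u))).hasFDerivAt.comp _ L.hasFDerivAt).fderiv
  simp only [Function.comp_def] at this ⊢
  rw [this]
  simp

theorem HasDerivAt.complex_re {w : ℝ → ℂ} {w' : ℂ} {s : ℝ} (h : HasDerivAt w w' s) :
    HasDerivAt (fun s => (w s).re) w'.re s :=
  Complex.reCLM.hasFDerivAt.comp_hasDerivAt s h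

theorem fderiv_sliceNormSq_sndOrder {G : (Fin 2 → ℂ) → ℂ} (hG : ContDiff ℝ ∞ G) (y u v : ℝ × ℂ) :
    fderiv ℝ (fderiv ℝ (sliceNormSq G)) y u v =
      fderiv ℝ (fderiv ℝ fun z => Complex.normSq (G z)) (slice y) (slice u) (slice v) :=
  fderiv_fderiv_comp_clm (contDiff_normSq.comp hG) slice y u v

theorem orbitVelocity_add_smul (p q : ℕ) (z u : Fin 2 → ℂ) (s : ℝ) :
    orbitVelocity p q (z + s • u) = orbitVelocity p q z + s • orbitVelocity p q u := by
  ext i; fin_cases i <;> simp [orbitVelocity] <;> ring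

/-- The orbit direction is in the kernel of the Hessian of `|G|²` at a critical point. -/
theorem IsCircleEquivariant.hessian_orbitVelocity {p q : ℕ} {k : ℝ} {G : (Fin 2 → ℂ) → ℂ}
    (h : IsCircleEquivariant p q k G) (hG : ContDiff ℝ ∞ G) {z : Fin 2 → ℂ}
    (hcrit : fderiv ℝ (fun z => Complex.normSq (G z)) z = 0) (u : Fin 2 → ℂ) :
    fderiv ℝ (fderiv ℝ fun z => Complex.normSq (G z)) z u (orbitVelocity p q z) = 0 := by
  have hG' := hG.differentiable (by simp)
  have hN := contDiff_normSq.comp hG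
  have h0 : ∀ z, fderiv ℝ (fun z => Complex.normSq (G z)) z (orbitVelocity p q z) = 0 := by
    intro z
    rw [hasFDerivAt_normSq_comp (hG' z), h.fderiv_orbitVelocity hG',
      show (starRingEnd ℂ) (G z) * (k * Complex.I * G z) =
        ((k * Complex.normSq (G z) : ℝ) : ℂ) * Complex.I by
      rw [Complex.ofReal_mul, ← Complex.mul_conj]; ring]
    simp
  -- The identity d|G|²(orbit direction) = 0 is differentiated along u; the term from moving the
  -- orbit direction vanishes because z is critical.
  have h1 := (hasDerivAt_fderiv_line hN z u (orbitVelocity p q z)).fun_add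
    ((hasDerivAt_id (0 : ℝ)).fun_mul (hasDerivAt_fderiv_line hN z u (orbitVelocity p q u)))
  have h2 : HasDerivAt (fun _ : ℝ => (0 : ℝ)) 0 0 := hasDerivAt_const _ _
  have h3 := h1.unique (h2.congr_of_eventuallyEq (Filter.Eventually.of_forall fun s => by
    have := h0 (z + s • u)
    rw [orbitVelocity_add_smul, map_add, map_smul, smul_eq_mul] at this
    simpa [Function.comp_def] using this))
  simp only [Function.comp_def] at h3
  simpa [hcrit] using h3

/-- The second derivative of `a` in the direction `v`. -/
noncomputable def evalHessian (a : MvPolynomial (Fin 2) ℂ) (z v : Fin 2 → ℂ) : ℂ :=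
  (eval z (pderiv 0 (pderiv 0 a)) * v 0 + eval z (pderiv 1 (pderiv 0 a)) * v 1) * v 0 +
  (eval z (pderiv 0 (pderiv 1 a)) * v 0 + eval z (pderiv 1 (pderiv 1 a)) * v 1) * v 1

/-- In general there are further terms: 2|dG(v)|² and products containing dg(v). The two hypotheses
remove them, leaving only forms quadratic in v or in its conjugate. -/
theorem hessian_normSq_mixedMap (f g h : MvPolynomial (Fin 2) ℂ) (z v : Fin 2 → ℂ)
    (hgv : eval z (pderiv 0 g) * v 0 + eval z (pderiv 1 g) * v 1 = 0)
    (hv : fderiv ℝ (mixedMap f g h) z v = 0) :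
    fderiv ℝ (fderiv ℝ fun z => Complex.normSq (mixedMap f g h z)) z v v =
      2 * ((starRingEnd ℂ) (mixedMap f g h z) * (evalHessian f z v * (starRingEnd ℂ) (eval z g) +
        evalHessian h z v + eval z f * (starRingEnd ℂ) (evalHessian g z v))).re := by
  have hG := contDiff_mixedMap f g h
  have hG' := hG.differentiable (by simp)
  have h1 := hasDerivAt_fderiv_line (contDiff_normSq.comp hG) z v v
  have hW : HasDerivAt (fun s : ℝ => fderiv ℝ (mixedMap f g h) (z + s • v) v)
      (evalHessian f z v * (starRingEnd ℂ) (eval z g) +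
        evalHessian h z v + eval z f * (starRingEnd ℂ) (evalHessian g z v)) 0 := by
    simp only [fderiv_mixedMap]
    have d := fun a => hasDerivAt_eval_line a z v
    have hgc := (d g).complex_conj
    have e0 := ((((d (pderiv 0 f)).fun_mul hgc).fun_add (d (pderiv 0 h))).mul_const (v 0))
    have e1 := ((((d (pderiv 1 f)).fun_mul hgc).fun_add (d (pderiv 1 h))).mul_const (v 1))
    have e2 := (d f).fun_mul
      (((d (pderiv 0 g)).mul_const (v 0)).fun_add ((d (pderiv 1 g)).mul_const (v 1))).complex_conj
    refine ((e0.fun_add e1).fun_add e2).congr_deriv ?_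
    simp only [zero_smul, add_zero, hgv, map_zero, mul_zero, zero_add, evalHessian]
    ring
  have hGl := (hG' z).hasFDerivAt.hasDerivAt_line v
  have h2 := ((hGl.complex_conj.fun_mul hW).complex_re).const_mul (2 : ℝ)
  refine (h1.unique (h2.congr_of_eventuallyEq (Filter.Eventually.of_forall fun s =>
    hasFDerivAt_normSq_comp (hG' _) v))).trans ?_
  simp [hv]

theorem evalHessian_I_smul (a : MvPolynomial (Fin 2) ℂ) (z v : Fin 2 → ℂ) :
    evalHessian a z (Complex.I • v) = -evalHessian a z v := by
  simp only [evalHessian, Pi.smul_apply, smul_eq_mul]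
  linear_combination ((eval z (pderiv 0 (pderiv 0 a)) * v 0 +
    eval z (pderiv 1 (pderiv 0 a)) * v 1) * v 0 + (eval z (pderiv 0 (pderiv 1 a)) * v 0 +
    eval z (pderiv 1 (pderiv 1 a)) * v 1) * v 1) * Complex.I_mul_I

/-- A nondegenerate symmetric bilinear form with a nonzero null vector is indefinite. -/
theorem exists_pos_neg_of_null {E : Type*} [NormedAddCommGroup E] [NormedSpace ℝ E]
    (D : E →L[ℝ] E →L[ℝ] ℝ) (hs : ∀ u v, D u v = D v u) (hinj : Function.Injective D) {v : E}
    (hv : v ≠ 0) (hnull : D v v = 0) : (∃ u, 0 < D u u) ∧ ∃ u, D u u < 0 := by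
  obtain ⟨u, hu⟩ : ∃ u, D v u ≠ 0 := by
    by_contra! h
    exact hv ((injective_iff_map_eq_zero D).1 hinj v (by ext u; simpa using h u))
  -- Along u + s v the quadratic form is affine in s with slope 2D(v, u) ≠ 0, so it takes every
  -- value.
  have key : ∀ a : ℝ, ∃ w, D w w = a := by
    intro a
    refine ⟨u + ((a - D u u) / (2 * D v u)) • v, ?_⟩
    simp only [map_add, map_smul, add_apply, smul_apply, smul_eq_mul, hnull, hs u v]
    field_simp
    ring
  obtain ⟨w, hw⟩ := key 1
  obtain ⟨w', hw'⟩ := key (-1)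
  exact ⟨⟨w, by rw [hw]; norm_num⟩, ⟨w', by rw [hw']; norm_num⟩⟩

/-- Projection to the slice along the orbit. -/
theorem exists_slice_add_orbitVelocity (p : ℕ) {q : ℕ} (hq : 0 < q) {y : ℝ × ℂ} (hy : 0 < y.1)
    (v : Fin 2 → ℂ) : ∃ (v' : ℝ × ℂ) (s : ℝ), v = slice v' + s • orbitVelocity p q (slice y) := by
  have hq' : (q : ℝ) ≠ 0 := by exact_mod_cast hq.ne'
  obtain ⟨s, hs⟩ : ∃ s : ℝ, s * (q * y.1) = (v 0).im :=
    ⟨(v 0).im / (q * y.1), div_mul_cancel₀ _ (mul_ne_zero hq' hy.ne')⟩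
  refine ⟨((v 0).re, v 1 - s * (p * Complex.I * y.2)), s, ?_⟩
  ext i
  fin_cases i
  · apply Complex.ext
    · simp [orbitVelocity]
    · simpa [orbitVelocity] using hs.symm
  · simp [orbitVelocity]

/-- For `G = f * conj g + h`, a nondegenerate critical point of `|G|²` on the slice with `G ≠ 0`
is indefinite: on the complex line tangent to the level set of `g` the Hessian is harmonic. -/
theorem isSliceFold_of_nondegenerate {p q : ℕ} (hq : 0 < q) {k : ℝ} (hk : k ≠ 0)
    {f g h : MvPolynomial (Fin 2) ℂ} (hequi : IsCircleEquivariant p q k (mixedMap f g h))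
    {y : ℝ × ℂ} (hy : 0 < y.1) (hG0 : mixedMap f g h (slice y) ≠ 0) {ζ : ℂ} (hζ : ‖ζ‖ = 1)
    (hs : ∀ v, ((starRingEnd ℂ) ζ * fderiv ℝ (mixedMap f g h) (slice y) v).re = 0)
    (hinj : Function.Injective (fderiv ℝ (fderiv ℝ (sliceNormSq (mixedMap f g h))) y)) :
    IsSliceFold (mixedMap f g h) y := by
  have hG := contDiff_mixedMap f g h
  have hG' := hG.differentiable (by simp)
  set G := mixedMap f g h with hGdef
  set z := slice y with hz
  obtain ⟨r, hr⟩ := hequi.exists_eq_mul hk hG' hζ hs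
  have hcrit : fderiv ℝ (fun z => Complex.normSq (G z)) z = 0 := by
    refine ContinuousLinearMap.ext fun v => ?_
    rw [hasFDerivAt_normSq_comp (hG' z), hr, map_mul, Complex.conj_ofReal, mul_assoc,
      Complex.re_ofReal_mul, hs]
    simp
  have hξ := hequi.hessian_orbitVelocity hG hcrit
  set B := fderiv ℝ (fderiv ℝ fun z => Complex.normSq (G z)) z with hB
  have hBs : ∀ u v, B u v = B v u := fun u v => by
    have : IsSymmSndFDerivAt ℝ (fun z => Complex.normSq (G z)) z :=
      (contDiff_normSq.comp hG).contDiffAt.isSymmSndFDerivAt (by simpa using two_le_infty)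
    exact this.eq u v
  have hDB := fderiv_sliceNormSq_sndOrder hG y
  set D := fderiv ℝ (fderiv ℝ (sliceNormSq G)) y with hD
  obtain ⟨c0, c1⟩ := (singularCoeff_eq_zero_iff f g h z hζ).1 hs
  simp only [singularCoeff] at c0 c1
  -- If dg(v) = 0, the conjugate term of dG(v) vanishes, and the singular equations turn the rest
  -- into a multiple of dg(v).
  have hDG : ∀ v : Fin 2 → ℂ, eval z (pderiv 0 g) * v 0 + eval z (pderiv 1 g) * v 1 = 0 →
      fderiv ℝ G z v = 0 := by
    intro v hv
    rw [hGdef, fderiv_mixedMap, hv, map_zero, mul_zero, add_zero]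
    linear_combination c0 * v 0 + c1 * v 1 - ζ ^ 2 * (starRingEnd ℂ) (eval z f) * hv
  -- The orbit direction lies in the kernel of B, so projection to the slice along it preserves the
  -- quadratic form.
  have hproj : ∀ v : Fin 2 → ℂ, ∀ (v' : ℝ × ℂ) (s : ℝ), v = slice v' + s • orbitVelocity p q z →
      D v' v' = B v v := by
    rintro v v' s rfl
    rw [hDB, ← hB]
    simp only [map_add, map_smul, add_apply, smul_apply, hξ, hBs (orbitVelocity p q z), smul_zero,
      add_zero]
  let v : Fin 2 → ℂ := ![eval z (pderiv 1 g), -eval z (pderiv 0 g)]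
  have hgv : eval z (pderiv 0 g) * v 0 + eval z (pderiv 1 g) * v 1 = 0 := by simp [v]; ring
  have hgv' : eval z (pderiv 0 g) * (Complex.I • v) 0 + eval z (pderiv 1 g) * (Complex.I • v) 1
      = 0 := by
    simp only [Pi.smul_apply, smul_eq_mul]
    linear_combination Complex.I * hgv
  have hDv := hDG v hgv
  have hneg : B (Complex.I • v) (Complex.I • v) = -B v v := by
    rw [hB, hessian_normSq_mixedMap f g h z _ hgv' (hDG _ hgv'),
      hessian_normSq_mixedMap f g h z _ hgv hDv]
    simp only [evalHessian_I_smul]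
    rw [← mul_neg, ← Complex.neg_re]
    congr 2
    rw [map_neg]
    ring
  obtain ⟨v', s, hv'⟩ := exists_slice_add_orbitVelocity p hq hy v
  obtain ⟨w', s', hw'⟩ := exists_slice_add_orbitVelocity p hq hy (Complex.I • v)
  have hDv' := hproj _ _ _ hv'
  have hDw' := hproj _ _ _ hw'
  rw [hneg, ← hDv'] at hDw'
  have hfin : (∃ u, 0 < D u u) ∧ ∃ u, D u u < 0 := by
    rcases lt_trichotomy (D v' v') 0 with hlt | heq | hgt
    · exact ⟨⟨w', by linarith⟩, v', hlt⟩
    -- If v' = 0, then v is a multiple of the orbit direction; since dG(v) = 0 while dG is ikG ≠ 0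
    -- on that direction, v = 0. Then dg = 0, hence dG = 0 everywhere at z, a contradiction.
    · refine exists_pos_neg_of_null D (fun a b => by rw [hDB, hDB, hBs]) hinj (v := v') ?_ heq
      intro h0
      rw [h0, map_zero, zero_add] at hv'
      have h1 := hDv
      rw [hv', map_smul, hequi.fderiv_orbitVelocity hG'] at h1
      have hs0 : s = 0 := by simpa [hk, hG0] using h1
      rw [hs0, zero_smul] at hv'
      have hg1 : eval z (pderiv 1 g) = 0 := by simpa [v] using congrFun hv' 0
      have hg0 : eval z (pderiv 0 g) = 0 := by simpa [v] using congrFun hv' 1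
      have h2 := hDG (orbitVelocity p q z) (by simp [hg0, hg1])
      rw [hequi.fderiv_orbitVelocity hG'] at h2
      simp [hk, hG0] at h2
    · exact ⟨⟨v', hgt⟩, w', by linarith⟩
  exact ⟨hy, hG0, hinj, hfin.1, hfin.2⟩

/-! ### Singular parameters and null sets -/

/-- The polynomial `γ₁ z₁^k₁ + γ₂ z₂^k₂`. -/
noncomputable def deformationPoly (k₁ k₂ : ℕ) (γ₁ γ₂ : ℂ) : MvPolynomial (Fin 2) ℂ :=
  C γ₁ * X 0 ^ k₁ + C γ₂ * X 1 ^ k₂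

theorem eval_deformationPoly (k₁ k₂ : ℕ) (γ₁ γ₂ : ℂ) (z : Fin 2 → ℂ) :
    eval z (deformationPoly k₁ k₂ γ₁ γ₂) = γ₁ * z 0 ^ k₁ + γ₂ * z 1 ^ k₂ := by
  simp [deformationPoly]

theorem eval_pderiv_zero_deformationPoly (k₁ k₂ : ℕ) (γ₁ γ₂ : ℂ) (z : Fin 2 → ℂ) :
    eval z (pderiv 0 (deformationPoly k₁ k₂ γ₁ γ₂)) = k₁ * z 0 ^ (k₁ - 1) * γ₁ := by
  simp [deformationPoly, pderiv_X, Derivation.leibniz_pow]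
  ring

theorem eval_pderiv_one_deformationPoly (k₁ k₂ : ℕ) (γ₁ γ₂ : ℂ) (z : Fin 2 → ℂ) :
    eval z (pderiv 1 (deformationPoly k₁ k₂ γ₁ γ₂)) = k₂ * z 1 ^ (k₂ - 1) * γ₂ := by
  simp [deformationPoly, pderiv_X, Derivation.leibniz_pow]
  ring

theorem isWeightedHomogeneous_deformationPoly {p q k₁ k₂ D : ℕ} (h₁ : k₁ * q = D) (h₂ : k₂ * p = D)
    (γ₁ γ₂ : ℂ) : IsWeightedHomogeneous ![q, p] (deformationPoly k₁ k₂ γ₁ γ₂) D := by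
  have hX : ∀ i : Fin 2, ∀ k : ℕ, ∀ γ : ℂ,
      IsWeightedHomogeneous ![q, p] (C γ * X i ^ k : MvPolynomial (Fin 2) ℂ) (k * ![q, p] i) := by
    intro i k γ
    have h1 := (isWeightedHomogeneous_C (R := ℂ) ![q, p] γ).mul
      ((isWeightedHomogeneous_X ℂ ![q, p] i).pow k)
    rwa [zero_add, smul_eq_mul] at h1
  refine IsWeightedHomogeneous.add ?_ ?_
  · simpa [h₁] using hX 0 k₁ γ₁
  · simpa [h₂] using hX 1 k₂ γ₂

/-- The coefficient `γ_j` for which `G` is singular at `z` in the direction `ζ`. -/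
noncomputable def singularParamAt (f g : MvPolynomial (Fin 2) ℂ) (k : ℕ) (j : Fin 2)
    (z : Fin 2 → ℂ) (ζ : ℂ) : ℂ :=
  -(eval z (pderiv j f) * (starRingEnd ℂ) (eval z g) +
    ζ ^ 2 * ((starRingEnd ℂ) (eval z f) * eval z (pderiv j g))) / (k * z j ^ (k - 1))

/-- The slice point with coordinates `(Re u, b)`. -/
noncomputable def slicePoint (P : ℂ × ℂ) : Fin 2 → ℂ := slice (P.1.re, P.2)

/-- The map `(x + i θ, b) ↦ (γ₁, γ₂)` parametrizing the singular deformations. -/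
noncomputable def singularParam (f g : MvPolynomial (Fin 2) ℂ) (k₁ k₂ : ℕ) (P : ℂ × ℂ) : ℂ × ℂ :=
  (singularParamAt f g k₁ 0 (slicePoint P) (Complex.exp (P.1.im * Complex.I)),
    singularParamAt f g k₂ 1 (slicePoint P) (Complex.exp (P.1.im * Complex.I)))

theorem differentiable_slicePoint : Differentiable ℝ slicePoint := by
  have h1 : Differentiable ℝ fun P : ℂ × ℂ => P.1.re :=
    Complex.reCLM.differentiable.comp differentiable_fst
  exact slice.differentiable.comp (h1.prodMk differentiable_snd)

theorem differentiable_eval_slicePoint (a : MvPolynomial (Fin 2) ℂ) :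
    Differentiable ℝ fun P => eval (slicePoint P) a :=
  ((contDiff_eval a).differentiable (by simp)).comp differentiable_slicePoint

theorem differentiable_conj_comp {E : Type*} [NormedAddCommGroup E] [NormedSpace ℝ E] {f : E → ℂ}
    (hf : Differentiable ℝ f) : Differentiable ℝ fun x => (starRingEnd ℂ) (f x) :=
  Complex.conjCLE.differentiable.comp hf

theorem differentiableAt_div_monomial {w : ℂ × ℂ → ℂ} {P : ℂ × ℂ} (hw : DifferentiableAt ℝ w P)
    {k : ℕ} (hk : k ≠ 0) {j : Fin 2} (hP : slicePoint P j ≠ 0) :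
    DifferentiableAt ℝ (fun P => w P / (k * slicePoint P j ^ (k - 1))) P := by
  have hj : DifferentiableAt ℝ (fun P => slicePoint P j) P :=
    differentiableAt_pi.1 (differentiable_slicePoint P) j
  have hne : (k * slicePoint P j ^ (k - 1) : ℂ) ≠ 0 :=
    mul_ne_zero (by exact_mod_cast hk) (pow_ne_zero _ hP)
  simp only [div_eq_mul_inv]
  exact hw.fun_mul (((hj.fun_pow (k - 1)).const_mul (k : ℂ)).inv hne)

theorem differentiableAt_singularParam (f g : MvPolynomial (Fin 2) ℂ) {k₁ k₂ : ℕ} (h₁ : k₁ ≠ 0)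
    (h₂ : k₂ ≠ 0) {P : ℂ × ℂ} (hP : 0 < P.1.re) (hP' : P.2 ≠ 0) :
    DifferentiableAt ℝ (singularParam f g k₁ k₂) P := by
  have hexp : Differentiable ℝ fun P : ℂ × ℂ => Complex.exp (P.1.im * Complex.I) := by
    have : Differentiable ℝ fun P : ℂ × ℂ => ((P.1.im : ℝ) : ℂ) :=
      Complex.ofRealCLM.differentiable.comp (Complex.imCLM.differentiable.comp differentiable_fst)
    exact (this.mul_const Complex.I).cexp
  have d := differentiable_eval_slicePoint
  have hnum : ∀ j, Differentiable ℝ fun P => -(eval (slicePoint P) (pderiv j f) *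
      (starRingEnd ℂ) (eval (slicePoint P) g) + Complex.exp (P.1.im * Complex.I) ^ 2 *
      ((starRingEnd ℂ) (eval (slicePoint P) f) * eval (slicePoint P) (pderiv j g))) := fun j =>
    (((d _).mul (differentiable_conj_comp (d _))).add
      ((hexp.pow 2).mul ((differentiable_conj_comp (d _)).mul (d _)))).neg
  exact (differentiableAt_div_monomial (hnum 0 P) h₁
    (by simpa [slicePoint] using hP.ne')).prodMk
    (differentiableAt_div_monomial (hnum 1 P) h₂ (by simpa [slicePoint] using hP'))

theorem singularCoeff_deformationPoly_zero (f g : MvPolynomial (Fin 2) ℂ) {k₁ k₂ : ℕ}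
    (h₁ : k₁ ≠ 0) (γ₁ γ₂ : ℂ) {z : Fin 2 → ℂ} (hz : z 0 ≠ 0) (ζ : ℂ) :
    singularCoeff f g (deformationPoly k₁ k₂ γ₁ γ₂) z ζ 0 =
      k₁ * z 0 ^ (k₁ - 1) * (γ₁ - singularParamAt f g k₁ 0 z ζ) := by
  have : (k₁ * z 0 ^ (k₁ - 1) : ℂ) ≠ 0 :=
    mul_ne_zero (by exact_mod_cast h₁) (pow_ne_zero _ hz)
  rw [singularCoeff, singularParamAt, eval_pderiv_zero_deformationPoly, mul_sub,
    mul_div_cancel₀ _ this]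
  ring

theorem singularCoeff_deformationPoly_one (f g : MvPolynomial (Fin 2) ℂ) {k₁ k₂ : ℕ}
    (h₂ : k₂ ≠ 0) (γ₁ γ₂ : ℂ) {z : Fin 2 → ℂ} (hz : z 1 ≠ 0) (ζ : ℂ) :
    singularCoeff f g (deformationPoly k₁ k₂ γ₁ γ₂) z ζ 1 =
      k₂ * z 1 ^ (k₂ - 1) * (γ₂ - singularParamAt f g k₂ 1 z ζ) := by
  have : (k₂ * z 1 ^ (k₂ - 1) : ℂ) ≠ 0 :=
    mul_ne_zero (by exact_mod_cast h₂) (pow_ne_zero _ hz)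
  rw [singularCoeff, singularParamAt, eval_pderiv_one_deformationPoly, mul_sub,
    mul_div_cancel₀ _ this]
  ring

theorem det_eq_zero_of_apply_eq_zero {A : ℂ × ℂ →L[ℝ] ℂ × ℂ} {v : ℂ × ℂ} (hv : v ≠ 0)
    (h : A v = 0) : A.det = 0 := by
  by_contra hdet
  have hinj := (LinearMap.equivOfDetNeZero (A : ℂ × ℂ →ₗ[ℝ] ℂ × ℂ) hdet).injective
  exact hv (hinj (by simpa using h))

/-- If a null vector of the Hessian of `|G|²` exists at a singular point, then the derivatives of
the singular coefficients vanish along a suitable direction. -/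
theorem hasDerivAt_singularCoeff_zero {p q : ℕ} (hq : 0 < q) {k : ℝ} (hk : k ≠ 0)
    {f g h : MvPolynomial (Fin 2) ℂ} (hequi : IsCircleEquivariant p q k (mixedMap f g h))
    {y : ℝ × ℂ} (hy : 0 < y.1) (hG0 : mixedMap f g h (slice y) ≠ 0) {θ : ℝ}
    (hs : ∀ v, ((starRingEnd ℂ) (Complex.exp (θ * Complex.I)) *
      fderiv ℝ (mixedMap f g h) (slice y) v).re = 0) {v : ℝ × ℂ}
    (hv : fderiv ℝ (fderiv ℝ (sliceNormSq (mixedMap f g h))) y v = 0) :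
    ∃ τ : ℝ, ∀ j, HasDerivAt (fun s : ℝ => singularCoeff f g h (slice y + s • slice v)
      (Complex.exp ((θ + s * τ : ℝ) * Complex.I)) j) 0 0 := by
  have hG := contDiff_mixedMap f g h
  have hG' := hG.differentiable (by simp)
  set z := slice y with hz
  set ζ := Complex.exp (θ * Complex.I) with hζdef
  have hζ : ‖ζ‖ = 1 := Complex.norm_exp_ofReal_mul_I θ
  have hζ0 : ζ ≠ 0 := Complex.exp_ne_zero _
  obtain ⟨r, hr⟩ := hequi.exists_eq_mul hk hG' hζ hs
  have hr0 : r ≠ 0 := by rintro rfl; simp [hr] at hG0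
  have hζζ : (starRingEnd ℂ) ζ * ζ = 1 := by
    rw [mul_comm, Complex.mul_conj, Complex.normSq_eq_norm_sq, hζ]; simp
  -- Since ζ̄ dG(v) is imaginary and G = rζ, G rotates with some speed τ to first order along v; the
  -- direction ζ is rotated with it.
  obtain ⟨τ, hτ⟩ : ∃ τ : ℝ, fderiv ℝ (mixedMap f g h) z (slice v) = τ * Complex.I * (r * ζ) := by
    have h1 := hs (slice v)
    set a := fderiv ℝ (mixedMap f g h) z (slice v)
    refine ⟨((starRingEnd ℂ) ζ * a).im / r, ?_⟩
    have h2 : (starRingEnd ℂ) ζ * a = (((starRingEnd ℂ) ζ * a).im : ℂ) * Complex.I := by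
      apply Complex.ext
      · rw [h1]; simp
      · simp
    have hr0' : (r : ℂ) ≠ 0 := by exact_mod_cast hr0
    calc a = ζ * ((starRingEnd ℂ) ζ * a) := by linear_combination -a * hζζ
      _ = _ := by rw [h2]; push_cast; field_simp; simp
  refine ⟨τ, ?_⟩
  let Z : ℝ → ℂ := fun s => Complex.exp ((θ + s * τ : ℝ) * Complex.I)
  have hZ0 : Z 0 = ζ := by simp [Z, hζdef]
  have hZn : ∀ s, ‖Z s‖ = 1 := fun s => Complex.norm_exp_ofReal_mul_I _
  have hZ : HasDerivAt Z (τ * Complex.I * ζ) 0 := by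
    have h1 : HasDerivAt (fun s : ℝ => ((θ + s * τ : ℝ) : ℂ)) τ 0 := by
      simpa using (((hasDerivAt_id (0 : ℝ)).mul_const τ).const_add θ).ofReal_comp
    refine ((h1.mul_const Complex.I).cexp).congr_deriv ?_
    simp [hζdef]
    ring
  let c : Fin 2 → ℝ → ℂ := fun j s => singularCoeff f g h (z + s • slice v) (Z s) j
  obtain ⟨c0, c1⟩ := (singularCoeff_eq_zero_iff f g h z hζ).1 hs
  have hc0 : ∀ j, c j 0 = 0 := by
    intro j
    simp only [c, zero_smul, add_zero, hZ0]
    fin_cases j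
    · exact c0
    · exact c1
  have d := fun a => hasDerivAt_eval_line a z (slice v)
  have hcd : ∀ j, ∃ c', HasDerivAt (c j) c' 0 := fun j =>
    ⟨_, ((((d (pderiv j f)).fun_mul (d g).complex_conj).fun_add (d (pderiv j h))).fun_add
      ((hZ.fun_pow 2).fun_mul ((d f).complex_conj.fun_mul (d (pderiv j g)))))⟩
  choose c' hc' using hcd
  have hGl := (hG' z).hasFDerivAt.hasDerivAt_line (slice v)
  -- G and rZ have the same value and derivative at s = 0. So the vanishing derivative of d|G|² = 2
  -- Re(Ḡ dG) on slice vectors passes to Re(Z̄ dG).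
  have hslice : ∀ u : ℝ × ℂ,
      ((starRingEnd ℂ) ζ * (c' 0 * slice u 0 + c' 1 * slice u 1)).re = 0 := by
    intro u
    have hW := hasDerivAt_fderiv_line hG z (slice v) (slice u)
    set W' := fderiv ℝ (fderiv ℝ (mixedMap f g h)) z (slice v) (slice u)
    have e1 := ((hGl.complex_conj.fun_mul hW).complex_re).const_mul (2 : ℝ)
    have e2 := hasDerivAt_fderiv_line (contDiff_sliceNormSq hG) y v u
    have e3 := e2.unique (e1.congr_of_eventuallyEq (Filter.Eventually.of_forall fun s => by
      simp only [fderiv_sliceNormSq hG', map_add, map_smul, ← hz]))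
    rw [hv, hτ] at e3
    simp only [zero_smul, add_zero, zero_apply, hr] at e3
    have e4 := (hZ.complex_conj.fun_mul hW).complex_re
    have e5 := (hZ.complex_conj.fun_mul
      (((hc' 0).mul_const (slice u 0)).fun_add ((hc' 1).mul_const (slice u 1)))).complex_re
    have e6 := e5.unique (e4.congr_of_eventuallyEq (Filter.Eventually.of_forall fun s =>
      (re_conj_mul_fderiv_mixedMap f g h _ _ (hZn s)).symm))
    simp only [hc0, zero_mul, add_zero, mul_zero, zero_add, hZ0, zero_smul] at e6
    rw [e6]
    set W := fderiv ℝ (mixedMap f g h) z (slice u)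
    have e7 : (starRingEnd ℂ) (τ * Complex.I * (r * ζ)) * W + (starRingEnd ℂ) (r * ζ) * W' =
        (r : ℂ) * ((starRingEnd ℂ) (τ * Complex.I * ζ) * W + (starRingEnd ℂ) ζ * W') := by
      simp only [map_mul, Complex.conj_ofReal]; ring
    rw [e7, Complex.re_ofReal_mul] at e3
    simpa [hr0] using e3.symm
  -- On orbit vectors dG is ikG, and the real part of Z̄ · ikG is stationary because Z and G rotate
  -- at the same speed.
  have horbit : ((starRingEnd ℂ) ζ * (c' 0 * orbitVelocity p q z 0 +
      c' 1 * orbitVelocity p q z 1)).re = 0 := by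
    have hξ : ∀ j, HasDerivAt (fun s : ℝ => orbitVelocity p q (z + s • slice v) j)
        (orbitVelocity p q (slice v) j) 0 := by
      intro j
      simp only [orbitVelocity_add_smul, Pi.add_apply, Pi.smul_apply]
      simpa using ((hasDerivAt_id (0 : ℝ)).smul_const
        (orbitVelocity p q (slice v) j)).const_add (orbitVelocity p q z j)
    have e5 := (hZ.complex_conj.fun_mul
      (((hc' 0).fun_mul (hξ 0)).fun_add ((hc' 1).fun_mul (hξ 1)))).complex_re
    have e4 := (hZ.complex_conj.fun_mul (hGl.const_mul (k * Complex.I))).complex_re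
    have e6 := e5.unique (e4.congr_of_eventuallyEq (Filter.Eventually.of_forall fun s => by
      have := re_conj_mul_fderiv_mixedMap f g h (z + s • slice v)
        (orbitVelocity p q (z + s • slice v)) (hZn s)
      rw [hequi.fderiv_orbitVelocity hG'] at this
      exact this.symm))
    simp only [hc0, zero_mul, add_zero, mul_zero, zero_add, hZ0, zero_smul] at e6
    rw [e6, hτ, hr]
    simp only [map_mul, Complex.conj_ofReal, Complex.conj_I]
    ring_nf
    simp
  -- The slice supplies all of ℂ in the second variable but only ℝ in the first; the orbit vector,
  -- with first coordinate iq y.1, supplies the missing imaginary direction.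
  have hc1 : c' 1 = 0 := (eq_zero_of_re_conj_mul (a := 0) hζ fun _ b => by
    simpa using hslice (0, b)).2
  have hc0' : c' 0 = 0 := by
    have h1 : ((starRingEnd ℂ) ζ * c' 0).re = 0 := by simpa using hslice (1, 0)
    have h2 := horbit
    rw [hc1, zero_mul, add_zero] at h2
    have h3 : (starRingEnd ℂ) ζ * (c' 0 * orbitVelocity p q z 0) =
        ((q * y.1 : ℝ) : ℂ) * (Complex.I * ((starRingEnd ℂ) ζ * c' 0)) := by
      simp [orbitVelocity, hz]; ring
    rw [h3, Complex.re_ofReal_mul, Complex.I_mul_re] at h2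
    have hqy : (q * y.1 : ℝ) ≠ 0 := mul_ne_zero (by exact_mod_cast hq.ne') hy.ne'
    have h4 : (starRingEnd ℂ) ζ * c' 0 = 0 :=
      Complex.ext h1 (neg_eq_zero.1 ((mul_eq_zero.1 h2).resolve_left hqy))
    exact (mul_eq_zero.1 h4).resolve_left (by simpa using hζ0)
  intro j
  have := hc' j
  fin_cases j
  · rw [← hc0']; exact hc' 0
  · rw [← hc1]; exact hc' 1

/-- Off the critical values of the parametrization, the Hessian is nondegenerate. -/
theorem injective_hessian_of_regular {p q : ℕ} (hq : 0 < q) {k : ℝ} (hk : k ≠ 0)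
    {f g : MvPolynomial (Fin 2) ℂ} {k₁ k₂ : ℕ} (h₁ : k₁ ≠ 0) (h₂ : k₂ ≠ 0) {γ₁ γ₂ : ℂ}
    (hequi : IsCircleEquivariant p q k (mixedMap f g (deformationPoly k₁ k₂ γ₁ γ₂)))
    (hγ : (γ₁, γ₂) ∉ singularParam f g k₁ k₂ ''
      {P | 0 < P.1.re ∧ P.2 ≠ 0 ∧ (fderiv ℝ (singularParam f g k₁ k₂) P).det = 0})
    {y : ℝ × ℂ} (hy : 0 < y.1) (hy' : y.2 ≠ 0)
    (hG0 : mixedMap f g (deformationPoly k₁ k₂ γ₁ γ₂) (slice y) ≠ 0) {ζ : ℂ} (hζ : ‖ζ‖ = 1)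
    (hs : ∀ v, ((starRingEnd ℂ) ζ *
      fderiv ℝ (mixedMap f g (deformationPoly k₁ k₂ γ₁ γ₂)) (slice y) v).re = 0) :
    Function.Injective
      (fderiv ℝ (fderiv ℝ (sliceNormSq (mixedMap f g (deformationPoly k₁ k₂ γ₁ γ₂)))) y) := by
  rw [injective_iff_map_eq_zero]
  intro v hv
  by_contra hv0
  obtain ⟨θ, rfl⟩ : ∃ θ : ℝ, ζ = Complex.exp (θ * Complex.I) :=
    ⟨ζ.arg, by simpa [hζ] using (Complex.norm_mul_exp_arg_mul_I ζ).symm⟩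
  obtain ⟨τ, hτ⟩ := hasDerivAt_singularCoeff_zero hq hk hequi hy hG0 hs hv
  -- Position and direction form one point of ℂ²: the free imaginary part of the first coordinate
  -- carries the angle of ζ, and w is the velocity of this point.
  let P : ℂ × ℂ := (⟨y.1, θ⟩, y.2)
  let w : ℂ × ℂ := (⟨v.1, τ⟩, v.2)
  have hP : ∀ s : ℝ, slicePoint (P + s • w) = slice y + s • slice v := fun s => by
    ext i; fin_cases i <;> simp [slicePoint, P, w]
  have hPθ : ∀ s : ℝ, (P + s • w).1.im = θ + s * τ := fun s => by simp [P, w]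
  have hP0 : slicePoint P = slice y := by simpa using hP 0
  have hd := (differentiableAt_singularParam f g h₁ h₂ (P := P) hy hy').hasFDerivAt.hasDerivAt_line w
  have hw0 : w ≠ 0 := by
    intro h0
    apply hv0
    have e1 := congrArg (fun P : ℂ × ℂ => P.1.re) h0
    have e2 := congrArg (fun P : ℂ × ℂ => P.2) h0
    exact Prod.ext e1 e2
  obtain ⟨c0, c1⟩ := (singularCoeff_eq_zero_iff _ _ _ _ hζ).1 hs
  have hy0 : slice y 0 ≠ 0 := by simpa using hy.ne'
  have hk1 : (k₁ * slice y 0 ^ (k₁ - 1) : ℂ) ≠ 0 :=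
    mul_ne_zero (by exact_mod_cast h₁) (pow_ne_zero _ hy0)
  have hk2 : (k₂ * slice y 1 ^ (k₂ - 1) : ℂ) ≠ 0 :=
    mul_ne_zero (by exact_mod_cast h₂) (pow_ne_zero _ hy')
  rw [singularCoeff_deformationPoly_zero f g h₁ _ _ hy0, mul_eq_zero, sub_eq_zero] at c0
  rw [singularCoeff_deformationPoly_one f g h₂ _ _ hy', mul_eq_zero, sub_eq_zero] at c1
  replace c0 := c0.resolve_left hk1
  replace c1 := c1.resolve_left hk2
  have hmono : ∀ (j : Fin 2) (kk : ℕ), ∃ b', HasDerivAt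
      (fun s : ℝ => (kk * (slice y + s • slice v) j ^ (kk - 1) : ℂ)) b' 0 := by
    intro j kk
    have h1 : HasDerivAt (fun s : ℝ => (slice y + s • slice v) j) (slice v j) 0 := by
      simpa using ((hasDerivAt_id (0 : ℝ)).smul_const (slice v j)).const_add (slice y j)
    exact ⟨_, (h1.fun_pow (kk - 1)).const_mul _⟩
  set d := fderiv ℝ (singularParam f g k₁ k₂) P w
  have hd0 : HasDerivAt (fun s : ℝ => singularParamAt f g k₁ 0 (slice y + s • slice v)
      (Complex.exp ((θ + s * τ : ℝ) * Complex.I))) d.1 0 := by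
    have := (hasFDerivAt_fst (𝕜 := ℝ) (p := singularParam f g k₁ k₂ (P + (0 : ℝ) • w))).comp_hasDerivAt
      (0 : ℝ) hd
    simp only [singularParam, Function.comp_def, hP, hPθ] at this
    exact this
  have hd1 : HasDerivAt (fun s : ℝ => singularParamAt f g k₂ 1 (slice y + s • slice v)
      (Complex.exp ((θ + s * τ : ℝ) * Complex.I))) d.2 0 := by
    have := (hasFDerivAt_snd (𝕜 := ℝ) (p := singularParam f g k₁ k₂ (P + (0 : ℝ) • w))).comp_hasDerivAt
      (0 : ℝ) hd
    simp only [singularParam, Function.comp_def, hP, hPθ] at this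
    exact this
  have hcont : ∀ j : Fin 2, Continuous fun s : ℝ => (slice y + s • slice v) j := fun j => by
    simp only [Pi.add_apply, Pi.smul_apply]; fun_prop
  -- The singular coefficient is a nonvanishing monomial times γ₁ minus the parameter. This
  -- difference is zero at s = 0, so only its derivative contributes.
  have hd0' : d.1 = 0 := by
    obtain ⟨b', hb'⟩ := hmono 0 k₁
    have e1 := hb'.fun_mul (hd0.const_sub γ₁)
    have hne : ∀ᶠ s : ℝ in 𝓝 0, (slice y + s • slice v) 0 ≠ 0 :=
      (hcont 0).continuousAt.eventually_ne (by simpa using hy.ne')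
    have e2 := e1.unique ((hτ 0).congr_of_eventuallyEq (by
      filter_upwards [hne] with s hs
      exact (singularCoeff_deformationPoly_zero f g h₁ γ₁ γ₂ hs _).symm))
    simp only [zero_smul, add_zero, zero_mul, ← c0, sub_self, mul_zero, zero_add, mul_neg,
      neg_eq_zero] at e2
    exact (mul_eq_zero.1 e2).resolve_left hk1
  have hd1' : d.2 = 0 := by
    obtain ⟨b', hb'⟩ := hmono 1 k₂
    have e1 := hb'.fun_mul (hd1.const_sub γ₂)
    have hne : ∀ᶠ s : ℝ in 𝓝 0, (slice y + s • slice v) 1 ≠ 0 :=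
      (hcont 1).continuousAt.eventually_ne (by simpa using hy')
    have e2 := e1.unique ((hτ 1).congr_of_eventuallyEq (by
      filter_upwards [hne] with s hs
      exact (singularCoeff_deformationPoly_one f g h₂ γ₁ γ₂ hs _).symm))
    simp only [zero_smul, add_zero, zero_mul, ← c1, sub_self, mul_zero, zero_add, mul_neg,
      neg_eq_zero] at e2
    exact (mul_eq_zero.1 e2).resolve_left hk2
  refine hγ ⟨P, ⟨hy, hy', det_eq_zero_of_apply_eq_zero hw0 (Prod.ext hd0' hd1')⟩, ?_⟩
  simp only [singularParam, hP0, P]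
  rw [← c0, ← c1]

/-- The parameters for which `G` is singular and vanishes at a point where `f` and `g` do not
vanish; they do not depend on the direction of the singularity. -/
noncomputable def vanishingParam (f g : MvPolynomial (Fin 2) ℂ) (k₁ k₂ : ℕ) (P : ℂ × ℂ) : ℂ × ℂ :=
  ((eval (slicePoint P) f * (starRingEnd ℂ) (eval (slicePoint P) g) *
      (eval (slicePoint P) (pderiv 0 g) * (eval (slicePoint P) g)⁻¹ -
        eval (slicePoint P) (pderiv 0 f) * (eval (slicePoint P) f)⁻¹)) /
      (k₁ * slicePoint P 0 ^ (k₁ - 1)),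
    (eval (slicePoint P) f * (starRingEnd ℂ) (eval (slicePoint P) g) *
      (eval (slicePoint P) (pderiv 1 g) * (eval (slicePoint P) g)⁻¹ -
        eval (slicePoint P) (pderiv 1 f) * (eval (slicePoint P) f)⁻¹)) /
      (k₂ * slicePoint P 1 ^ (k₂ - 1)))

/-- The map ignores the imaginary part of its first argument, so its differential is singular
everywhere. -/
theorem measure_image_vanishingParam (μ : MeasureTheory.Measure (ℂ × ℂ)) [μ.IsAddHaarMeasure]
    (f g : MvPolynomial (Fin 2) ℂ) {k₁ k₂ : ℕ} (h₁ : k₁ ≠ 0)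
    (h₂ : k₂ ≠ 0) :
    μ (vanishingParam f g k₁ k₂ '' {P | 0 < P.1.re ∧ P.2 ≠ 0 ∧
      eval (slicePoint P) f ≠ 0 ∧ eval (slicePoint P) g ≠ 0}) = 0 := by
  have d := differentiable_eval_slicePoint
  have hdiff : ∀ P ∈ {P : ℂ × ℂ | 0 < P.1.re ∧ P.2 ≠ 0 ∧
      eval (slicePoint P) f ≠ 0 ∧ eval (slicePoint P) g ≠ 0},
      DifferentiableAt ℝ (vanishingParam f g k₁ k₂) P := by
    rintro P ⟨hP, hP', hf, hg⟩
    have hnum : ∀ j, DifferentiableAt ℝ (fun P => eval (slicePoint P) f *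
        (starRingEnd ℂ) (eval (slicePoint P) g) *
        (eval (slicePoint P) (pderiv j g) * (eval (slicePoint P) g)⁻¹ -
          eval (slicePoint P) (pderiv j f) * (eval (slicePoint P) f)⁻¹)) P := fun j =>
      ((d _ P).fun_mul (differentiable_conj_comp (d _) P)).fun_mul
        (((d _ P).fun_mul ((d _ P).inv hg)).fun_sub ((d _ P).fun_mul ((d _ P).inv hf)))
    exact (differentiableAt_div_monomial (hnum 0) h₁
      (by simpa [slicePoint] using hP.ne')).prodMk
      (differentiableAt_div_monomial (hnum 1) h₂ (by simpa [slicePoint] using hP'))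
  refine MeasureTheory.addHaar_image_eq_zero_of_det_fderivWithin_eq_zero μ
    (fun P hP => (hdiff P hP).hasFDerivAt.hasFDerivWithinAt) fun P hP => ?_
  refine det_eq_zero_of_apply_eq_zero (v := (Complex.I, 0)) (by simp) ?_
  have h1 := (hdiff P hP).hasFDerivAt.hasDerivAt_line (Complex.I, 0)
  refine h1.unique ((hasDerivAt_const (0 : ℝ) (vanishingParam f g k₁ k₂ P)).congr_of_eventuallyEq
    (Filter.Eventually.of_forall fun s => ?_))
  have : slicePoint (P + s • (Complex.I, (0 : ℂ))) = slicePoint P := by simp [slicePoint]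
  simp only [vanishingParam, this]

/-- Sard's theorem in equal dimensions. -/
theorem measure_image_singularParam (μ : MeasureTheory.Measure (ℂ × ℂ)) [μ.IsAddHaarMeasure]
    (f g : MvPolynomial (Fin 2) ℂ) {k₁ k₂ : ℕ} (h₁ : k₁ ≠ 0)
    (h₂ : k₂ ≠ 0) :
    μ (singularParam f g k₁ k₂ '' {P | 0 < P.1.re ∧ P.2 ≠ 0 ∧
      (fderiv ℝ (singularParam f g k₁ k₂) P).det = 0}) = 0 :=
  MeasureTheory.addHaar_image_eq_zero_of_det_fderivWithin_eq_zero μ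
    (fun _ hP => (differentiableAt_singularParam f g h₁ h₂ hP.1
      hP.2.1).hasFDerivAt.hasFDerivWithinAt) fun _ hP => hP.2.2

theorem measure_line (μ : MeasureTheory.Measure (ℂ × ℂ)) [μ.IsAddHaarMeasure] (c : ℂ) :
    μ {γ : ℂ × ℂ | γ.1 + c * γ.2 = 0} = 0 := by
  let ℓ : ℂ × ℂ →ₗ[ℝ] ℂ := LinearMap.fst ℝ ℂ ℂ + c • LinearMap.snd ℝ ℂ ℂ
  refine MeasureTheory.Measure.addHaar_submodule μ (LinearMap.ker ℓ) fun h => ?_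
  have : ((1 : ℂ), (0 : ℂ)) ∈ LinearMap.ker ℓ := h ▸ Submodule.mem_top
  simp [ℓ] at this

/-- The one-variable polynomial a(1, X) is nonzero because its value at 0 is. -/
theorem finite_zeros_on_line {a : MvPolynomial (Fin 2) ℂ} (ha : eval ![1, 0] a ≠ 0) :
    {b : ℂ | eval ![1, b] a = 0}.Finite := by
  let P : Polynomial ℂ := aeval ![1, Polynomial.X] a
  have hP : ∀ b, P.eval b = eval ![1, b] a := by
    intro b
    have h1 : P.eval b = (Polynomial.aeval b : Polynomial ℂ →ₐ[ℂ] ℂ) P := by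
      simp [Polynomial.aeval_def]
    have h2 : (Polynomial.aeval b : Polynomial ℂ →ₐ[ℂ] ℂ).comp (aeval ![1, Polynomial.X]) =
        (aeval ![1, b] : MvPolynomial (Fin 2) ℂ →ₐ[ℂ] ℂ) := by
      ext i
      fin_cases i <;> simp
    rw [h1, ← MvPolynomial.aeval_eq_eval]
    exact DFunLike.congr_fun h2 a
  have hP0 : P ≠ 0 := fun h0 => ha (by rw [← hP, h0, Polynomial.eval_zero])
  refine (P.finite_setOfPred_isRoot hP0).subset fun b hb => ?_
  simpa [Polynomial.IsRoot, hP] using hb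

/-- If `G` vanishes at a singular point with `f g ≠ 0`, then the direction of the singularity is
determined by `f` and `g`. -/
theorem mem_image_vanishingParam {p q a b : ℕ} (hb : b ≠ 0) (hab : b ≤ a)
    {f g : MvPolynomial (Fin 2) ℂ} (hf : IsWeightedHomogeneous ![q, p] f a)
    (hg : IsWeightedHomogeneous ![q, p] g b) {k₁ k₂ : ℕ} (h₁ : k₁ ≠ 0) (h₂ : k₂ ≠ 0) {γ₁ γ₂ : ℂ}
    (hh : IsWeightedHomogeneous ![q, p] (deformationPoly k₁ k₂ γ₁ γ₂) (a - b))
    {y : ℝ × ℂ} (hy : 0 < y.1) (hy' : y.2 ≠ 0) {ζ : ℂ}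
    (c0 : singularCoeff f g (deformationPoly k₁ k₂ γ₁ γ₂) (slice y) ζ 0 = 0)
    (c1 : singularCoeff f g (deformationPoly k₁ k₂ γ₁ γ₂) (slice y) ζ 1 = 0)
    (hG0 : mixedMap f g (deformationPoly k₁ k₂ γ₁ γ₂) (slice y) = 0)
    (hf0 : eval (slice y) f ≠ 0) (hg0 : eval (slice y) g ≠ 0) :
    (γ₁, γ₂) ∈ vanishingParam f g k₁ k₂ '' {P | 0 < P.1.re ∧ P.2 ≠ 0 ∧
      eval (slicePoint P) f ≠ 0 ∧ eval (slicePoint P) g ≠ 0} := by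
  have hP : slicePoint ((y.1 : ℂ), y.2) = slice y := rfl
  have e1 := euler_identity hf (slice y)
  have e2 := euler_identity hg (slice y)
  have e3 := euler_identity hh (slice y)
  have hy0 : slice y 0 ≠ 0 := by simpa using hy.ne'
  have hk1 : (k₁ * slice y 0 ^ (k₁ - 1) : ℂ) ≠ 0 :=
    mul_ne_zero (by exact_mod_cast h₁) (pow_ne_zero _ hy0)
  have hk2 : (k₂ * slice y 1 ^ (k₂ - 1) : ℂ) ≠ 0 :=
    mul_ne_zero (by exact_mod_cast h₂) (pow_ne_zero _ hy')
  have hb' : (b : ℂ) ≠ 0 := by exact_mod_cast hb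
  rw [Nat.cast_sub hab] at e3
  rw [mixedMap] at hG0
  simp only [singularCoeff] at c0 c1
  -- Weighting the singular equations by q z₁ and p z₂, Euler's identities give a f ḡ + (a-b) h + b
  -- ζ² f̄ g = 0. With f ḡ + h = 0 this becomes ζ² f̄ g = -f ḡ, which eliminates ζ.
  have key : ζ ^ 2 * (starRingEnd ℂ) (eval (slice y) f) =
      -(eval (slice y) f * (starRingEnd ℂ) (eval (slice y) g)) * (eval (slice y) g)⁻¹ := by
    rw [eq_mul_inv_iff_mul_eq₀ hg0]
    apply mul_left_cancel₀ hb'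
    linear_combination (q * slice y 0) * c0 + (p * slice y 1) * c1 -
      (starRingEnd ℂ) (eval (slice y) g) * e1 -
      ζ ^ 2 * (starRingEnd ℂ) (eval (slice y) f) * e2 - e3 - (a - b : ℂ) * hG0
  refine ⟨((y.1 : ℂ), y.2), ⟨by simpa using hy, hy', by rwa [hP], by rwa [hP]⟩, ?_⟩
  rw [vanishingParam, hP]
  refine Prod.ext ?_ ?_
  · simp only
    rw [div_eq_iff hk1]
    rw [eval_pderiv_zero_deformationPoly] at c0
    have := mul_inv_cancel₀ hf0
    linear_combination eval (slice y) (pderiv 0 g) * key - c0 - eval (slice y) (pderiv 0 f) *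
      (starRingEnd ℂ) (eval (slice y) g) * this
  · simp only
    rw [div_eq_iff hk2]
    rw [eval_pderiv_one_deformationPoly] at c1
    have := mul_inv_cancel₀ hf0
    linear_combination eval (slice y) (pderiv 1 g) * key - c1 - eval (slice y) (pderiv 1 f) *
      (starRingEnd ℂ) (eval (slice y) g) * this

/-! ### Excluding the axes and the common zeros -/

/-- Put κ = a ā', ρ = |b|^(2N), d = M-N. Taking moduli in the equation gives |Mκρ + dγ| = N|κ|ρ. But
the product of Mκρ + dγ with κ̄ has real part M|κ|²ρ + d Re(κ̄γ) > N|κ|²ρ. -/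
theorem not_singular_of_re_pos {a a' γ b ζ : ℂ} {M N : ℕ} (hlt : N < M)
    (hζ : ‖ζ‖ = 1) (hb : b ≠ 0) (ha : 0 < ((starRingEnd ℂ) (a * (starRingEnd ℂ) a') * γ).re) :
    (M : ℂ) * (a * b ^ M) * (starRingEnd ℂ) (a' * b ^ N) + (M - N : ℕ) * γ * b ^ (M - N) +
      ζ ^ 2 * N * (starRingEnd ℂ) (a * b ^ M) * (a' * b ^ N) ≠ 0 := by
  intro h
  set κ := a * (starRingEnd ℂ) a' with hκ
  set ρ : ℝ := Complex.normSq b ^ N with hρ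
  have hρ0 : 0 < ρ := pow_pos (Complex.normSq_pos.2 hb) N
  have hbb : b ^ N * (starRingEnd ℂ) b ^ N = (ρ : ℂ) := by
    rw [← mul_pow, Complex.mul_conj, hρ]; push_cast; rfl
  obtain ⟨d, rfl⟩ := Nat.exists_eq_add_of_le hlt.le
  rw [Nat.add_sub_cancel_left] at h
  have h1 : b ^ d * (((N + d : ℕ) : ℂ) * κ * ρ + d * γ) =
      -(ζ ^ 2 * N * (starRingEnd ℂ) κ * (starRingEnd ℂ) b ^ d * ρ) := by
    simp only [map_mul, map_pow, pow_add] at h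
    rw [hκ, map_mul, Complex.conj_conj]
    linear_combination h - (((N + d : ℕ) : ℂ) * a * (starRingEnd ℂ) a' * b ^ d +
      ζ ^ 2 * N * (starRingEnd ℂ) a * a' * (starRingEnd ℂ) b ^ d) * hbb
  have h2 := congrArg norm h1
  simp only [norm_mul, norm_neg, norm_pow, hζ, RCLike.norm_conj, Complex.norm_natCast,
    Complex.norm_real, Real.norm_of_nonneg hρ0.le, one_pow, one_mul] at h2
  have hbd : 0 < ‖b‖ ^ d := pow_pos (norm_pos_iff.2 hb) d
  have h3 : ‖((N + d : ℕ) : ℂ) * κ * ρ + d * γ‖ = N * ‖κ‖ * ρ := by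
    apply mul_left_cancel₀ hbd.ne'
    rw [h2]; ring
  have h4 : ((starRingEnd ℂ) κ * (((N + d : ℕ) : ℂ) * κ * ρ + d * γ)).re =
      (N + d) * ‖κ‖ ^ 2 * ρ + d * ((starRingEnd ℂ) κ * γ).re := by
    have : (starRingEnd ℂ) κ * (((N + d : ℕ) : ℂ) * κ * ρ + d * γ) =
        (((N + d) * ‖κ‖ ^ 2 * ρ : ℝ) : ℂ) + ((d : ℝ) : ℂ) * ((starRingEnd ℂ) κ * γ) := by
      have hk : κ * (starRingEnd ℂ) κ = ((‖κ‖ ^ 2 : ℝ) : ℂ) := by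
        rw [Complex.mul_conj, Complex.normSq_eq_norm_sq]
      push_cast at hk ⊢
      linear_combination ((N + d : ℂ) * ρ) * hk
    rw [this, Complex.add_re, Complex.ofReal_re, Complex.re_ofReal_mul]
  have h5 := Complex.re_le_norm ((starRingEnd ℂ) κ * (((N + d : ℕ) : ℂ) * κ * ρ + d * γ))
  rw [h4, norm_mul ((starRingEnd ℂ) κ), RCLike.norm_conj, h3] at h5
  have hd : (0 : ℝ) < d := by exact_mod_cast (by omega : 0 < d)
  have h6 : 0 < (d : ℝ) * ((starRingEnd ℂ) κ * γ).re := mul_pos hd ha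
  have h7 : 0 ≤ (d : ℝ) * ‖κ‖ ^ 2 * ρ := by positivity
  nlinarith

/-- A p-th root of z₂ moves (0, 1) to the given point of the axis, and homogeneity does the rest. -/
theorem eval_axis_one {p q e : ℕ} (hp : 0 < p) {f : MvPolynomial (Fin 2) ℂ}
    (hf : IsWeightedHomogeneous ![q, p] f (p * e)) {z : Fin 2 → ℂ} (hz : z 0 = 0) :
    eval z f = eval ![0, 1] f * z 1 ^ e := by
  obtain ⟨c, hc⟩ := IsAlgClosed.exists_pow_nat_eq (z 1) hp
  have h1 : weightedAct p q c ![0, 1] = z := by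
    ext i; fin_cases i <;> simp [hz, hc]
  rw [← h1, eval_weightedAct hf, h1, pow_mul, hc, mul_comm]

theorem eval_axis_zero {p q e : ℕ} (hq : 0 < q) {f : MvPolynomial (Fin 2) ℂ}
    (hf : IsWeightedHomogeneous ![q, p] f (q * e)) {z : Fin 2 → ℂ} (hz : z 1 = 0) :
    eval z f = eval ![1, 0] f * z 0 ^ e := by
  obtain ⟨c, hc⟩ := IsAlgClosed.exists_pow_nat_eq (z 0) hq
  have h1 : weightedAct p q c ![1, 0] = z := by
    ext i; fin_cases i <;> simp [hz, hc]
  rw [← h1, eval_weightedAct hf, h1, pow_mul, hc, mul_comm]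

theorem natCast_mul_pow_sub_one_mul {k : ℕ} (hk : k ≠ 0) (b γ : ℂ) :
    b * (k * b ^ (k - 1) * γ) = k * γ * b ^ k := by
  obtain ⟨j, rfl⟩ := Nat.exists_eq_succ_of_ne_zero hk
  rw [Nat.succ_sub_one, pow_succ]
  ring

/-- For suitable `γ₂` there are no singularities on the axis `z₁ = 0`. -/
theorem singularCoeff_one_ne_zero {p q M N : ℕ} (hp : 0 < p) (hNM : N < M)
    {f g : MvPolynomial (Fin 2) ℂ} (hf : IsWeightedHomogeneous ![q, p] f (p * M))
    (hg : IsWeightedHomogeneous ![q, p] g (p * N)) {k₁ : ℕ} {γ₁ γ₂ : ℂ}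
    (hγ : 0 < ((starRingEnd ℂ) (eval ![0, 1] f * (starRingEnd ℂ) (eval ![0, 1] g)) * γ₂).re)
    {z : Fin 2 → ℂ} (hz : z 0 = 0) (hz' : z 1 ≠ 0) {ζ : ℂ} (hζ : ‖ζ‖ = 1) :
    singularCoeff f g (deformationPoly k₁ (M - N) γ₁ γ₂) z ζ 1 ≠ 0 := by
  intro h
  have hp' : (p : ℂ) ≠ 0 := by exact_mod_cast hp.ne'
  have e1 : z 1 * eval z (pderiv 1 f) = M * eval z f := by
    have := euler_identity hf z
    rw [hz] at this
    apply mul_left_cancel₀ hp'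
    push_cast at this
    linear_combination this
  have e2 : z 1 * eval z (pderiv 1 g) = N * eval z g := by
    have := euler_identity hg z
    rw [hz] at this
    apply mul_left_cancel₀ hp'
    push_cast at this
    linear_combination this
  refine not_singular_of_re_pos hNM hζ hz' hγ ?_
  rw [← eval_axis_one hp hf hz, ← eval_axis_one hp hg hz]
  rw [singularCoeff, eval_pderiv_one_deformationPoly] at h
  have e3 := natCast_mul_pow_sub_one_mul (by omega : M - N ≠ 0) (z 1) γ₂
  linear_combination z 1 * h - (starRingEnd ℂ) (eval z g) * e1 -
    ζ ^ 2 * (starRingEnd ℂ) (eval z f) * e2 - e3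

/-- For suitable `γ₁` there are no singularities on the axis `z₂ = 0`. -/
theorem singularCoeff_zero_ne_zero {p q M N : ℕ} (hq : 0 < q) (hNM : N < M)
    {f g : MvPolynomial (Fin 2) ℂ} (hf : IsWeightedHomogeneous ![q, p] f (q * M))
    (hg : IsWeightedHomogeneous ![q, p] g (q * N)) {k₂ : ℕ} {γ₁ γ₂ : ℂ}
    (hγ : 0 < ((starRingEnd ℂ) (eval ![1, 0] f * (starRingEnd ℂ) (eval ![1, 0] g)) * γ₁).re)
    {z : Fin 2 → ℂ} (hz : z 1 = 0) (hz' : z 0 ≠ 0) {ζ : ℂ} (hζ : ‖ζ‖ = 1) :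
    singularCoeff f g (deformationPoly (M - N) k₂ γ₁ γ₂) z ζ 0 ≠ 0 := by
  intro h
  have hq' : (q : ℂ) ≠ 0 := by exact_mod_cast hq.ne'
  have e1 : z 0 * eval z (pderiv 0 f) = M * eval z f := by
    have := euler_identity hf z
    rw [hz] at this
    apply mul_left_cancel₀ hq'
    push_cast at this
    linear_combination this
  have e2 : z 0 * eval z (pderiv 0 g) = N * eval z g := by
    have := euler_identity hg z
    rw [hz] at this
    apply mul_left_cancel₀ hq'
    push_cast at this
    linear_combination this
  refine not_singular_of_re_pos hNM hζ hz' hγ ?_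
  rw [← eval_axis_zero hq hf hz, ← eval_axis_zero hq hg hz]
  rw [singularCoeff, eval_pderiv_zero_deformationPoly] at h
  have e3 := natCast_mul_pow_sub_one_mul (by omega : M - N ≠ 0) (z 0) γ₁
  linear_combination z 0 * h - (starRingEnd ℂ) (eval z g) * e1 -
    ζ ^ 2 * (starRingEnd ℂ) (eval z f) * e2 - e3

theorem eval_axis_ne_zero {p q e : ℕ} (hp : 0 < p) (hq : 0 < q) {f : MvPolynomial (Fin 2) ℂ}
    (hf : IsWeightedHomogeneous ![q, p] f (p * q * e)) (hc : IsConvenient f) :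
    eval ![1, 0] f ≠ 0 ∧ eval ![0, 1] f ≠ 0 := by
  constructor
  · obtain ⟨c, hc⟩ := hc 0
    intro h
    rw [eval_axis_zero (e := p * e) hq (by convert hf using 1; ring) (by simp), h] at hc
    simp at hc
  · obtain ⟨c, hc⟩ := hc 1
    intro h
    rw [eval_axis_one (e := q * e) hp (by convert hf using 1; ring) (by simp), h] at hc
    simp at hc

/-- If `G` and `f g` vanish at a common point, then the parameters lie on one of finitely many
lines. -/
theorem mem_line_of_vanishing {p q a : ℕ} (hq : 0 < q) {f g : MvPolynomial (Fin 2) ℂ}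
    (hfg : IsWeightedHomogeneous ![q, p] (f * g) a) {k₁ k₂ D : ℕ} {γ₁ γ₂ : ℂ}
    (hh : IsWeightedHomogeneous ![q, p] (deformationPoly k₁ k₂ γ₁ γ₂) D) {z : Fin 2 → ℂ}
    (hz : z 0 ≠ 0) (h0 : eval z f = 0 ∨ eval z g = 0)
    (hG0 : mixedMap f g (deformationPoly k₁ k₂ γ₁ γ₂) z = 0) :
    (γ₁, γ₂) ∈ ⋃ b ∈ {b : ℂ | eval ![1, b] (f * g) = 0}, {γ : ℂ × ℂ | γ.1 + b ^ k₂ * γ.2 = 0} := by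
  -- A q-th root of z₁ normalizes the point to (1, b). There fg = 0 restricts b to finitely many
  -- values, and G = h = 0 is a line in (γ₁, γ₂).
  obtain ⟨c, hc⟩ := IsAlgClosed.exists_pow_nat_eq (z 0) hq
  have hc0 : c ≠ 0 := by rintro rfl; rw [zero_pow hq.ne'] at hc; exact hz hc.symm
  have hact : weightedAct p q c ![1, z 1 / c ^ p] = z := by
    ext i
    fin_cases i
    · simp [hc]
    · simp [mul_div_cancel₀ _ (pow_ne_zero p hc0)]
  have hfg0 : eval z (f * g) = 0 := by rw [map_mul]; exact mul_eq_zero.2 h0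
  have hP : eval z f * (starRingEnd ℂ) (eval z g) = 0 := by
    rcases h0 with h | h <;> simp [h]
  rw [mixedMap, hP, zero_add, ← hact, eval_weightedAct hh, mul_eq_zero] at hG0
  rw [← hact, eval_weightedAct hfg, mul_eq_zero] at hfg0
  refine Set.mem_biUnion (x := z 1 / c ^ p) (hfg0.resolve_left (pow_ne_zero _ hc0)) ?_
  have := hG0.resolve_left (pow_ne_zero _ hc0)
  rw [eval_deformationPoly] at this
  simpa [mul_comm] using this

theorem re_conj_mul_self_pos {κ : ℂ} (hκ : κ ≠ 0) : 0 < ((starRingEnd ℂ) κ * κ).re := by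
  rw [mul_comm, Complex.mul_conj, Complex.ofReal_re]
  exact Complex.normSq_pos.2 hκ

/-! ### The generic choice of parameters -/

/-- For generic coefficients of the deformation term, every singularity of `f * conj g + h` away
from the origin is a fold. -/
theorem exists_generic_deformation {p q m n : ℕ} (hp : 0 < p) (hq : 0 < q) (hn : 0 < n)
    (hnm : n < m) {f g : MvPolynomial (Fin 2) ℂ}
    (hf : IsWeightedHomogeneous ![q, p] f (p * q * m))
    (hg : IsWeightedHomogeneous ![q, p] g (p * q * n)) (hfc : IsConvenient f)
    (hgc : IsConvenient g) :
    ∃ γ₁ γ₂ : ℂ, γ₁ ≠ 0 ∧ γ₂ ≠ 0 ∧ ∀ y : ℝ × ℂ, 0 ≤ y.1 → y ≠ 0 → ∀ ζ : ℂ, ‖ζ‖ = 1 →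
      (∀ v, ((starRingEnd ℂ) ζ * fderiv ℝ
        (mixedMap f g (deformationPoly (p * (m - n)) (q * (m - n)) γ₁ γ₂)) (slice y) v).re = 0) →
      IsSliceFold (mixedMap f g (deformationPoly (p * (m - n)) (q * (m - n)) γ₁ γ₂)) y := by
  obtain ⟨hf1, hf2⟩ := eval_axis_ne_zero hp hq hf hfc
  obtain ⟨hg1, hg2⟩ := eval_axis_ne_zero hp hq hg hgc
  have hd : 0 < m - n := Nat.sub_pos_of_lt hnm
  have h₁ : p * (m - n) ≠ 0 := (Nat.mul_pos hp hd).ne'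
  have h₂ : q * (m - n) ≠ 0 := (Nat.mul_pos hq hd).ne'
  set k₁ := p * (m - n) with hk₁
  set k₂ := q * (m - n) with hk₂
  set κ₁ := eval ![1, 0] f * (starRingEnd ℂ) (eval ![1, 0] g) with hκ₁
  set κ₂ := eval ![0, 1] f * (starRingEnd ℂ) (eval ![0, 1] g) with hκ₂
  let μ : MeasureTheory.Measure (ℂ × ℂ) := MeasureTheory.Measure.addHaar
  -- Parameters in this open set give no singularities on the axes. Below, S₁ accounts for
  -- degenerate Hessians, S₂ for singular zeros of G off fg = 0, and S₃ for zeros of G on fg = 0.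
  let O : Set (ℂ × ℂ) :=
    {γ | 0 < ((starRingEnd ℂ) κ₁ * γ.1).re ∧ 0 < ((starRingEnd ℂ) κ₂ * γ.2).re}
  have hO : IsOpen O :=
    (isOpen_lt continuous_const (Complex.continuous_re.comp (continuous_fst.const_mul _))).inter
      (isOpen_lt continuous_const (Complex.continuous_re.comp (continuous_snd.const_mul _)))
  have hOne : O.Nonempty := ⟨(κ₁, κ₂),
    re_conj_mul_self_pos (mul_ne_zero hf1 (by simpa using hg1)),
    re_conj_mul_self_pos (mul_ne_zero hf2 (by simpa using hg2))⟩
  let S₁ := singularParam f g k₁ k₂ '' {P | 0 < P.1.re ∧ P.2 ≠ 0 ∧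
      (fderiv ℝ (singularParam f g k₁ k₂) P).det = 0}
  let S₂ := vanishingParam f g k₁ k₂ '' {P | 0 < P.1.re ∧ P.2 ≠ 0 ∧
      eval (slicePoint P) f ≠ 0 ∧ eval (slicePoint P) g ≠ 0}
  let S₃ := ⋃ b ∈ {b : ℂ | eval ![1, b] (f * g) = 0}, {γ : ℂ × ℂ | γ.1 + b ^ k₂ * γ.2 = 0}
  have hS₃ : μ S₃ = 0 := by
    refine (MeasureTheory.measure_biUnion_null_iff
      (finite_zeros_on_line (by rw [map_mul]; exact mul_ne_zero hf1 hg1)).countable).2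
      fun b _ => measure_line μ _
  have hS : μ (S₁ ∪ S₂ ∪ S₃) = 0 := MeasureTheory.measure_union_null
    (MeasureTheory.measure_union_null (measure_image_singularParam μ f g h₁ h₂)
      (measure_image_vanishingParam μ f g h₁ h₂)) hS₃
  obtain ⟨⟨γ₁, γ₂⟩, ⟨hγ₁, hγ₂⟩, hγ⟩ : (O \ (S₁ ∪ S₂ ∪ S₃)).Nonempty := by
    refine MeasureTheory.nonempty_of_measure_ne_zero (μ := μ) ?_
    rw [MeasureTheory.measure_sdiff_null hS]
    exact hO.measure_ne_zero μ hOne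
  simp only [Set.mem_union, not_or] at hγ
  obtain ⟨⟨hγS₁, hγS₂⟩, hγS₃⟩ := hγ
  have hsub : p * q * m - p * q * n = p * q * (m - n) := (Nat.mul_sub ..).symm
  have hle : p * q * n ≤ p * q * m := Nat.mul_le_mul_left _ hnm.le
  have hh : IsWeightedHomogeneous ![q, p] (deformationPoly k₁ k₂ γ₁ γ₂)
      (p * q * m - p * q * n) := by
    rw [hsub]
    exact isWeightedHomogeneous_deformationPoly (by rw [hk₁]; ring) (by rw [hk₂]; ring) γ₁ γ₂
  have hequi := isCircleEquivariant_mixedMap hle hf hg hh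
  have hk : (((p * q * m - p * q * n : ℕ) : ℝ)) ≠ 0 := by
    rw [hsub]
    exact_mod_cast (Nat.mul_pos (Nat.mul_pos hp hq) hd).ne'
  refine ⟨γ₁, γ₂, ?_, ?_, fun y hy hy0 ζ hζ hs => ?_⟩
  · rintro rfl; simp at hγ₁
  · rintro rfl; simp at hγ₂
  obtain ⟨c0, c1⟩ := (singularCoeff_eq_zero_iff _ _ _ _ hζ).1 hs
  have hy1 : 0 < y.1 := by
    refine lt_of_le_of_ne hy fun h0 => ?_
    have hy2 : y.2 ≠ 0 := fun h2 => hy0 (Prod.ext h0.symm h2)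
    refine singularCoeff_one_ne_zero (M := q * m) (N := q * n) hp
      (Nat.mul_lt_mul_of_pos_left hnm hq) (by convert hf using 1; ring)
      (by convert hg using 1; ring) hγ₂ (z := slice y) (by simp [← h0]) hy2 hζ ?_ (k₁ := k₁)
      (γ₁ := γ₁)
    rw [← Nat.mul_sub]
    exact c1
  have hy2 : y.2 ≠ 0 := by
    intro h0
    refine singularCoeff_zero_ne_zero (M := p * m) (N := p * n) hq
      (Nat.mul_lt_mul_of_pos_left hnm hp) (by convert hf using 1; ring)
      (by convert hg using 1; ring) hγ₁ (z := slice y) (by simp [h0]) (by simpa using hy1.ne') hζ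
      ?_ (k₂ := k₂) (γ₂ := γ₂)
    rw [← Nat.mul_sub]
    exact c0
  have hG0 : mixedMap f g (deformationPoly k₁ k₂ γ₁ γ₂) (slice y) ≠ 0 := by
    intro hG0
    by_cases h0 : eval (slice y) f = 0 ∨ eval (slice y) g = 0
    · exact hγS₃ (mem_line_of_vanishing hq (hf.mul hg) hh (by simpa using hy1.ne') h0 hG0)
    · push Not at h0
      exact hγS₂ (mem_image_vanishingParam (Nat.mul_pos (Nat.mul_pos hp hq) hn).ne' hle hf hg h₁ h₂
        hh hy1 hy2 c0 c1 hG0 h0.1 h0.2)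
  exact isSliceFold_of_nondegenerate hq hk hequi hy1 hG0 hζ hs
    (injective_hessian_of_regular hq hk h₁ h₂ hequi hγS₁ hy1 hy2 hG0 hζ hs)

/-! ### Rescaling -/

theorem weightedAct_one_left (p q : ℕ) (z : Fin 2 → ℂ) : weightedAct p q 1 z = z := by
  ext i; fin_cases i <;> simp

theorem weightedAct_inv_cancel (p q : ℕ) {c : ℂ} (hc : c ≠ 0) (z : Fin 2 → ℂ) :
    weightedAct p q c (weightedAct p q c⁻¹ z) = z := by
  rw [← weightedAct_mul, mul_inv_cancel₀ hc, weightedAct_one_left]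

theorem weightedAct_ne_zero (p q : ℕ) {c : ℂ} (hc : c ≠ 0) {z : Fin 2 → ℂ} (hz : z ≠ 0) :
    weightedAct p q c z ≠ 0 := by
  intro h
  apply hz
  ext i
  have := congrFun h i
  fin_cases i <;> simpa [hc] using this

/-- If `F` is a rescaling of a circle-equivariant map `G` all of whose singularities on the slice
are folds, then all singularities of `F` off the origin are indefinite folds. -/
theorem isIndefiniteFold_of_forall_slice {F G : (Fin 2 → ℂ) → ℂ} {p q : ℕ} (hq : 0 < q) {k : ℝ}
    (hk : k ≠ 0) {c lam : ℂ} (hc : c ≠ 0) (hlam : lam ≠ 0) (hF : ContDiff ℝ ∞ F)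
    (hG : ContDiff ℝ ∞ G) (hequi : IsCircleEquivariant p q k G)
    (hFG : ∀ z, F (weightedAct p q c z) = lam * G z)
    (hy : ∀ y : ℝ × ℂ, 0 ≤ y.1 → y ≠ 0 → ∀ ζ : ℂ, ‖ζ‖ = 1 →
      (∀ v, ((starRingEnd ℂ) ζ * fderiv ℝ G (slice y) v).re = 0) → IsSliceFold G y)
    {w : Fin 2 → ℂ} (hw : w ≠ 0) (hs : IsSingularity F w) : IsIndefiniteFold F w := by
  obtain ⟨η, y, hy0, -, -, hwy⟩ := exists_slice_representative p hq (weightedAct p q c⁻¹ w)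
  have hw' : w = weightedAct p q (c * Complex.exp (η * Complex.I)) (slice y) := by
    rw [weightedAct_mul, ← hwy, weightedAct_inv_cancel p q hc]
  have hyne : y ≠ 0 := by
    rintro rfl
    apply weightedAct_ne_zero p q (inv_ne_zero hc) hw
    rw [hwy]
    ext i; fin_cases i <;> simp
  rw [hw'] at hs ⊢
  refine isIndefiniteFold_of_scaled hq hk (mul_ne_zero hc (Complex.exp_ne_zero _))
    (lam := lam * Complex.exp ((k * η : ℝ) * Complex.I))
    (mul_ne_zero hlam (Complex.exp_ne_zero _)) hF hG hequi (fun z => ?_) (hy y hy0 hyne) hs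
  rw [weightedAct_mul, hFG, hequi, mul_assoc]

/-! ### Stability under the extra term z₁^m z̄₁ -/

/-- The family `a (f * conj g + t z₁^m * conj z₁) + b h`. -/
noncomputable def perturbedMap (f g h : MvPolynomial (Fin 2) ℂ) (m : ℕ) (a b t : ℝ)
    (z : Fin 2 → ℂ) : ℂ :=
  a * (eval z f * (starRingEnd ℂ) (eval z g) + t * (z 0 ^ m * (starRingEnd ℂ) (z 0))) +
    b * eval z h

theorem contDiff_perturbedMap_comp {E : Type*} [NormedAddCommGroup E] [NormedSpace ℝ E]
    (f g h : MvPolynomial (Fin 2) ℂ) (m : ℕ) {a b t : E → ℝ} {z : E → Fin 2 → ℂ}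
    (ha : ContDiff ℝ ∞ a) (hb : ContDiff ℝ ∞ b) (ht : ContDiff ℝ ∞ t) (hz : ContDiff ℝ ∞ z) :
    ContDiff ℝ ∞ fun x => perturbedMap f g h m (a x) (b x) (t x) (z x) := by
  have hr : ∀ {c : E → ℝ}, ContDiff ℝ ∞ c → ContDiff ℝ ∞ fun x => (c x : ℂ) := fun hc =>
    Complex.ofRealCLM.contDiff.comp hc
  have he := fun p : MvPolynomial (Fin 2) ℂ => (contDiff_eval p).comp hz
  have hz0 : ContDiff ℝ ∞ fun x => z x 0 := contDiff_pi.1 hz 0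
  exact ((hr ha).mul (((he f).mul (contDiff_conj.comp (he g))).add
    ((hr ht).mul ((hz0.pow m).mul (contDiff_conj.comp hz0))))).add ((hr hb).mul (he h))

theorem contDiff_perturbedMap (f g h : MvPolynomial (Fin 2) ℂ) (m : ℕ) (a b t : ℝ) :
    ContDiff ℝ ∞ (perturbedMap f g h m a b t) :=
  contDiff_perturbedMap_comp f g h m contDiff_const contDiff_const contDiff_const contDiff_id

theorem perturbedMap_one_one_zero (f g h : MvPolynomial (Fin 2) ℂ) (m : ℕ) :
    perturbedMap f g h m 1 1 0 = mixedMap f g h := by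
  ext z; simp [perturbedMap, mixedMap]

theorem perturbedMap_zero_one (f g h : MvPolynomial (Fin 2) ℂ) (m : ℕ) (t : ℝ) :
    perturbedMap f g h m 0 1 t = mixedMap 0 0 h := by
  ext z; simp [perturbedMap, mixedMap]

theorem perturbedMap_one_zero_zero (f g h : MvPolynomial (Fin 2) ℂ) (m : ℕ) :
    perturbedMap f g h m 1 0 0 = mixedMap f g 0 := by
  ext z; simp [perturbedMap, mixedMap]

theorem perturbedMap_smul (f g h : MvPolynomial (Fin 2) ℂ) (m : ℕ) (a b t s : ℝ)
    (z : Fin 2 → ℂ) :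
    perturbedMap f g h m (s * a) (s * b) t z = s * perturbedMap f g h m a b t z := by
  simp [perturbedMap]; ring

/-- Both f ḡ and z₁^(d+1) z̄₁ scale by r^(d+2), while h scales by r^d. So dilations act on (a, b)
and leave t fixed. -/
theorem perturbedMap_weightedAct {f g h : MvPolynomial (Fin 2) ℂ} {d : ℕ}
    (hf : IsWeightedHomogeneous ![1, 1] f (d + 1)) (hg : IsWeightedHomogeneous ![1, 1] g 1)
    (hh : IsWeightedHomogeneous ![1, 1] h d) (a b t r : ℝ) (z : Fin 2 → ℂ) :
    perturbedMap f g h (d + 1) a b t (weightedAct 1 1 r z) =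
      perturbedMap f g h (d + 1) (r ^ (d + 2) * a) (r ^ d * b) t z := by
  simp only [perturbedMap, eval_weightedAct hf, eval_weightedAct hg, eval_weightedAct hh,
    weightedAct_zero, map_mul, map_pow, Complex.conj_ofReal]
  push_cast
  ring

theorem isCircleEquivariant_perturbedMap {f g h : MvPolynomial (Fin 2) ℂ} {d : ℕ}
    (hf : IsWeightedHomogeneous ![1, 1] f (d + 1)) (hg : IsWeightedHomogeneous ![1, 1] g 1)
    (hh : IsWeightedHomogeneous ![1, 1] h d) (a b t : ℝ) :
    IsCircleEquivariant 1 1 d (perturbedMap f g h (d + 1) a b t) := by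
  intro η z
  have he : Complex.exp (((d : ℝ) * η : ℝ) * Complex.I) = Complex.exp (η * Complex.I) ^ d := by
    rw [← Complex.exp_nat_mul]; push_cast; ring_nf
  have hu := exp_mul_conj_pow (a := d + 1) (b := 1) (by omega) η
  rw [Nat.add_sub_cancel, pow_one] at hu
  rw [he]
  simp only [perturbedMap, eval_weightedAct hf, eval_weightedAct hg, eval_weightedAct hh,
    weightedAct_zero, map_mul, pow_one, mul_pow]
  linear_combination a * (eval z f * (starRingEnd ℂ) (eval z g) +
    t * (z 0 ^ (d + 1) * (starRingEnd ℂ) (z 0))) * hu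

theorem eventually_re_fderiv_ne_zero {X : Type*} [NormedAddCommGroup X] [NormedSpace ℝ X]
    {Φ : X → (Fin 2 → ℂ) → ℂ} (hΦ : ContDiff ℝ ∞ (Function.uncurry Φ)) {x₀ : X}
    {y : (Fin 2 → ℂ) × ℂ} (h : ∃ v, ((starRingEnd ℂ) y.2 * fderiv ℝ (Φ x₀) y.1 v).re ≠ 0) :
    ∀ᶠ w : X × ((Fin 2 → ℂ) × ℂ) in 𝓝 (x₀, y),
      ∃ v, ((starRingEnd ℂ) w.2.2 * fderiv ℝ (Φ w.1) w.2.1 v).re ≠ 0 := by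
  obtain ⟨v, hv⟩ := h
  have hD : Continuous fun w : X × ((Fin 2 → ℂ) × ℂ) => fderiv ℝ (Φ w.1) w.2.1 := by
    refine (ContDiff.fderiv (m := ∞) (n := ∞) (f := fun w : X × ((Fin 2 → ℂ) × ℂ) => Φ w.1) ?_ ?_
      (by simp)).continuous
    · exact hΦ.comp ((contDiff_fst.comp contDiff_fst).prodMk contDiff_snd)
    · exact (contDiff_fst.comp contDiff_snd)
  have hc : Continuous fun w : X × ((Fin 2 → ℂ) × ℂ) =>
      ((starRingEnd ℂ) w.2.2 * fderiv ℝ (Φ w.1) w.2.1 v).re :=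
    Complex.continuous_re.comp ((Complex.continuous_conj.comp
      (continuous_snd.comp continuous_snd)).mul (hD.clm_apply continuous_const))
  have := hc.continuousAt.eventually_ne (x := (x₀, y)) hv
  filter_upwards [this] with w hw using ⟨v, hw⟩

/-- Nonsingularity is stable over compact sets of points and directions. -/
theorem eventually_forall_not_singular {X : Type*} [NormedAddCommGroup X] [NormedSpace ℝ X]
    {Φ : X → (Fin 2 → ℂ) → ℂ} (hΦ : ContDiff ℝ ∞ (Function.uncurry Φ)) {x₀ : X}
    {K : Set ((Fin 2 → ℂ) × ℂ)} (hK : IsCompact K)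
    (h : ∀ y ∈ K, ∃ v, ((starRingEnd ℂ) y.2 * fderiv ℝ (Φ x₀) y.1 v).re ≠ 0) :
    ∀ᶠ x in 𝓝 x₀, ∀ y ∈ K, ∃ v, ((starRingEnd ℂ) y.2 * fderiv ℝ (Φ x) y.1 v).re ≠ 0 :=
  hK.eventually_forall_of_forall_eventually fun y hy => eventually_re_fderiv_ne_zero hΦ (h y hy)

/-- The fold condition on the slice is open. -/
theorem eventually_isSliceFold {Φ : ℝ → (Fin 2 → ℂ) → ℂ}
    (hΦ : ContDiff ℝ ∞ (Function.uncurry Φ)) {t₀ : ℝ} {y₀ : ℝ × ℂ}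
    (h : IsSliceFold (Φ t₀) y₀) :
    ∀ᶠ w : ℝ × (ℝ × ℂ) in 𝓝 (t₀, y₀), IsSliceFold (Φ w.1) w.2 := by
  obtain ⟨h1, h2, h3, ⟨u, hu⟩, v, hv⟩ := h
  have hM : ContDiff ℝ ∞ fun w : ℝ × (ℝ × ℂ) => sliceNormSq (Φ w.1) w.2 :=
    contDiff_normSq.comp (hΦ.comp (contDiff_fst.prodMk (slice.contDiff.comp contDiff_snd)))
  have hD1 : ContDiff ℝ ∞ fun w : ℝ × (ℝ × ℂ) => fderiv ℝ (sliceNormSq (Φ w.1)) w.2 := by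
    refine ContDiff.fderiv (m := ∞) (n := ∞) (f := fun w : ℝ × (ℝ × ℂ) => sliceNormSq (Φ w.1)) ?_
      contDiff_snd (by simp)
    exact hM.comp ((contDiff_fst.comp contDiff_fst).prodMk contDiff_snd)
  have hD2 : Continuous fun w : ℝ × (ℝ × ℂ) =>
      fderiv ℝ (fderiv ℝ (sliceNormSq (Φ w.1))) w.2 := by
    refine (ContDiff.fderiv (m := ∞) (n := ∞)
      (f := fun w : ℝ × (ℝ × ℂ) => fderiv ℝ (sliceNormSq (Φ w.1))) ?_
      contDiff_snd (by simp)).continuous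
    exact hD1.comp ((contDiff_fst.comp contDiff_fst).prodMk contDiff_snd)
  have hdim : Module.finrank ℝ (ℝ × ℂ) = Module.finrank ℝ (ℝ × ℂ →L[ℝ] ℝ) := by
    rw [← (LinearMap.toContinuousLinearMap :
      (ℝ × ℂ →ₗ[ℝ] ℝ) ≃ₗ[ℝ] (ℝ × ℂ →L[ℝ] ℝ)).finrank_eq]
    exact (Subspace.dual_finrank_eq (K := ℝ) (V := ℝ × ℂ)).symm
  -- In equal finite dimensions injectivity is invertibility, which is an open condition.
  have hinv : fderiv ℝ (fderiv ℝ (sliceNormSq (Φ t₀))) y₀ ∈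
      Set.range ((↑) : ((ℝ × ℂ) ≃L[ℝ] (ℝ × ℂ →L[ℝ] ℝ)) → (ℝ × ℂ) →L[ℝ] (ℝ × ℂ →L[ℝ] ℝ)) :=
    ⟨(LinearMap.linearEquivOfInjective (fderiv ℝ (fderiv ℝ (sliceNormSq (Φ t₀))) y₀).toLinearMap
      h3 hdim).toContinuousLinearEquiv, by ext <;> rfl⟩
  have e1 : ∀ᶠ w : ℝ × (ℝ × ℂ) in 𝓝 (t₀, y₀), 0 < w.2.1 :=
    (continuous_fst.comp continuous_snd).continuousAt.eventually (lt_mem_nhds h1)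
  have e2 : ∀ᶠ w : ℝ × (ℝ × ℂ) in 𝓝 (t₀, y₀), Φ w.1 (slice w.2) ≠ 0 :=
    (hΦ.continuous.comp (continuous_fst.prodMk
      (slice.continuous.comp continuous_snd))).continuousAt.eventually_ne h2
  have e3 := (hD2.continuousAt (x := (t₀, y₀))).eventually
    (ContinuousLinearEquiv.isOpen.mem_nhds hinv)
  have e4 := (((hD2.clm_apply continuous_const).clm_apply
    continuous_const).continuousAt (x := (t₀, y₀))).eventually (lt_mem_nhds hu)
  have e5 := (((hD2.clm_apply continuous_const).clm_apply
    continuous_const).continuousAt (x := (t₀, y₀))).eventually (gt_mem_nhds hv)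
  filter_upwards [e1, e2, e3, e4, e5] with w w1 w2 w3 w4 w5
  obtain ⟨L, hL⟩ := w3
  refine ⟨w1, w2, ?_, ⟨u, w4⟩, v, w5⟩
  rw [← hL]
  exact L.injective

/-- Over a compact set of slice points and directions, the property that every singularity is a
fold is stable. -/
theorem eventually_forall_isSliceFold {Φ : ℝ → (Fin 2 → ℂ) → ℂ}
    (hΦ : ContDiff ℝ ∞ (Function.uncurry Φ)) {t₀ : ℝ} {K : Set ((ℝ × ℂ) × ℂ)} (hK : IsCompact K)
    (h : ∀ w ∈ K, (∀ v, ((starRingEnd ℂ) w.2 * fderiv ℝ (Φ t₀) (slice w.1) v).re = 0) →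
      IsSliceFold (Φ t₀) w.1) :
    ∀ᶠ t in 𝓝 t₀, ∀ w ∈ K,
      (∀ v, ((starRingEnd ℂ) w.2 * fderiv ℝ (Φ t) (slice w.1) v).re = 0) →
        IsSliceFold (Φ t) w.1 := by
  refine hK.eventually_forall_of_forall_eventually ?_
  rintro ⟨y, ζ⟩ hw
  -- Being nonsingular in a direction and being a slice fold are both open conditions; at t₀ one of
  -- them holds.
  by_cases hs : ∃ v, ((starRingEnd ℂ) ζ * fderiv ℝ (Φ t₀) (slice y) v).re ≠ 0
  · have hc : Continuous fun w : ℝ × ((ℝ × ℂ) × ℂ) => (w.1, (slice w.2.1, w.2.2)) := by fun_prop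
    have := (hc.tendsto (t₀, (y, ζ))).eventually
      (eventually_re_fderiv_ne_zero hΦ (y := (slice y, ζ)) hs)
    filter_upwards [this] with w hw hw'
    obtain ⟨v, hv⟩ := hw
    exact absurd (hw' v) hv
  · push Not at hs
    have hc : Continuous fun w : ℝ × ((ℝ × ℂ) × ℂ) => (w.1, w.2.1) := by fun_prop
    have := (hc.tendsto (t₀, (y, ζ))).eventually (eventually_isSliceFold hΦ (h _ hw hs))
    filter_upwards [this] with w hw _ using hw

/-- For f = g = 0 the singular equations say that both partial derivatives of h vanish, which is
impossible off the origin. -/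
theorem exists_re_ne_zero_deformationPoly {k₁ k₂ : ℕ} (h₁ : k₁ ≠ 0) (h₂ : k₂ ≠ 0) {γ₁ γ₂ : ℂ}
    (hγ₁ : γ₁ ≠ 0) (hγ₂ : γ₂ ≠ 0) {z : Fin 2 → ℂ} (hz : z ≠ 0) {ζ : ℂ} (hζ : ‖ζ‖ = 1) :
    ∃ v, ((starRingEnd ℂ) ζ *
      fderiv ℝ (mixedMap 0 0 (deformationPoly k₁ k₂ γ₁ γ₂)) z v).re ≠ 0 := by
  by_contra! h
  obtain ⟨c0, c1⟩ := (singularCoeff_eq_zero_iff _ _ _ _ hζ).1 h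
  simp only [singularCoeff, eval_pderiv_zero_deformationPoly, eval_pderiv_one_deformationPoly,
    map_zero, mul_zero, zero_add, add_zero] at c0 c1
  apply hz
  ext i
  fin_cases i
  · by_contra hi
    exact mul_ne_zero (mul_ne_zero (by exact_mod_cast h₁) (pow_ne_zero _ hi)) hγ₁ c0
  · by_contra hi
    exact mul_ne_zero (mul_ne_zero (by exact_mod_cast h₂) (pow_ne_zero _ hi)) hγ₂ c1

/-- A homogeneous map with an isolated singularity at the origin has no other singularities. -/
theorem not_isSingularity_of_homogeneous {F : (Fin 2 → ℂ) → ℂ} (hF : Differentiable ℝ F) {D : ℕ}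
    (hhom : ∀ (r : ℝ) z, F (weightedAct 1 1 r z) = r ^ D * F z)
    (hiso : ∀ᶠ z in 𝓝[≠] 0, ¬ IsSingularity F z) {z : Fin 2 → ℂ} (hz : z ≠ 0) :
    ¬ IsSingularity F z := by
  intro hs
  have hc : Continuous fun r : ℝ => weightedAct 1 1 (r : ℂ) z := by
    refine continuous_pi fun i => ?_
    fin_cases i
    all_goals
      simp only [weightedAct, pow_one]
      exact Complex.continuous_ofReal.fun_mul continuous_const
  have h0 : weightedAct 1 1 ((0 : ℝ) : ℂ) z = 0 := by ext i; fin_cases i <;> simp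
  -- Small dilations carry z into the punctured neighbourhood without singularities, and homogeneity
  -- makes singularity invariant under dilation.
  have ht : Filter.Tendsto (fun r : ℝ => weightedAct 1 1 (r : ℂ) z) (𝓝[>] 0) (𝓝[≠] 0) := by
    refine tendsto_nhdsWithin_iff.2 ⟨?_, ?_⟩
    · have := hc.tendsto 0
      rw [h0] at this
      exact this.mono_left nhdsWithin_le_nhds
    · filter_upwards [self_mem_nhdsWithin] with r hr
      exact weightedAct_ne_zero 1 1 (by exact_mod_cast (ne_of_gt hr)) hz
  obtain ⟨r, hr, hr0⟩ := ((ht.eventually hiso).and self_mem_nhdsWithin).exists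
  have hr0' : ((r⁻¹ : ℝ) : ℂ) ≠ 0 := by
    exact_mod_cast inv_ne_zero (ne_of_gt hr0)
  apply hr
  refine (isSingularity_iff (hF _)).2 (exists_singular_direction_of_scaled
    (lam := ((r⁻¹ : ℝ) : ℂ) ^ D) (pow_ne_zero _ hr0') hF hF (fun z => hhom r⁻¹ z) ?_)
  rw [← weightedAct_mul, ← Complex.ofReal_mul, inv_mul_cancel₀ (ne_of_gt hr0),
    Complex.ofReal_one, weightedAct_one_left]
  exact hs

theorem norm_slice (y : ℝ × ℂ) : ‖slice y‖ = ‖y‖ := by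
  rw [Prod.norm_def]
  apply le_antisymm
  · refine (pi_norm_le_iff_of_nonneg (by positivity)).2 fun i => ?_
    fin_cases i <;> simp
  · refine max_le ?_ ?_
    · simpa using norm_le_pi_norm (slice y) 0
    · simpa using norm_le_pi_norm (slice y) 1

/-- For small `t`, the singularities of the perturbed map lie in a fixed annulus. -/
theorem exists_annulus {f g : MvPolynomial (Fin 2) ℂ} {d : ℕ} (hd : d ≠ 0)
    (hf : IsWeightedHomogeneous ![1, 1] f (d + 1)) (hg : IsWeightedHomogeneous ![1, 1] g 1)
    (hiso : ∀ᶠ z in 𝓝[≠] 0, ¬ IsSingularity (mixedMap f g 0) z) {γ₁ γ₂ : ℂ} (hγ₁ : γ₁ ≠ 0)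
    (hγ₂ : γ₂ ≠ 0) :
    ∃ δ > 0, ∀ t : ℝ, |t| < δ → ∀ z : Fin 2 → ℂ, z ≠ 0 → ∀ ζ : ℂ, ‖ζ‖ = 1 →
      (∀ v, ((starRingEnd ℂ) ζ * fderiv ℝ
        (perturbedMap f g (deformationPoly d d γ₁ γ₂) (d + 1) 1 1 t) z v).re = 0) →
      δ ≤ ‖z‖ ^ 2 ∧ ‖z‖ ^ 2 ≤ δ⁻¹ := by
  set h := deformationPoly d d γ₁ γ₂ with hh
  have hhom : IsWeightedHomogeneous ![1, 1] h d :=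
    isWeightedHomogeneous_deformationPoly (by ring) (by ring) γ₁ γ₂
  -- This compactifies the radius: a = 0 is the limit of small radius, where only h remains; a = 1
  -- is the limit of large radius, where for t = 0 only f ḡ remains.
  let Φ : ℝ × ℝ → (Fin 2 → ℂ) → ℂ := fun x => perturbedMap f g h (d + 1) x.1 (1 - x.1) x.2
  have hΦ : ContDiff ℝ ∞ (Function.uncurry Φ) :=
    contDiff_perturbedMap_comp f g h (d + 1) (contDiff_fst.comp contDiff_fst)
      (contDiff_const.sub (contDiff_fst.comp contDiff_fst)) (contDiff_snd.comp contDiff_fst)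
      contDiff_snd
  let K : Set ((Fin 2 → ℂ) × ℂ) := Metric.sphere 0 1 ×ˢ Metric.sphere 0 1
  have hK : IsCompact K := (isCompact_sphere _ _).prod (isCompact_sphere _ _)
  have hne : ∀ y ∈ K, y.1 ≠ 0 ∧ ‖y.2‖ = 1 := by
    rintro ⟨z, ζ⟩ ⟨h1, h2⟩
    rw [mem_sphere_zero_iff_norm] at h1 h2
    refine ⟨fun h0 => ?_, h2⟩
    rw [h0, norm_zero] at h1
    exact zero_ne_one h1
  have e0 := eventually_forall_not_singular hΦ (x₀ := (0, 0)) hK (by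
    intro y hy
    obtain ⟨h1, h2⟩ := hne y hy
    simp only [Φ, sub_zero, perturbedMap_zero_one]
    exact exists_re_ne_zero_deformationPoly hd hd hγ₁ hγ₂ h1 h2)
  have e1 := eventually_forall_not_singular hΦ (x₀ := (1, 0)) hK (by
    intro y hy
    obtain ⟨h1, h2⟩ := hne y hy
    simp only [Φ, sub_self, perturbedMap_one_zero_zero]
    by_contra! h3
    have hdiff := (contDiff_mixedMap f g 0).differentiable (by simp)
    refine not_isSingularity_of_homogeneous hdiff (D := d + 2) (fun r z => ?_) hiso h1
      ((isSingularity_iff (hdiff _)).2 ⟨y.2, h2, h3⟩)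
    simp only [mixedMap, eval_weightedAct hf, eval_weightedAct hg, map_mul, map_pow,
      Complex.conj_ofReal, map_zero]
    ring)
  obtain ⟨ε₀, hε₀, H0⟩ := Metric.eventually_nhds_iff.1 e0
  obtain ⟨ε₁, hε₁, H1⟩ := Metric.eventually_nhds_iff.1 e1
  refine ⟨min ε₀ ε₁, lt_min hε₀ hε₁, fun t ht z hz ζ hζ hs => ?_⟩
  set δ := min ε₀ ε₁ with hδ
  have hδ0 : 0 < δ := lt_min hε₀ hε₁
  set r := ‖z‖ with hr
  have hr0 : 0 < r := norm_pos_iff.2 hz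
  have hrc : (r : ℂ) ≠ 0 := by exact_mod_cast hr0.ne'
  -- On the sphere of radius r the two parts have weights r^(d+2) and r^d; division by their sum
  -- gives a and 1 - a.
  set a := r ^ 2 / (1 + r ^ 2) with ha
  have h1r : (0 : ℝ) < 1 + r ^ 2 := by positivity
  set u := weightedAct 1 1 (r : ℂ)⁻¹ z with hu
  have hzu : weightedAct 1 1 (r : ℂ) u = z := weightedAct_inv_cancel 1 1 hrc z
  have hun : ‖u‖ = 1 := by
    have : u = (r⁻¹ : ℝ) • z := by ext i; fin_cases i <;> simp [hu]
    rw [this, norm_smul, norm_inv, Real.norm_of_nonneg hr0.le, inv_mul_cancel₀ hr0.ne']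
  have hscale : ∀ w, perturbedMap f g h (d + 1) 1 1 t (weightedAct 1 1 (r : ℂ) w) =
      ((r ^ d * (1 + r ^ 2) : ℝ) : ℂ) * Φ (a, t) w := by
    intro w
    rw [perturbedMap_weightedAct hf hg hhom]
    simp only [Φ]
    rw [← perturbedMap_smul]
    congr 1
    · rw [ha]; field_simp; ring
    · rw [ha]; field_simp; ring
  have hsing : IsSingularity (perturbedMap f g h (d + 1) 1 1 t) (weightedAct 1 1 (r : ℂ) u) := by
    rw [hzu]
    exact (isSingularity_iff ((contDiff_perturbedMap f g h (d + 1) 1 1 t).differentiable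
      (by simp) _)).2 ⟨ζ, hζ, hs⟩
  obtain ⟨ζ', hζ', hs'⟩ := exists_singular_direction_of_scaled
    (by exact_mod_cast (mul_pos (pow_pos hr0 d) h1r).ne')
    ((contDiff_perturbedMap f g h (d + 1) 1 1 t).differentiable (by simp))
    ((contDiff_perturbedMap f g h (d + 1) a (1 - a) t).differentiable (by simp)) hscale hsing
  have hmem : (u, ζ') ∈ K := ⟨by simpa using hun, by simpa using hζ'⟩
  have ha0 : 0 ≤ a := by positivity
  have ha1 : 1 - a = 1 / (1 + r ^ 2) := by rw [ha]; field_simp; ring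
  -- If a < δ, then (a, t) is so close to (0, 0) that the unit sphere carries no singularity; the
  -- next bound is the same near (1, 0).
  have hage : δ ≤ a := by
    by_contra! hlt
    obtain ⟨v, hv⟩ := H0 (y := (a, t)) (by
      rw [Prod.dist_eq, max_lt_iff]
      simp only [Real.dist_eq, sub_zero, abs_of_nonneg ha0]
      exact ⟨hlt.trans_le (min_le_left _ _), ht.trans_le (min_le_left _ _)⟩) _ hmem
    exact hv (hs' v)
  have hale : δ ≤ 1 - a := by
    by_contra! hlt
    obtain ⟨v, hv⟩ := H1 (y := (a, t)) (by
      rw [Prod.dist_eq, max_lt_iff]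
      simp only [Real.dist_eq, sub_zero]
      have h0 : 0 ≤ 1 - a := by rw [ha1]; positivity
      rw [abs_sub_comm, abs_of_nonneg h0]
      exact ⟨hlt.trans_le (min_le_right _ _), ht.trans_le (min_le_right _ _)⟩) _ hmem
    exact hv (hs' v)
  constructor
  · rw [ha, le_div_iff₀ h1r] at hage
    nlinarith [sq_nonneg r]
  · rw [ha1, le_div_iff₀ h1r] at hale
    rw [le_inv_comm₀ (by positivity) hδ0, ← one_div, le_div_iff₀ (by positivity)]
    nlinarith [sq_nonneg r]

/-- The fold condition survives the small perturbation by `t z₁^m * conj z₁`. -/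
theorem exists_perturbation_bound {f g : MvPolynomial (Fin 2) ℂ} {d : ℕ} (hd : d ≠ 0)
    (hf : IsWeightedHomogeneous ![1, 1] f (d + 1)) (hg : IsWeightedHomogeneous ![1, 1] g 1)
    (hiso : ∀ᶠ z in 𝓝[≠] 0, ¬ IsSingularity (mixedMap f g 0) z) {γ₁ γ₂ : ℂ} (hγ₁ : γ₁ ≠ 0)
    (hγ₂ : γ₂ ≠ 0)
    (hgen : ∀ y : ℝ × ℂ, 0 ≤ y.1 → y ≠ 0 → ∀ ζ : ℂ, ‖ζ‖ = 1 →
      (∀ v, ((starRingEnd ℂ) ζ * fderiv ℝ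
        (mixedMap f g (deformationPoly d d γ₁ γ₂)) (slice y) v).re = 0) →
      IsSliceFold (mixedMap f g (deformationPoly d d γ₁ γ₂)) y) :
    ∃ t₀ > 0, ∀ t : ℝ, 0 < t → t < t₀ → ∀ y : ℝ × ℂ, 0 ≤ y.1 → y ≠ 0 → ∀ ζ : ℂ, ‖ζ‖ = 1 →
      (∀ v, ((starRingEnd ℂ) ζ * fderiv ℝ
        (perturbedMap f g (deformationPoly d d γ₁ γ₂) (d + 1) 1 1 t) (slice y) v).re = 0) →
      IsSliceFold (perturbedMap f g (deformationPoly d d γ₁ γ₂) (d + 1) 1 1 t) y := by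
  obtain ⟨δ, hδ, hann⟩ := exists_annulus hd hf hg hiso hγ₁ hγ₂
  set h := deformationPoly d d γ₁ γ₂ with hh
  let Φ : ℝ → (Fin 2 → ℂ) → ℂ := fun t => perturbedMap f g h (d + 1) 1 1 t
  have hΦ : ContDiff ℝ ∞ (Function.uncurry Φ) :=
    contDiff_perturbedMap_comp f g h (d + 1) contDiff_const contDiff_const contDiff_fst
      contDiff_snd
  have hΦ0 : Φ 0 = mixedMap f g h := perturbedMap_one_one_zero f g h (d + 1)
  let A : Set (ℝ × ℂ) := {y | 0 ≤ y.1 ∧ δ ≤ ‖y‖ ^ 2 ∧ ‖y‖ ^ 2 ≤ δ⁻¹}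
  have hA : IsCompact A := by
    refine Metric.isCompact_of_isClosed_isBounded ?_ ?_
    · exact (isClosed_le continuous_const continuous_fst).inter
        ((isClosed_le continuous_const (continuous_norm.pow 2)).inter
          (isClosed_le (continuous_norm.pow 2) continuous_const))
    · refine (Metric.isBounded_closedBall (x := (0 : ℝ × ℂ)) (r := √(δ⁻¹))).subset fun y hy => ?_
      rw [mem_closedBall_zero_iff]
      exact Real.le_sqrt_of_sq_le hy.2.2
  have hK : IsCompact (A ×ˢ Metric.sphere (0 : ℂ) 1) := hA.prod (isCompact_sphere _ _)
  have hev := eventually_forall_isSliceFold hΦ (t₀ := 0) hK (by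
    rintro ⟨y, ζ⟩ ⟨⟨hy0, hy1, -⟩, hζ⟩ hs
    rw [mem_sphere_zero_iff_norm] at hζ
    rw [hΦ0] at hs ⊢
    refine hgen y hy0 ?_ ζ hζ hs
    intro h0
    replace hy1 : δ ≤ ‖y‖ ^ 2 := hy1
    rw [h0, norm_zero] at hy1
    linarith)
  obtain ⟨ε, hε, H⟩ := Metric.eventually_nhds_iff.1 hev
  refine ⟨min ε δ, lt_min hε hδ, fun t ht0 ht y hy0 hyne ζ hζ hs => ?_⟩
  have htabs : |t| < min ε δ := by rwa [abs_of_pos ht0]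
  have hsne : slice y ≠ 0 := by
    rw [← norm_ne_zero_iff, norm_slice]
    exact norm_ne_zero_iff.2 hyne
  have hnorm := hann t (htabs.trans_le (min_le_right _ _)) (slice y) hsne ζ hζ hs
  rw [norm_slice] at hnorm
  exact H (y := t) (by simpa [Real.dist_eq] using htabs.trans_le (min_le_left _ _)) (y, ζ)
    ⟨⟨hy0, hnorm⟩, by simpa using hζ⟩ hs

/-! ### Conjugation, mixed polynomials and the conclusion -/

theorem isSingularity_conj_iff {F : (Fin 2 → ℂ) → ℂ} {w : Fin 2 → ℂ}
    (hF : DifferentiableAt ℝ F w) :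
    IsSingularity (fun z => (starRingEnd ℂ) (F z)) w ↔ IsSingularity F w := by
  have hF' : HasFDerivAt (fun z => (starRingEnd ℂ) (F z))
      ((Complex.conjCLE : ℂ →L[ℝ] ℂ).comp (fderiv ℝ F w)) w :=
    (Complex.conjCLE : ℂ →L[ℝ] ℂ).hasFDerivAt.comp w hF.hasFDerivAt
  rw [isSingularity_iff hF, isSingularity_iff hF'.differentiableAt, hF'.fderiv]
  constructor
  · rintro ⟨ζ, hζ, h⟩
    refine ⟨(starRingEnd ℂ) ζ, by simpa using hζ, fun v => ?_⟩
    rw [← h v, ← Complex.conj_re]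
    simp
  · rintro ⟨ζ, hζ, h⟩
    refine ⟨(starRingEnd ℂ) ζ, by simpa using hζ, fun v => ?_⟩
    rw [← h v, ← Complex.conj_re]
    simp

/-- Conjugation is absorbed into the target chart. -/
theorem IsIndefiniteFold.of_conj {F : (Fin 2 → ℂ) → ℂ} {w : Fin 2 → ℂ}
    (h : IsIndefiniteFold (fun z => (starRingEnd ℂ) (F z)) w) : IsIndefiniteFold F w := by
  obtain ⟨φ, ψ, ε, h1, h2, h3, h4, h5, h6, h7, h8, h9, h10, h11, h12, h13⟩ := h
  have hsrc : (Complex.conjCLE.toHomeomorph.toOpenPartialHomeomorph.trans ψ).source =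
      Complex.conjCLE ⁻¹' ψ.source := by
    ext; simp
  have htgt : (Complex.conjCLE.toHomeomorph.toOpenPartialHomeomorph.trans ψ).target =
      ψ.target := by
    ext; simp
  refine ⟨φ, Complex.conjCLE.toHomeomorph.toOpenPartialHomeomorph.trans ψ, ε, h1, h2, ?_, h4, h5,
    h6, ?_, ?_, ?_, h10, h11, h12, h13⟩
  · rw [hsrc]; exact h3
  · rw [hsrc]
    exact h7.comp Complex.conjCLE.contDiff.contDiffOn fun x hx => hx
  · rw [htgt]
    exact Complex.conjCLE.symm.contDiff.comp_contDiffOn h8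
  · rw [hsrc]
    exact fun z hz => h9 hz

namespace MixedPoly

theorem toFun_add (P Q : MixedPoly) (w : Fin 2 → ℂ) : toFun (P + Q) w = toFun P w + toFun Q w :=
  map_add _ _ _

theorem toFun_mul (P Q : MixedPoly) (w : Fin 2 → ℂ) : toFun (P * Q) w = toFun P w * toFun Q w :=
  map_mul _ _ _

theorem toFun_pow (P : MixedPoly) (n : ℕ) (w : Fin 2 → ℂ) : toFun (P ^ n) w = toFun P w ^ n :=
  map_pow _ _ _

theorem toFun_const (c : ℂ) (w : Fin 2 → ℂ) : toFun (const c) w = c := eval_C c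

theorem toFun_z (j : Fin 2) (w : Fin 2 → ℂ) : toFun (z j) w = w j := by
  simp [toFun, z]

theorem toFun_zbar (j : Fin 2) (w : Fin 2 → ℂ) :
    toFun (zbar j) w = (starRingEnd ℂ) (w j) := by
  simp [toFun, zbar]

theorem contDiff_toFun (P : MixedPoly) : ContDiff ℝ ∞ (toFun P) := by
  induction P using MvPolynomial.induction_on with
  | C a =>
    rw [show toFun (C a) = fun _ => a from funext fun w => toFun_const a w]
    exact contDiff_const
  | add P Q hP hQ =>
    rw [show toFun (P + Q) = fun w => toFun P w + toFun Q w from funext fun w => toFun_add P Q w]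
    exact hP.add hQ
  | mul_X P i hP =>
    rcases i with j | j
    · rw [show toFun (P * X (Sum.inl j)) = fun w => toFun P w * w j from
        funext fun w => by rw [toFun_mul]; exact congrArg _ (toFun_z j w)]
      exact hP.mul (contDiff_apply ℝ ℂ j)
    · rw [show toFun (P * X (Sum.inr j)) = fun w => toFun P w * (starRingEnd ℂ) (w j) from
        funext fun w => by rw [toFun_mul]; exact congrArg _ (toFun_zbar j w)]
      exact hP.mul (contDiff_conj.comp (contDiff_apply ℝ ℂ j))

end MixedPoly

theorem toFun_mul_conj (f g : MvPolynomial (Fin 2) ℂ) :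
    MixedPoly.toFun (MixedPoly.ofComplex f * MixedPoly.conj (MixedPoly.ofComplex g)) =
      mixedMap f g 0 := by
  ext w
  simp [MixedPoly.toFun_mul, MixedPoly.toFun_conj, MixedPoly.toFun_ofComplex, mixedMap]

/-- A convenient weighted homogeneous linear form is homogeneous of degree one. -/
theorem weights_of_isLinearForm {p q n : ℕ} {g : MvPolynomial (Fin 2) ℂ}
    (hg : IsWeightedHomogeneous ![q, p] g (p * q * n)) (hgc : IsConvenient g)
    (hlin : IsLinearForm g) (hp : 0 < p) (hq : 0 < q) : p = 1 ∧ q = 1 ∧ n = 1 := by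
  obtain ⟨β₁, β₂, rfl⟩ := hlin
  obtain ⟨c, hc⟩ := hgc 0
  obtain ⟨c', hc'⟩ := hgc 1
  have hβ₁ : β₁ ≠ 0 := by rintro rfl; simp at hc
  have hβ₂ : β₂ ≠ 0 := by rintro rfl; simp at hc'
  have h1 : coeff (Finsupp.single 0 1)
      (C β₁ * X 0 + C β₂ * X 1 : MvPolynomial (Fin 2) ℂ) ≠ 0 := by
    simpa [coeff_C_mul, coeff_X, Finsupp.single_left_inj] using hβ₁
  have h2 : coeff (Finsupp.single 1 1)
      (C β₁ * X 0 + C β₂ * X 1 : MvPolynomial (Fin 2) ℂ) ≠ 0 := by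
    simpa [coeff_C_mul, coeff_X, Finsupp.single_left_inj] using hβ₂
  -- Both monomials occur, so their weights q and p both equal pqn.
  have e1 := hg h1
  have e2 := hg h2
  simp [Finsupp.weight_single] at e1 e2
  have f1 : p * n = 1 := by
    apply Nat.eq_of_mul_eq_mul_left hq
    linarith
  have f2 : q * n = 1 := by
    apply Nat.eq_of_mul_eq_mul_left hp
    linarith
  exact ⟨Nat.eq_one_of_mul_eq_one_right f1, Nat.eq_one_of_mul_eq_one_right f2,
    Nat.eq_one_of_mul_eq_one_left f1⟩

/-- For r^(2pqn) = t one has t r^(pq(m-n)) = r^(pq(m+n)). So under dilation by r both terms of F_t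
acquire the same factor, and the result holds globally for every t > 0. -/
theorem exists_deformation_of_not_isLinearForm {p q m n : ℕ} (hp : 0 < p) (hq : 0 < q)
    (hn : 0 < n) (hnm : n < m) {f g : MvPolynomial (Fin 2) ℂ}
    (hf : IsWeightedHomogeneous ![q, p] f (p * q * m))
    (hg : IsWeightedHomogeneous ![q, p] g (p * q * n)) (hfc : IsConvenient f)
    (hgc : IsConvenient g) (hlin : ¬ IsLinearForm g) :
    ∃ h : MixedPoly, IsDeformationTerm p q m n g h ∧ DeformsToIndefiniteFolds
      (MixedPoly.ofComplex f * MixedPoly.conj (MixedPoly.ofComplex g)) h := by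
  obtain ⟨γ₁, γ₂, hγ₁, hγ₂, hgen⟩ := exists_generic_deformation hp hq hn hnm hf hg hfc hgc
  refine ⟨_, ⟨γ₁, γ₂, hγ₁, hγ₂, fun _ => rfl, fun h => absurd h hlin⟩, Set.univ, Filter.univ_mem,
    1, one_pos, fun t ht _ w _ hw hs => ?_⟩
  have hd : 0 < m - n := Nat.sub_pos_of_lt hnm
  have hsub : p * q * m - p * q * n = p * q * (m - n) := (Nat.mul_sub ..).symm
  have hle : p * q * n ≤ p * q * m := Nat.mul_le_mul_left _ hnm.le
  have hh : IsWeightedHomogeneous ![q, p]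
      (deformationPoly (p * (m - n)) (q * (m - n)) γ₁ γ₂) (p * q * m - p * q * n) := by
    rw [hsub]
    exact isWeightedHomogeneous_deformationPoly (by ring) (by ring) γ₁ γ₂
  have hk : (((p * q * m - p * q * n : ℕ) : ℝ)) ≠ 0 := by
    rw [hsub]
    exact_mod_cast (Nat.mul_pos (Nat.mul_pos hp hq) hd).ne'
  have hN : 2 * (p * q * n) ≠ 0 := by positivity
  obtain ⟨r, hr0, hr⟩ : ∃ r : ℝ, 0 < r ∧ r ^ (2 * (p * q * n)) = t :=
    ⟨t ^ ((2 * (p * q * n) : ℕ) : ℝ)⁻¹, Real.rpow_pos_of_pos ht _,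
      Real.rpow_inv_natCast_pow ht.le hN⟩
  have hrc : (r : ℂ) ≠ 0 := by exact_mod_cast hr0.ne'
  refine isIndefiniteFold_of_forall_slice hq hk hrc
    (lam := (r : ℂ) ^ (p * q * m + p * q * n)) (pow_ne_zero _ hrc)
    (MixedPoly.contDiff_toFun _) (contDiff_mixedMap f g _)
    (isCircleEquivariant_mixedMap hle hf hg hh) (fun z => ?_) hgen hw hs
  have e := eval_weightedAct hh (r : ℂ) z
  simp only [eval_deformationPoly] at e
  have hrt : (t : ℂ) * (r : ℂ) ^ (p * q * m - p * q * n) =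
      (r : ℂ) ^ (p * q * m + p * q * n) := by
    rw [← hr]
    push_cast
    rw [← pow_add]
    congr 1
    omega
  simp only [MixedPoly.toFun_add, MixedPoly.toFun_mul, MixedPoly.toFun_conj,
    MixedPoly.toFun_ofComplex, MixedPoly.toFun_const, MixedPoly.toFun_pow, MixedPoly.toFun_z, e,
    mixedMap, eval_deformationPoly, eval_weightedAct hf, eval_weightedAct hg, map_mul, map_pow,
    Complex.conj_ofReal, mul_add (r ^ (p * q * m + p * q * n) : ℂ)]
  rw [← mul_assoc (t : ℂ), hrt, pow_add]
  ring

/-- Dilation by √t balances f ḡ with the holomorphic part of t h but leaves the factor t on z₁^m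
z̄₁. The rescaled map is thus a small perturbation of the generic G. -/
theorem exists_deformation_of_isLinearForm {p q m n : ℕ} (hp : 0 < p) (hq : 0 < q)
    (hn : 0 < n) (hnm : n < m) {f g : MvPolynomial (Fin 2) ℂ}
    (hf : IsWeightedHomogeneous ![q, p] f (p * q * m))
    (hg : IsWeightedHomogeneous ![q, p] g (p * q * n)) (hfc : IsConvenient f)
    (hgc : IsConvenient g) (hiso : ∀ᶠ z in 𝓝[≠] 0, ¬ IsSingularity (mixedMap f g 0) z)
    (hlin : IsLinearForm g) :
    ∃ h : MixedPoly, IsDeformationTerm p q m n g h ∧ DeformsToIndefiniteFolds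
      (MixedPoly.ofComplex f * MixedPoly.conj (MixedPoly.ofComplex g)) h := by
  obtain ⟨γ₁, γ₂, hγ₁, hγ₂, hgen⟩ := exists_generic_deformation hp hq hn hnm hf hg hfc hgc
  obtain ⟨rfl, rfl, rfl⟩ := weights_of_isLinearForm hg hgc hlin hp hq
  obtain ⟨d, rfl⟩ : ∃ d, m = d + 1 := ⟨m - 1, by omega⟩
  have hd : d ≠ 0 := by omega
  simp only [one_mul, Nat.add_sub_cancel] at hf hg hgen
  obtain ⟨t₀, ht₀, H⟩ := exists_perturbation_bound hd hf hg hiso hγ₁ hγ₂ hgen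
  refine ⟨_, ⟨γ₁, γ₂, hγ₁, hγ₂, fun h => absurd hlin h, fun _ => rfl⟩, Set.univ, Filter.univ_mem,
    t₀, ht₀, fun t ht htt w _ hw hs => ?_⟩
  have hh : IsWeightedHomogeneous ![1, 1] (deformationPoly d d γ₁ γ₂) d :=
    isWeightedHomogeneous_deformationPoly (by ring) (by ring) γ₁ γ₂
  have hk : (d : ℝ) ≠ 0 := by exact_mod_cast hd
  have hr0 : 0 < √t := Real.sqrt_pos.2 ht
  have hrc : ((√t : ℝ) : ℂ) ≠ 0 := by exact_mod_cast hr0.ne'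
  have key : ∀ z, MixedPoly.toFun (MixedPoly.ofComplex f * MixedPoly.conj (MixedPoly.ofComplex g) +
      MixedPoly.const (t : ℂ) * (MixedPoly.z 0 ^ (d + 1) * MixedPoly.zbar 0 +
        MixedPoly.const γ₁ * MixedPoly.z 0 ^ (d + 1 - 1) +
        MixedPoly.const γ₂ * MixedPoly.z 1 ^ (d + 1 - 1))) z =
      perturbedMap f g (deformationPoly d d γ₁ γ₂) (d + 1) 1 t t z := by
    intro z
    simp only [MixedPoly.toFun_add, MixedPoly.toFun_mul, MixedPoly.toFun_conj,
      MixedPoly.toFun_ofComplex, MixedPoly.toFun_const, MixedPoly.toFun_pow, MixedPoly.toFun_z,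
      MixedPoly.toFun_zbar, perturbedMap, eval_deformationPoly, Nat.add_sub_cancel]
    push_cast
    ring
  refine isIndefiniteFold_of_forall_slice one_pos hk hrc
    (lam := ((√t ^ (d + 2) : ℝ) : ℂ)) (by exact_mod_cast (pow_pos hr0 _).ne')
    (MixedPoly.contDiff_toFun _) (contDiff_perturbedMap f g _ (d + 1) 1 1 t)
    (isCircleEquivariant_perturbedMap hf hg hh 1 1 t) (fun z => ?_) (H t ht htt) hw hs
  rw [key, perturbedMap_weightedAct hf hg hh, ← perturbedMap_smul]
  congr 1
  rw [pow_add, Real.sq_sqrt ht.le, mul_one]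

theorem exists_deformation {p q m n : ℕ} (hp : 0 < p) (hq : 0 < q)
    (hn : 0 < n) (hnm : n < m) {f g : MvPolynomial (Fin 2) ℂ}
    (hf : IsWeightedHomogeneous ![q, p] f (p * q * m))
    (hg : IsWeightedHomogeneous ![q, p] g (p * q * n)) (hfc : IsConvenient f)
    (hgc : IsConvenient g) (hiso : ∀ᶠ z in 𝓝[≠] 0, ¬ IsSingularity (mixedMap f g 0) z) :
    ∃ h : MixedPoly, IsDeformationTerm p q m n g h ∧ DeformsToIndefiniteFolds
      (MixedPoly.ofComplex f * MixedPoly.conj (MixedPoly.ofComplex g)) h := by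
  by_cases hlin : IsLinearForm g
  · exact exists_deformation_of_isLinearForm hp hq hn hnm hf hg hfc hgc hiso hlin
  · exact exists_deformation_of_not_isLinearForm hp hq hn hnm hf hg hfc hgc hlin

theorem conj_mixedMap_zero (f g : MvPolynomial (Fin 2) ℂ) :
    mixedMap g f 0 = fun z => (starRingEnd ℂ) (mixedMap f g 0 z) := by
  ext z
  simp [mixedMap, mul_comm]

/-- As t is real, the two deformations are conjugate, and conjugation preserves singularities and
indefinite folds. -/
theorem DeformsToIndefiniteFolds.conj {f g : MvPolynomial (Fin 2) ℂ} {h : MixedPoly}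
    (hdef : DeformsToIndefiniteFolds
      (MixedPoly.ofComplex g * MixedPoly.conj (MixedPoly.ofComplex f)) h) :
    DeformsToIndefiniteFolds
      (MixedPoly.ofComplex f * MixedPoly.conj (MixedPoly.ofComplex g)) (MixedPoly.conj h) := by
  obtain ⟨U, hU, t₀, ht₀, H⟩ := hdef
  refine ⟨U, hU, t₀, ht₀, fun t ht htt w hwU hw hs => ?_⟩
  have key : MixedPoly.toFun (MixedPoly.ofComplex g * MixedPoly.conj (MixedPoly.ofComplex f) +
      MixedPoly.const (t : ℂ) * h) = fun z => (starRingEnd ℂ) (MixedPoly.toFun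
        (MixedPoly.ofComplex f * MixedPoly.conj (MixedPoly.ofComplex g) +
          MixedPoly.const (t : ℂ) * MixedPoly.conj h) z) := by
    ext z
    simp only [MixedPoly.toFun_add, MixedPoly.toFun_mul, MixedPoly.toFun_conj,
      MixedPoly.toFun_const, map_add, map_mul, Complex.conj_conj, Complex.conj_ofReal]
    ring
  have hfold := H t ht htt w hwU hw
  rw [key] at hfold
  exact (hfold ((isSingularity_conj_iff
    ((MixedPoly.contDiff_toFun _).differentiable (by simp) w)).2 hs)).of_conj

theorem theorem1 (p q m n : ℕ) (hp : 0 < p) (hq : 0 < q) (hpq : Nat.Coprime p q)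
    (hm : 0 < m) (hn : 0 < n) (f g : MvPolynomial (Fin 2) ℂ)
    (hf : MvPolynomial.IsWeightedHomogeneous ![q, p] f (p * q * m))
    (hg : MvPolynomial.IsWeightedHomogeneous ![q, p] g (p * q * n))
    (hfc : IsConvenient f) (hgc : IsConvenient g)
    (hiso : IsIsolatedSingularity
      (MixedPoly.toFun (MixedPoly.ofComplex f * MixedPoly.conj (MixedPoly.ofComplex g))) 0) :
    (n < m → ∃ h : MixedPoly, IsDeformationTerm p q m n g h ∧
      DeformsToIndefiniteFolds
        (MixedPoly.ofComplex f * MixedPoly.conj (MixedPoly.ofComplex g)) h) ∧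
    (m < n → ∃ h : MixedPoly, IsDeformationTerm p q n m f h ∧
      DeformsToIndefiniteFolds
        (MixedPoly.ofComplex f * MixedPoly.conj (MixedPoly.ofComplex g)) (MixedPoly.conj h)) := by
  have hiso' := hiso.2
  rw [toFun_mul_conj] at hiso'
  refine ⟨fun hnm => exists_deformation hp hq hn hnm hf hg hfc hgc hiso', fun hmn => ?_⟩
  -- The map g f̄ is the conjugate of f ḡ, so it has the same singularities and the first case
  -- applies with the roles exchanged.
  obtain ⟨h, h1, h2⟩ := exists_deformation hp hq hm hmn hg hf hgc hfc (by
    rw [conj_mixedMap_zero f g]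
    filter_upwards [hiso'] with z hz
    rwa [isSingularity_conj_iff ((contDiff_mixedMap f g 0).differentiable (by simp) z)])
  exact ⟨h, h1, h2.conj⟩
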